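/- A superform of bidegree $(p,q)$ (a $(p,q)$-form) on $\mathbb{R}^n$ is an expression $\alpha=\sum_{|I|=p,|J|=q}\alpha_{IJ}(x)\,dx_I\wedge d\xi_J$, where the sum runs over strictly increasing multi-indices, the coefficients $\alpha_{IJ}$ are real functions of $x\in\mathbb{R}^n$ only, and $dx_1,\dots,dx_n,d\xi_1,\dots,d\xi_n$ anticommute. Put $$d\alpha=\sum_{i,I,J}\partial_i\alpha_{IJ}\,dx_i\wedge dx_I\wedge d\xi_J,\qquad d^{\#}\alpha=\sum_{i,I,J}\partial_i\alpha_{IJ}\,d\xi_i\wedge dx_I\wedge d\xi_J,$$ where $d$ is taken in the sense of distributions when the coefficients are not smooth. An $\mathbb{R}$-Kähler form is a smooth $(1,1)$-form $\omega=\sum_{i,j}\omega_{ij}\,dx_i\wedge d\xi_j$ with $d\omega=0$ whose coefficient matrix $(\omega_{ij}(x))$ is symmetric and positive definite for every $x$. It induces the pointwise inner product on $(p,q)$-forms $$(\alpha,\beta)_\omega=\sum_{I,J,K,L}\alpha_{IJ}\beta_{KL}\,(dx_I,dx_K)\,(d\xi_J,d\xi_L),\qquad (dx_I,dx_K)=(d\xi_I,d\xi_K)=\det(\omega^{ik})_{i\in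 I,k\in K},$$ where $(\omega^{ij})$ is the inverse matrix of $(\omega_{ij})$; write $|\alpha|^2_\omega=(\alpha,\alpha)_\omega$ and $\omega_n=\omega^n/n!$. The integral of an $(n,n)$-form $\gamma=\gamma_0(x)\,c_n\,dx_1\wedge\dots\wedge dx_n\wedge d\xi_1\wedge\dots\wedge d\xi_n$, $c_n=(-1)^{n(n-1)/2}$, is $\int\gamma=\int_{\mathbb{R}^n}\gamma_0(x)\,dx$. For a smooth function $\varphi$ let $\|\alpha\|_\varphi^2=\int|\alpha|_\omega^2e^{-\varphi}\omega_n$, and let $L^2_{p,q,\varphi}$ be the space of $(p,q)$-forms with measurable coefficients and $\|\alpha\|_\varphi<\infty$. Theorem. Let $\omega$ be an $\mathbb{R}$-Kähler form on $\mathbb{R}^n$ and let $\varphi:\mathbb{R}^n\to\mathbb{R}$ be a smooth function such that $dd^{\#}\varphi\ge\varepsilon\omega$ for some $\varepsilon>0$, i.e. the coefficient matrix of $dd^{\#}\varphi-\varepsilon\omega$ is positive semidefinite at every point. Let $p\ge1$ and let $\beta\in L^2_{p,n,\varphi}$ satisfy $d\beta=0$. Then there is an $\alpha\in L^2_{p-1,n,\varphi}$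 such that $$d\alpha=\beta\qquad\text{and}\qquad\|\alpha\|_\varphi^2\le\frac1{p\varepsilon}\,\|\beta\|_\varphi^2 .$$ -/

import Mathlib

open MeasureTheory


namespace SuperForms

/-- The base space `ℝⁿ`, with coordinates `x₁, …, xₙ`. -/
abbrev Base (n : ℕ) : Type := EuclideanSpace ℝ (Fin n)

/-- Superforms of bidegree `(p,q)` at a point: `p`-forms in the `dxᵢ` whose values are `q`-forms in
the `dξⱼ`. The superform `∑ α_{IJ} dx_I ∧ dξ_J` is represented by
`v ↦ (w ↦ ∑ α_{IJ} dx_I(v) * dξ_J(w))`. -/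
abbrev SForm (n p q : ℕ) : Type := (Base n) [⋀^Fin p]→L[ℝ] ((Base n) [⋀^Fin q]→L[ℝ] ℝ)

variable {n p q : ℕ}

/-- The coordinate vectors of `ℝⁿ`. -/
noncomputable def stdVec (i : Fin n) : Base n := EuclideanSpace.single i 1

/-- The coefficient `α_{IJ}` of `dx_I ∧ dξ_J`, where `I` and `J` are strictly increasing
multi-indices. -/
noncomputable def coeff (α : SForm n p q) (I : Fin p ↪o Fin n) (J : Fin q ↪o Fin n) : ℝ :=
  α (fun a => stdVec (I a)) (fun b => stdVec (J b))

/-- The coefficient matrix `(ω_{ij})` of a `(1,1)`-form `∑ ω_{ij} dx_i ∧ dξ_j`. -/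
noncomputable def coeffMatrix (ω : SForm n 1 1) : Matrix (Fin n) (Fin n) ℝ :=
  Matrix.of fun i j => ω (fun _ => stdVec i) (fun _ => stdVec j)

/-- A function, viewed as a superform of bidegree `(0,0)`. -/
noncomputable def ofFun (f : Base n → ℝ) (x : Base n) : SForm n 0 0 :=
  ContinuousAlternatingMap.constOfIsEmpty ℝ (Base n) (Fin 0)
    (ContinuousAlternatingMap.constOfIsEmpty ℝ (Base n) (Fin 0) (f x))

/-- Wedge product on the left with the `(1,0)`-form `a = ∑ aᵢ dxᵢ`. -/
noncomputable def wedgeDx (a : Base n →L[ℝ] ℝ) (α : SForm n p q) : SForm n (p + 1) q :=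
  ContinuousAlternatingMap.alternatizeUncurryFin (a.smulRight α)

/-- `dξ`-alternatization of a linear map into superforms: the linear extension of
`b ⊗ α ↦ b ∧ α`, where `b = ∑ bⱼ dξⱼ`. The sign comes from
`dξⱼ ∧ dx_I ∧ dξ_J = (-1)^p dx_I ∧ dξⱼ ∧ dξ_J`. -/
noncomputable def altXi (f : Base n →L[ℝ] SForm n p q) : SForm n p (q + 1) :=
  (-1 : ℝ) ^ p •
    (ContinuousAlternatingMap.alternatizeUncurryFinCLM ℝ (Base n) ℝ).compContinuousAlternatingMap
      f.flipAlternating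

/-- Wedge product on the left with the `(0,1)`-form `b = ∑ bⱼ dξⱼ`. -/
noncomputable def wedgeDxi (b : Base n →L[ℝ] ℝ) (α : SForm n p q) : SForm n p (q + 1) :=
  altXi (b.smulRight α)

/-- The exterior derivative `d (∑ α_{IJ} dx_I ∧ dξ_J) = ∑ ∂ᵢα_{IJ} dxᵢ ∧ dx_I ∧ dξ_J`. -/
noncomputable def d (α : Base n → SForm n p q) : Base n → SForm n (p + 1) q :=
  extDeriv α

/-- The operator `d^# (∑ α_{IJ} dx_I ∧ dξ_J) = ∑ ∂ᵢα_{IJ} dξᵢ ∧ dx_I ∧ dξ_J`. -/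
noncomputable def dSharp (α : Base n → SForm n p q) (x : Base n) : SForm n p (q + 1) :=
  altXi (fderiv ℝ α x)

/-- The `(1,1)`-form `d d^# f` of a function `f`. -/
noncomputable def ddSharp (f : Base n → ℝ) : Base n → SForm n 1 1 :=
  d (dSharp (ofFun f))

/-- `ℝ`-Kähler forms: smooth, closed `(1,1)`-forms whose coefficient matrix is everywhere
(symmetric and) positive definite. -/
structure IsRKahler (ω : Base n → SForm n 1 1) : Prop where
  smooth : ContDiff ℝ (⊤ : ℕ∞) ω
  closed : d ω = 0
  pos : ∀ x, (coeffMatrix (ω x)).PosDef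

/-- The inequality `η ≥ θ` between `(1,1)`-forms: the coefficient matrix of `η - θ` is positive
semidefinite at every point. -/
def FormGE (η θ : Base n → SForm n 1 1) : Prop :=
  ∀ x, (coeffMatrix (η x - θ x)).PosSemidef

/-- The operator `L α = ω ∧ α` for a `(1,1)`-form `ω = ∑ ω_{ij} dxᵢ ∧ dξⱼ` at a point. -/
noncomputable def wedgeOmega (ω : SForm n 1 1) (α : SForm n p q) : SForm n (p + 1) (q + 1) :=
  ∑ i, ∑ j, coeffMatrix ω i j •
    wedgeDx (EuclideanSpace.proj i : Base n →L[ℝ] ℝ)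
      (wedgeDxi (EuclideanSpace.proj j : Base n →L[ℝ] ℝ) α)

/-- The wedge power `ω^k`. -/
noncomputable def omegaPow (ω : SForm n 1 1) : (k : ℕ) → SForm n k k
  | 0 => ContinuousAlternatingMap.constOfIsEmpty ℝ (Base n) (Fin 0)
      (ContinuousAlternatingMap.constOfIsEmpty ℝ (Base n) (Fin 0) 1)
  | k + 1 => wedgeOmega ω (omegaPow ω k)

/-- The volume form `ω_n = ω^n / n!`. -/
noncomputable def omegaVol (ω : SForm n 1 1) : SForm n n n :=
  ((n.factorial : ℝ)⁻¹) • omegaPow ω n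

/-- The coefficient `γ₀` of an `(n,n)`-form `γ = γ₀ c_n dx ∧ dξ`, with `c_n = (-1)^{n(n-1)/2}`. -/
noncomputable def topCoeff (γ : SForm n n n) : ℝ :=
  (-1 : ℝ) ^ (n * (n - 1) / 2) * γ stdVec stdVec

/-- An `(n,n)`-form is integrable if its coefficient is. -/
def SuperIntegrable (γ : Base n → SForm n n n) : Prop :=
  Integrable (fun x => topCoeff (γ x)) volume

/-- The integral of an `(n,n)`-form: `∫ γ₀(x) c_n dx ∧ dξ = ∫ γ₀(x) dx`. -/
noncomputable def superIntegral (γ : Base n → SForm n n n) : ℝ :=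
  ∫ x, topCoeff (γ x)

/-- The inner product `(dx_I, dx_K)` induced by the `(1,1)`-form `ω`: the minor with rows `I` and
columns `K` of the inverse matrix `(ω^{ij})` of `(ω_{ij})`. It is also `(dξ_I, dξ_K)`. -/
noncomputable def gram (ω : SForm n 1 1) (I K : Fin p ↪o Fin n) : ℝ :=
  ((coeffMatrix ω)⁻¹.submatrix I K).det

/-- The pointwise inner product of `(p,q)`-forms induced by `ω`: the bilinear form with
`(dx_I ∧ dξ_J, dx_K ∧ dξ_L) = (dx_I, dx_K) (dξ_J, dξ_L)`. In coordinates in which `(ω_{ij})` is the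
identity matrix it is `∑ α_{IJ} β_{IJ}`. -/
noncomputable def pInner (ω : SForm n 1 1) (α β : SForm n p q) : ℝ :=
  ∑ I, ∑ J, ∑ K, ∑ L, coeff α I J * coeff β K L * (gram ω I K * gram ω J L)

/-- The `(n,n)`-form `|α|²_ω e^{-φ} ω_n`. -/
noncomputable def normDensity (ω : Base n → SForm n 1 1) (φ : Base n → ℝ)
    (α : Base n → SForm n p q) (x : Base n) : SForm n n n :=
  (pInner (ω x) (α x) (α x) * Real.exp (-φ x)) • omegaVol (ω x)

/-- Membership in the weighted space `L²_{p,q,φ}(ω)`: the coefficients are measurable and `‖α‖²_φ`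
is finite. -/
structure MemL2 (ω : Base n → SForm n 1 1) (φ : Base n → ℝ)
    (α : Base n → SForm n p q) : Prop where
  aestronglyMeasurable : ∀ I J, AEStronglyMeasurable (fun x => coeff (α x) I J) volume
  integrable : SuperIntegrable (normDensity ω φ α)

/-- The squared weighted norm `‖α‖²_φ = ∫ |α|²_ω e^{-φ} ω_n`. -/
noncomputable def normSq (ω : Base n → SForm n 1 1) (φ : Base n → ℝ)
    (α : Base n → SForm n p q) : ℝ :=
  superIntegral (normDensity ω φ α)

/-- `dα = β` in the sense of distributions, for superforms with locally integrable coefficients: for every test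
function `η`, the coefficients of `∫ dη ∧ α` and `-∫ η β` agree. -/
structure IsWeakD (α : Base n → SForm n p q) (β : Base n → SForm n (p + 1) q) : Prop where
  locallyIntegrable_left : ∀ I J, LocallyIntegrable (fun x => coeff (α x) I J) volume
  locallyIntegrable_right : ∀ I J, LocallyIntegrable (fun x => coeff (β x) I J) volume
  integral_eq : ∀ η : Base n → ℝ, ContDiff ℝ (⊤ : ℕ∞) η → HasCompactSupport η →
    ∀ (v : Fin (p + 1) → Base n) (w : Fin q → Base n),
      ∫ x, wedgeDx (fderiv ℝ η x) (α x) v w = -∫ x, η x * β x v w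

end SuperForms

open SuperForms

/-!
The proof is Hörmander's `L²` method, carried out on components.

A `(p,n)`-form has a single `dξ`-component, so it amounts to an alternating tensor field with `p`
indices. Its `dξ`-part has squared length `1 / det ω`, which cancels the volume density `det ω`; hence
`‖α‖²` is `1 / p!` times the integral of `e^{-φ}` times the squared length of the tensor in the
inverse metric `ω⁻¹` (`normSq_eq`). Write `P` for the matrix field of this weighted inner product on
tensors with `p + 1` indices (`weight`). Tensors are indexed by all tuples, not only the increasing
ones, and `tpow` is the induced metric.

By the Riesz representation theorem (`weighted_riesz`) it is enough to show
`(∫ β · W)² ≤ ε⁻¹ ‖β‖² ∫ e^φ |div W|²` for all smooth compactly supported alternating multivector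
fields `W` (`sq_integral_le`). To this end `P⁻¹ W` is projected orthogonally to the closed subspace of
weakly closed alternating fields (`weighted_projection`, `exists_alternating_representative`). Its
projection `u` has the same inner product with `β` as `P⁻¹ W`, and `P u` has the same weak divergence
as `W`, because exact forms `d (η dx_K)` are admissible test fields. It remains to bound
`ε ‖u‖² ≤ ∫ e^φ |div W|²` (`apriori_of_bounded_below`).

For smooth compactly supported fields such a bound, with an additional term for the exterior
derivative, is the Bochner inequality (`bochner_inequality`). It rests on the identity
`sum_pd_bochnerFlux`, in which the Hessian of `φ` appears and, although the metric is not constant,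
none of its derivatives: since `dω = 0`, these are symmetric in three indices, and they are contracted
with alternating tensors. The bound passes to a weakly closed `u` with `P u` of weak divergence `div W`
by cutoff functions and mollification, the commutators being controlled by `tendsto_friedrichs`. The
error terms of the cutoff vanish in the limit when the metric is bounded below by a constant one. In
general, `δ` times the flat metric is added to `ω` and `ε δ |x|² / 2` to `φ`
(`WeightedHessianMetric.add_flat`), and `δ` tends to zero.

The factor `1 / (p + 1)` for forms of degree `p + 1` comes from the normalization: the primitive is
`1 / (p + 1)` times the alternating part of the solution `u` of the dual equation
(`integral_dual_solution`), and `‖α‖²` and `‖β‖²` carry the factors `1 / p!` and `1 / (p + 1)!`.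
-/

open Matrix Filter Topology
open scoped ENNReal NNReal

namespace SuperForms

variable {n p q m : ℕ}

/-! ### Tensor powers of matrices -/

/-- The tensor power `A ⊗ ⋯ ⊗ A` of a matrix, indexed by multi-indices that need not be increasing. -/
def tpow (A : Matrix (Fin n) (Fin n) ℝ) (m : ℕ) : Matrix (Fin m → Fin n) (Fin m → Fin n) ℝ :=
  Matrix.of fun I K => ∏ a, A (I a) (K a)

lemma tpow_apply (A : Matrix (Fin n) (Fin n) ℝ) (I K : Fin m → Fin n) :
    tpow A m I K = ∏ a, A (I a) (K a) := rfl

lemma tpow_mul (A B : Matrix (Fin n) (Fin n) ℝ) (m : ℕ) :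
    tpow (A * B) m = tpow A m * tpow B m := by
  ext I K
  simp only [tpow_apply, Matrix.mul_apply, Fintype.prod_sum, Finset.prod_mul_distrib]

lemma tpow_one (m : ℕ) : tpow (1 : Matrix (Fin n) (Fin n) ℝ) m = 1 := by
  ext I K
  simp only [tpow_apply, Matrix.one_apply, Finset.prod_boole, Finset.mem_univ, true_imp_iff,
    funext_iff]

lemma tpow_transpose (A : Matrix (Fin n) (Fin n) ℝ) (m : ℕ) : tpow Aᵀ m = (tpow A m)ᵀ := rfl

lemma tpow_cons (A : Matrix (Fin n) (Fin n) ℝ) (i k : Fin n) (I K : Fin m → Fin n) :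
    tpow A (m + 1) (Fin.cons i I) (Fin.cons k K) = A i k * tpow A m I K := by
  simp [tpow_apply, Fin.prod_univ_succ]

lemma tpow_comp_perm (A : Matrix (Fin n) (Fin n) ℝ) (I K : Fin m → Fin n)
    (σ : Equiv.Perm (Fin m)) : tpow A m (I ∘ σ) (K ∘ σ) = tpow A m I K :=
  Equiv.prod_comp σ fun a => A (I a) (K a)

lemma tpow_isSymm {A : Matrix (Fin n) (Fin n) ℝ} (hA : A.IsSymm) (m : ℕ) : (tpow A m).IsSymm := by
  rw [Matrix.IsSymm, ← tpow_transpose, hA.eq]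

/-- Over the reals, semidefiniteness includes symmetry. -/
lemma posSemidef_isSymm {ι : Type*} [Fintype ι] {A : Matrix ι ι ℝ} (hA : A.PosSemidef) :
    A.IsSymm := by
  have h := hA.isHermitian
  rwa [Matrix.IsHermitian, conjTranspose_eq_transpose_of_trivial] at h

lemma posDef_isSymm {ι : Type*} [Fintype ι] {A : Matrix ι ι ℝ} (hA : A.PosDef) : A.IsSymm :=
  posSemidef_isSymm hA.posSemidef

lemma quad_eq_sum {ι : Type*} [Fintype ι] (M : Matrix ι ι ℝ) (u v : ι → ℝ) :
    u ⬝ᵥ M *ᵥ v = ∑ i, ∑ k, M i k * u i * v k := by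
  simp only [dotProduct, mulVec, Finset.mul_sum]
  exact Finset.sum_congr rfl fun i _ => Finset.sum_congr rfl fun k _ => by ring

lemma quad_comm {ι : Type*} [Fintype ι] {M : Matrix ι ι ℝ} (hM : M.IsSymm) (u v : ι → ℝ) :
    u ⬝ᵥ M *ᵥ v = v ⬝ᵥ M *ᵥ u := by
  rw [dotProduct_mulVec, ← mulVec_transpose, hM.eq, dotProduct_comm]

lemma quad_nonneg {ι : Type*} [Fintype ι] {M : Matrix ι ι ℝ} (hM : M.PosSemidef) (u : ι → ℝ) :
    0 ≤ u ⬝ᵥ M *ᵥ u := by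
  simpa using hM.dotProduct_mulVec_nonneg u

lemma tpow_posSemidef {A : Matrix (Fin n) (Fin n) ℝ} (hA : A.PosSemidef) (m : ℕ) :
    (tpow A m).PosSemidef := by
  classical
  obtain ⟨B, rfl⟩ : ∃ B : Matrix (Fin n) (Fin n) ℝ, A = Bᴴ * B := by
    open scoped MatrixOrder in
    exact CStarAlgebra.nonneg_iff_eq_star_mul_self.mp hA.nonneg
  rw [conjTranspose_eq_transpose_of_trivial, tpow_mul, tpow_transpose,
    ← conjTranspose_eq_transpose_of_trivial]
  exact posSemidef_conjTranspose_mul_self _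

lemma tpow_mul_inv {A : Matrix (Fin n) (Fin n) ℝ} (hA : A.PosDef) (m : ℕ) :
    tpow A m * tpow A⁻¹ m = 1 := by
  rw [← tpow_mul, mul_nonsing_inv _ ((isUnit_iff_isUnit_det _).mp hA.isUnit), tpow_one]

lemma tpow_inv_mul {A : Matrix (Fin n) (Fin n) ℝ} (hA : A.PosDef) (m : ℕ) :
    tpow A⁻¹ m * tpow A m = 1 := by
  rw [← tpow_mul, nonsing_inv_mul _ ((isUnit_iff_isUnit_det _).mp hA.isUnit), tpow_one]

lemma tpow_posDef {A : Matrix (Fin n) (Fin n) ℝ} (hA : A.PosDef) (m : ℕ) : (tpow A m).PosDef := by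
  rw [(tpow_posSemidef hA.posSemidef m).posDef_iff_isUnit]
  exact IsUnit.of_mul_eq_one _ (tpow_mul_inv hA m)

/-- The Kronecker product of two positive semidefinite matrices is positive semidefinite, in the form
in which it is applied to a tensor with one index split off. -/
lemma sum_quad_nonneg {ι κ : Type*} [Fintype ι] [Fintype κ] {M : Matrix ι ι ℝ}
    {N : Matrix κ κ ℝ} (hM : M.PosSemidef) (hN : N.PosSemidef) (u : ι → κ → ℝ) :
    0 ≤ ∑ i, ∑ k, M i k * (u i ⬝ᵥ N *ᵥ u k) := by
  classical
  obtain ⟨R, rfl⟩ : ∃ R : Matrix ι ι ℝ, M = Rᴴ * R := by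
    open scoped MatrixOrder in
    exact CStarAlgebra.nonneg_iff_eq_star_mul_self.mp hM.nonneg
  have key : ∑ i, ∑ k, (Rᴴ * R) i k * (u i ⬝ᵥ N *ᵥ u k)
      = ∑ r, (∑ i, R r i • u i) ⬝ᵥ N *ᵥ (∑ i, R r i • u i) := by
    have h1 : ∀ r, (∑ i, R r i • u i) ⬝ᵥ N *ᵥ (∑ i, R r i • u i)
        = ∑ i, ∑ k, R r i * R r k * (u i ⬝ᵥ N *ᵥ u k) := fun r => by
      rw [mulVec_sum, sum_dotProduct]
      refine Finset.sum_congr rfl fun i _ => ?_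
      rw [dotProduct_sum]
      refine Finset.sum_congr rfl fun k _ => ?_
      rw [mulVec_smul, smul_dotProduct, dotProduct_smul, smul_eq_mul, smul_eq_mul, mul_assoc]
    simp only [h1, mul_apply, conjTranspose_apply, star_trivial, Finset.sum_mul]
    rw [Finset.sum_congr rfl fun i _ => Finset.sum_comm, Finset.sum_comm]
  rw [key]
  exact Finset.sum_nonneg fun r _ => quad_nonneg hN _

lemma sum_cons {M : Type*} [AddCommMonoid M] (f : (Fin (m + 1) → Fin n) → M) :
    ∑ I, f I = ∑ k, ∑ K : Fin m → Fin n, f (Fin.cons k K) := by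
  rw [← (Fin.consEquiv fun _ => Fin n).sum_comp, Fintype.sum_prod_type]
  rfl

/-- Splitting off the first tensor factor. -/
lemma quad_tpow_succ (A : Matrix (Fin n) (Fin n) ℝ) (u v : (Fin (m + 1) → Fin n) → ℝ) :
    u ⬝ᵥ tpow A (m + 1) *ᵥ v = ∑ k, ∑ l, A k l *
      ((fun K => u (Fin.cons k K)) ⬝ᵥ tpow A m *ᵥ (fun K => v (Fin.cons l K))) := by
  simp only [quad_eq_sum, sum_cons, tpow_cons, Finset.mul_sum]
  refine Finset.sum_congr rfl fun k _ => ?_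
  rw [Finset.sum_comm]
  exact Finset.sum_congr rfl fun _ _ => Finset.sum_congr rfl fun _ _ =>
    Finset.sum_congr rfl fun _ _ => by ring

/-- Tensor powers are monotone on positive semidefinite matrices. -/
lemma quad_tpow_mono {A B : Matrix (Fin n) (Fin n) ℝ} (hA : A.PosSemidef)
    (hAB : (B - A).PosSemidef) (u : (Fin m → Fin n) → ℝ) :
    u ⬝ᵥ tpow A m *ᵥ u ≤ u ⬝ᵥ tpow B m *ᵥ u := by
  have hB : B.PosSemidef := by simpa using hAB.add hA
  induction m with
  | zero => simp [quad_eq_sum, tpow_apply]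
  | succ m ih =>
    rw [quad_tpow_succ, quad_tpow_succ]
    -- `B ⊗ B' - A ⊗ A' = (B - A) ⊗ B' + A ⊗ (B' - A')`
    have h1 := sum_quad_nonneg hAB (tpow_posSemidef hB m) fun k K => u (Fin.cons k K)
    simp only [Matrix.sub_apply, sub_mul, Finset.sum_sub_distrib] at h1
    have h2 : (tpow B m - tpow A m).PosSemidef := by
      refine PosSemidef.of_dotProduct_mulVec_nonneg ?_ fun x => ?_
      · exact (tpow_posSemidef hB m).isHermitian.sub (tpow_posSemidef hA m).isHermitian
      · simpa [sub_mulVec, dotProduct_sub] using ih x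
    have h3 := sum_quad_nonneg hA h2 fun k K => u (Fin.cons k K)
    simp only [sub_mulVec, dotProduct_sub, mul_sub, Finset.sum_sub_distrib] at h3
    linarith

/-- Inversion reverses the order of positive definite matrices. -/
lemma inv_sub_inv_posSemidef {ι : Type*} [Fintype ι] [DecidableEq ι] {A B : Matrix ι ι ℝ}
    (hA : A.PosDef) (hB : B.PosDef) (hAB : (B - A).PosSemidef) : (A⁻¹ - B⁻¹).PosSemidef := by
  refine PosSemidef.of_dotProduct_mulVec_nonneg
    (hA.inv.isHermitian.sub hB.inv.isHermitian) fun x => ?_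
  -- with `y = B⁻¹ x`, expand `0 ≤ A (A⁻¹ x - y, A⁻¹ x - y)` and use `A (y, y) ≤ B (y, y)`
  set y := B⁻¹ *ᵥ x with hy
  have hBy : B *ᵥ y = x := by
    rw [hy, mulVec_mulVec, mul_nonsing_inv _ ((isUnit_iff_isUnit_det _).mp hB.isUnit), one_mulVec]
  have hAx : A *ᵥ (A⁻¹ *ᵥ x) = x := by
    rw [mulVec_mulVec, mul_nonsing_inv _ ((isUnit_iff_isUnit_det _).mp hA.isUnit), one_mulVec]
  have h1 := quad_nonneg hA.posSemidef (A⁻¹ *ᵥ x - y)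
  have h2 := quad_nonneg hAB y
  have h3 : (A⁻¹ *ᵥ x) ⬝ᵥ A *ᵥ y = x ⬝ᵥ y := by
    rw [quad_comm (posDef_isSymm hA), hAx, dotProduct_comm]
  simp only [sub_mulVec, mulVec_sub, dotProduct_sub, sub_dotProduct, hBy, hAx, star_trivial, h3]
    at h1 h2 ⊢
  rw [dotProduct_comm y x] at h1 h2
  rw [dotProduct_comm (A⁻¹ *ᵥ x) x] at h1
  linarith

/-- Cauchy–Schwarz for a positive semidefinite form, in additive form. -/
lemma quad_add_le {ι : Type*} [Fintype ι] {M : Matrix ι ι ℝ} (hM : M.PosSemidef) (u v : ι → ℝ)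
    {θ : ℝ} (hθ : 0 < θ) :
    (u + v) ⬝ᵥ M *ᵥ (u + v) ≤ (1 + θ) * (u ⬝ᵥ M *ᵥ u) + (1 + θ⁻¹) * (v ⬝ᵥ M *ᵥ v) := by
  have hs : M.IsSymm := posSemidef_isSymm hM
  have h := quad_nonneg hM (θ • u - v)
  have h' : 0 ≤ θ⁻¹ * ((θ • u - v) ⬝ᵥ M *ᵥ (θ • u - v)) := mul_nonneg (by positivity) h
  simp only [mulVec_sub, mulVec_add, dotProduct_sub, sub_dotProduct, dotProduct_add,
    add_dotProduct, mulVec_smul, smul_dotProduct, dotProduct_smul, smul_eq_mul,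
    quad_comm hs v u] at h' ⊢
  have : θ⁻¹ * θ = 1 := inv_mul_cancel₀ hθ.ne'
  have h3 : θ⁻¹ * (θ * (θ * u ⬝ᵥ M *ᵥ u - u ⬝ᵥ M *ᵥ v) - (θ * u ⬝ᵥ M *ᵥ v - v ⬝ᵥ M *ᵥ v))
    = (θ⁻¹ * θ) * (θ * u ⬝ᵥ M *ᵥ u) - 2 * (θ⁻¹ * θ) * u ⬝ᵥ M *ᵥ v + θ⁻¹ * v ⬝ᵥ M *ᵥ v := by ring
  rw [h3, this] at h'
  linarith

/-! ### Alternating tensors -/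

/-- A function of multi-indices is alternating: these are the components of forms and of
multivector fields. -/
def IsAlt (u : (Fin m → Fin n) → ℝ) : Prop :=
  ∀ (σ : Equiv.Perm (Fin m)) (I : Fin m → Fin n),
    u (I ∘ σ) = ((Equiv.Perm.sign σ : ℤ) : ℝ) * u I

lemma IsAlt.mulVec_tpow {u : (Fin m → Fin n) → ℝ} (hu : IsAlt u) (A : Matrix (Fin n) (Fin n) ℝ) :
    IsAlt (tpow A m *ᵥ u) := by
  intro σ I
  simp only [mulVec, dotProduct, Finset.mul_sum]
  rw [← (Equiv.arrowCongr σ.symm (Equiv.refl (Fin n))).sum_comp]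
  refine Finset.sum_congr rfl fun K _ => ?_
  have : (Equiv.arrowCongr σ.symm (Equiv.refl (Fin n))) K = K ∘ σ := by ext; simp
  rw [this, tpow_comp_perm, hu σ K]
  ring

lemma IsAlt.swap {u : (Fin m → Fin n) → ℝ} (hu : IsAlt u) {a b : Fin m} (hab : a ≠ b)
    (I : Fin m → Fin n) : u (I ∘ Equiv.swap a b) = - u I := by
  rw [hu, Equiv.Perm.sign_swap hab]
  simp

lemma IsAlt.add {u v : (Fin m → Fin n) → ℝ} (hu : IsAlt u) (hv : IsAlt v) : IsAlt (u + v) :=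
  fun σ I => by simp only [Pi.add_apply, hu σ I, hv σ I]; ring

lemma IsAlt.smul {u : (Fin m → Fin n) → ℝ} (hu : IsAlt u) (c : ℝ) : IsAlt (c • u) :=
  fun σ I => by simp only [Pi.smul_apply, smul_eq_mul, hu σ I]; ring

lemma cons_comp_swap_succ (k : Fin n) (I : Fin m → Fin n) (a b : Fin m) :
    (Fin.cons k I : Fin (m + 1) → Fin n) ∘ Equiv.swap a.succ b.succ
      = Fin.cons k (I ∘ Equiv.swap a b) := by
  ext c
  refine Fin.cases ?_ (fun c => ?_) c
  · rw [Function.comp_apply, Equiv.swap_apply_of_ne_of_ne (Fin.succ_ne_zero _).symm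
      (Fin.succ_ne_zero _).symm]
    simp
  · simp only [Function.comp_apply, Fin.cons_succ]
    rw [← (Fin.succ_injective m).map_swap, Fin.cons_succ]

lemma cons_cons_comp_swap (k l : Fin n) (K : Fin m → Fin n) :
    (Fin.cons k (Fin.cons l K : Fin (m + 1) → Fin n) : Fin (m + 2) → Fin n) ∘
      Equiv.swap 0 (Fin.succ 0) = Fin.cons l (Fin.cons k K : Fin (m + 1) → Fin n) := by
  ext c
  refine Fin.cases ?_ (fun c => Fin.cases ?_ (fun c => ?_) c) c
  · rw [Function.comp_apply, Equiv.swap_apply_left]; simp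
  · rw [Function.comp_apply, Equiv.swap_apply_right]; simp
  · rw [Function.comp_apply, Equiv.swap_apply_of_ne_of_ne (Fin.succ_ne_zero _)
      (fun h => Fin.succ_ne_zero _ (Fin.succ_injective _ h))]
    simp

section GeneralizedDelta

/-- The generalized Kronecker delta `δ_{IJ}`, the component `(dx_J)_I` of the form `dx_J`. -/
def gdelta (I J : Fin m → Fin n) : ℝ :=
  (Matrix.of fun a b => if I a = J b then (1 : ℝ) else 0).det

lemma gdelta_comm (I J : Fin m → Fin n) : gdelta I J = gdelta J I := by
  rw [gdelta, ← det_transpose, gdelta]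
  congr 1
  ext a b
  simp [eq_comm]

lemma gdelta_isAlt (J : Fin m → Fin n) : IsAlt (fun I => gdelta I J) := fun σ I =>
  det_permute σ (Matrix.of fun a b => if I a = J b then (1 : ℝ) else 0)

lemma gdelta_isAlt_right (I : Fin m → Fin n) : IsAlt (gdelta I) := by
  have : gdelta I = fun J => gdelta J I := funext fun J => gdelta_comm I J
  rw [this]
  exact gdelta_isAlt I

/-- Contraction with the generalized delta is `m!` times the antisymmetrization, so it multiplies an
alternating tensor by `m!`. -/
lemma sum_mul_gdelta {u : (Fin m → Fin n) → ℝ} (hu : IsAlt u) (J : Fin m → Fin n) :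
    ∑ I, u I * gdelta I J = m.factorial * u J := by
  have h1 : ∀ I, gdelta I J = ∑ σ : Equiv.Perm (Fin m), ((Equiv.Perm.sign σ : ℤ) : ℝ) *
      if I ∘ σ = J then 1 else 0 := by
    intro I
    rw [gdelta, det_apply']
    refine Finset.sum_congr rfl fun σ _ => ?_
    simp only [of_apply, Finset.prod_boole, Finset.mem_univ, true_imp_iff, funext_iff,
      Function.comp_apply]
  simp only [h1, Finset.mul_sum]
  rw [Finset.sum_comm]
  have h2 : ∀ σ : Equiv.Perm (Fin m), ∑ I, u I * (((Equiv.Perm.sign σ : ℤ) : ℝ) *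
      if I ∘ σ = J then (1 : ℝ) else 0) = u J := by
    intro σ
    rw [Finset.sum_eq_single (J ∘ σ.symm)]
    · have : (J ∘ σ.symm) ∘ σ = J := by ext; simp
      rw [if_pos this, mul_one]
      conv_rhs => rw [← this, hu σ]
      ring
    · intro I _ hI
      rw [if_neg]
      · ring
      · rintro rfl
        exact hI (by ext; simp)
    · simp
  simp only [h2, Finset.sum_const, Finset.card_univ, Fintype.card_perm, Fintype.card_fin,
    nsmul_eq_mul]

/-- Laplace expansion of the generalized delta along its first row. -/
lemma gdelta_cons_left (k : Fin n) (K : Fin m → Fin n) (J : Fin (m + 1) → Fin n) :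
    gdelta (Fin.cons k K) J
      = ∑ b : Fin (m + 1), (-1) ^ (b : ℕ) * (if k = J b then 1 else 0) *
        gdelta K (J ∘ b.succAbove) := by
  rw [gdelta, det_succ_row_zero]
  rfl

lemma gdelta_cons_right (J : Fin (m + 1) → Fin n) (l : Fin n) (L : Fin m → Fin n) :
    gdelta J (Fin.cons l L)
      = ∑ a : Fin (m + 1), (-1) ^ (a : ℕ) * (if l = J a then 1 else 0) *
        gdelta (J ∘ a.succAbove) L := by
  rw [gdelta_comm, gdelta_cons_left]
  simp only [gdelta_comm L]

lemma gdelta_cons_cons_swap (J : Fin (m + 2) → Fin n) (k l : Fin n) (K : Fin m → Fin n) :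
    gdelta J (Fin.cons k (Fin.cons l K : Fin (m + 1) → Fin n))
      = - gdelta J (Fin.cons l (Fin.cons k K : Fin (m + 1) → Fin n)) := by
  rw [← cons_cons_comp_swap l k K,
    (gdelta_isAlt_right J).swap (Fin.succ_ne_zero (0 : Fin (m + 1))).symm]

end GeneralizedDelta

section SwapSum

/-- The exterior derivative at the level of components: if `X_{l I}` is alternating in `I`, then
`swapSum X` is the alternating sum of `X` over the position of its first index. It
is written with transpositions, which all have sign `-1`; `swapSum_eq_sum` is the usual formula. -/
def swapSum (X : (Fin (m + 2) → Fin n) → ℝ) (J : Fin (m + 2) → Fin n) : ℝ :=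
  X J - ∑ a : Fin (m + 1), X (J ∘ Equiv.swap 0 a.succ)

lemma swapSum_add (X Z : (Fin (m + 2) → Fin n) → ℝ) :
    swapSum (X + Z) = swapSum X + swapSum Z := by
  ext J
  simp only [swapSum, Pi.add_apply, Finset.sum_add_distrib]
  ring

lemma swapSum_smul (c : ℝ) (X : (Fin (m + 2) → Fin n) → ℝ) :
    swapSum (c • X) = c • swapSum X := by
  ext J
  simp only [swapSum, Pi.smul_apply, smul_eq_mul, ← Finset.mul_sum]
  ring

lemma quad_tpow_comp_perm (H : Matrix (Fin n) (Fin n) ℝ) (σ : Equiv.Perm (Fin m))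
    (u v : (Fin m → Fin n) → ℝ) :
    (fun I => u (I ∘ σ)) ⬝ᵥ tpow H m *ᵥ (fun I => v (I ∘ σ)) = u ⬝ᵥ tpow H m *ᵥ v := by
  have hK : ∀ K, (Equiv.arrowCongr σ.symm (Equiv.refl (Fin n))) K = K ∘ σ := fun K => by ext; simp
  have h1 : ∀ f : (Fin m → Fin n) → ℝ, ∑ K, f K = ∑ K, f (K ∘ σ) := fun f => by
    rw [← (Equiv.arrowCongr σ.symm (Equiv.refl (Fin n))).sum_comp]
    simp only [hK]
  rw [quad_eq_sum, quad_eq_sum, h1 fun I => ∑ K, tpow H m I K * u I * v K]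
  refine Finset.sum_congr rfl fun I _ => ?_
  rw [h1 fun K => tpow H m (I ∘ σ) K * u (I ∘ σ) * v K]
  simp only [tpow_comp_perm]

/-- All the transpositions that move the first index contribute equally. -/
lemma quad_swap_eq (H : Matrix (Fin n) (Fin n) ℝ) {X : (Fin (m + 2) → Fin n) → ℝ}
    (hX : ∀ l, IsAlt fun I => X (Fin.cons l I)) (a : Fin (m + 1)) :
    X ⬝ᵥ tpow H (m + 2) *ᵥ (fun J => X (J ∘ Equiv.swap 0 a.succ))
      = X ⬝ᵥ tpow H (m + 2) *ᵥ (fun J => X (J ∘ Equiv.swap 0 (Fin.succ 0))) := by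
  rcases eq_or_ne a 0 with rfl | ha
  · rfl
  have hX' : ∀ J, X (J ∘ Equiv.swap (Fin.succ 0) a.succ) = - X J := by
    intro J
    conv_lhs => rw [← Fin.cons_self_tail J, cons_comp_swap_succ]
    rw [(hX (J 0)).swap ha.symm, Fin.cons_self_tail]
  rw [← quad_tpow_comp_perm H (Equiv.swap (Fin.succ 0) a.succ)]
  have h1 : ∀ J : Fin (m + 2) → Fin n,
      (J ∘ Equiv.swap (Fin.succ 0) a.succ) ∘ Equiv.swap 0 a.succ
        = (J ∘ Equiv.swap 0 (Fin.succ 0)) ∘ Equiv.swap (Fin.succ 0) a.succ := by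
    intro J
    rw [Function.comp_assoc, Function.comp_assoc]
    congr 1
    have h2 : Equiv.swap (Fin.succ 0) a.succ * Equiv.swap 0 a.succ
        = Equiv.swap 0 (Fin.succ 0) * Equiv.swap (Fin.succ 0) a.succ := by
      have := Equiv.swap_mul_swap_mul_swap (x := (0 : Fin (m + 2))) (y := a.succ)
        (z := Fin.succ 0) (Fin.succ_ne_zero _).symm (Fin.succ_ne_zero (0 : Fin (m+1))).symm
      rw [Equiv.swap_comm a.succ] at this
      rw [Equiv.swap_comm (Fin.succ 0) 0] at this
      rw [← this, mul_assoc _ _ (Equiv.swap (Fin.succ 0) a.succ), Equiv.swap_mul_self, mul_one]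
    exact congrArg DFunLike.coe h2
  simp only [h1, hX']
  simp [mulVec_neg, ← Pi.neg_def]

/-- The inner product of a tensor with its alternating sum: one square, and a cross term in which the
first two indices are exchanged. -/
lemma quad_swapSum (H : Matrix (Fin n) (Fin n) ℝ) {X : (Fin (m + 2) → Fin n) → ℝ}
    (hX : ∀ l, IsAlt fun I => X (Fin.cons l I)) :
    X ⬝ᵥ tpow H (m + 2) *ᵥ swapSum X = X ⬝ᵥ tpow H (m + 2) *ᵥ X
      - (m + 1) * (X ⬝ᵥ tpow H (m + 2) *ᵥ (fun J => X (J ∘ Equiv.swap 0 (Fin.succ 0)))) := by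
  have : swapSum X = X - ∑ a : Fin (m + 1), fun J => X (J ∘ Equiv.swap 0 a.succ) := by
    ext J; simp [swapSum]
  rw [this, mulVec_sub, dotProduct_sub, mulVec_sum, dotProduct_sum,
    Finset.sum_congr rfl fun a _ => quad_swap_eq H hX a]
  simp

end SwapSum

/-! ### Pointwise inequalities for alternating tensors -/

/-- The derivative of the tensor power of `A` when the derivative of `A` is `A'`. -/
def tpowDeriv (A A' : Matrix (Fin n) (Fin n) ℝ) (m : ℕ) :
    Matrix (Fin m → Fin n) (Fin m → Fin n) ℝ :=
  Matrix.of fun I K => ∑ b, A' (I b) (K b) * ∏ c ∈ Finset.univ.erase b, A (I c) (K c)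

/-- Contraction of a differentiated index with the indices of an alternating tensor gives zero
when the derivatives of the metric are symmetric in all indices. -/
lemma sum_tpowDeriv_mul_eq_zero {A : Matrix (Fin n) (Fin n) ℝ}
    {A' : Fin n → Matrix (Fin n) (Fin n) ℝ} (hA' : ∀ k i j, A' k i j = A' i k j)
    {u : (Fin (m + 1) → Fin n) → ℝ} (hu : IsAlt u) (K' : Fin m → Fin n) :
    ∑ k, ∑ K, tpowDeriv A (A' k) m K K' * u (Fin.cons k K) = 0 := by
  have h1 : ∑ k, ∑ K, tpowDeriv A (A' k) m K K' * u (Fin.cons k K)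
      = ∑ b : Fin m, ∑ J : Fin (m + 1) → Fin n, (A' (J 0) (J b.succ) (K' b) *
        ∏ c ∈ Finset.univ.erase b, A (J c.succ) (K' c)) * u J := by
    simp only [sum_cons, tpowDeriv, of_apply, Finset.sum_mul, Fin.cons_zero, Fin.cons_succ]
    rw [Finset.sum_comm]
    conv_rhs => rw [Finset.sum_comm]; enter [2, k]; rw [Finset.sum_comm]
    rw [Finset.sum_comm]
  rw [h1]
  refine Finset.sum_eq_zero fun b _ => ?_
  set e : (Fin (m + 1) → Fin n) ≃ (Fin (m + 1) → Fin n) :=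
    Equiv.arrowCongr (Equiv.swap 0 b.succ) (Equiv.refl (Fin n)) with he
  have heJ : ∀ J, e J = J ∘ Equiv.swap 0 b.succ := fun J => by ext; simp [he]
  -- exchanging the first index with the differentiated one changes the sign of the sum
  have h2 : ∀ f : (Fin (m + 1) → Fin n) → ℝ, (∀ J, f (e J) = - f J) → ∑ J, f J = 0 := by
    intro f hf
    have h := e.sum_comp f
    rw [Finset.sum_congr rfl fun J _ => hf J, Finset.sum_neg_distrib] at h
    linarith
  refine h2 _ fun J => ?_
  rw [heJ, hu.swap (Fin.succ_ne_zero b).symm]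
  have h3 : ∏ c ∈ Finset.univ.erase b, A ((J ∘ Equiv.swap 0 b.succ) c.succ) (K' c)
      = ∏ c ∈ Finset.univ.erase b, A (J c.succ) (K' c) := by
    refine Finset.prod_congr rfl fun c hc => ?_
    rw [Function.comp_apply, Equiv.swap_apply_of_ne_of_ne (Fin.succ_ne_zero c)
      (fun h => Finset.ne_of_mem_erase hc (Fin.succ_injective _ h))]
  rw [h3, Function.comp_apply, Function.comp_apply, Equiv.swap_apply_left,
    Equiv.swap_apply_right, hA']
  ring

/-- The terms in which the metric is differentiated do not contribute to the exterior derivative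
of the form obtained by lowering the indices of a multivector field `u`: this is where the closedness
of the Kähler form enters. -/
lemma swapSum_tpowDeriv_eq_zero {A : Matrix (Fin n) (Fin n) ℝ}
    {A' : Fin n → Matrix (Fin n) (Fin n) ℝ} (hA' : ∀ k i j, A' k i j = A' i k j)
    {u : (Fin (m + 1) → Fin n) → ℝ} (hu : IsAlt u) :
    swapSum (fun J : Fin (m + 2) → Fin n =>
      (tpowDeriv A (A' (J 0)) (m + 1) *ᵥ u) (Fin.tail J)) = 0 := by
  -- the part of the sum in which the factor `b` is differentiated
  set Z : Fin (m + 1) → (Fin (m + 2) → Fin n) → ℝ := fun b J =>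
    ∑ K, A' (J 0) (J b.succ) (K b) * (∏ c ∈ Finset.univ.erase b, A (J c.succ) (K c)) * u K with hZ
  have hX : ∀ J : Fin (m + 2) → Fin n,
      (tpowDeriv A (A' (J 0)) (m + 1) *ᵥ u) (Fin.tail J) = ∑ b, Z b J := by
    intro J
    simp only [hZ, mulVec, dotProduct, tpowDeriv, of_apply, Finset.sum_mul, Fin.tail]
    rw [Finset.sum_comm]
  -- exchanging the first index with the one on the differentiated factor: the three indices of `A'`
  -- are symmetric
  have hdiag : ∀ b J, Z b (J ∘ Equiv.swap 0 b.succ) = Z b J := by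
    intro b J
    simp only [hZ]
    refine Finset.sum_congr rfl fun K _ => ?_
    congr 2
    · rw [Function.comp_apply, Function.comp_apply, Equiv.swap_apply_left,
        Equiv.swap_apply_right, hA']
    · refine Finset.prod_congr rfl fun c hc => ?_
      rw [Function.comp_apply, Equiv.swap_apply_of_ne_of_ne (Fin.succ_ne_zero c)
        (fun h => Finset.ne_of_mem_erase hc (Fin.succ_injective _ h))]
  -- exchanging it with any other one: these terms cancel in pairs since `u` is alternating
  have hoff : ∀ a b, a ≠ b → ∀ J,
      Z b (J ∘ Equiv.swap 0 a.succ) = - Z a (J ∘ Equiv.swap 0 b.succ) := by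
    intro a b hab J
    simp only [hZ]
    set e : (Fin (m + 1) → Fin n) ≃ (Fin (m + 1) → Fin n) :=
      Equiv.arrowCongr (Equiv.swap a b) (Equiv.refl (Fin n)) with he
    have heJ : ∀ J, e J = J ∘ Equiv.swap a b := fun J => by ext; simp [he]
    rw [← e.sum_comp, ← Finset.sum_neg_distrib]
    refine Finset.sum_congr rfl fun K _ => ?_
    rw [heJ, hu.swap hab]
    have hp : ∀ a b : Fin (m + 1), a ≠ b → ∀ K : Fin (m + 1) → Fin n,
        ∏ c ∈ Finset.univ.erase b, A ((J ∘ Equiv.swap 0 a.succ) c.succ) (K c)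
        = A (J 0) (K a) * ∏ c ∈ (Finset.univ.erase b).erase a, A (J c.succ) (K c) := by
      intro a b hab K
      rw [← Finset.mul_prod_erase _ _ (Finset.mem_erase.mpr ⟨hab, Finset.mem_univ a⟩)]
      congr 1
      · rw [Function.comp_apply, Equiv.swap_apply_right]
      · refine Finset.prod_congr rfl fun c hc => ?_
        rw [Function.comp_apply, Equiv.swap_apply_of_ne_of_ne (Fin.succ_ne_zero c)
          (fun h => Finset.ne_of_mem_erase hc (Fin.succ_injective _ h))]
    rw [hp a b hab, hp b a hab.symm, Finset.erase_right_comm]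
    have hq : ∏ c ∈ (Finset.univ.erase a).erase b, A (J c.succ) ((K ∘ Equiv.swap a b) c)
        = ∏ c ∈ (Finset.univ.erase a).erase b, A (J c.succ) (K c) := by
      refine Finset.prod_congr rfl fun c hc => ?_
      rw [Function.comp_apply, Equiv.swap_apply_of_ne_of_ne
        (Finset.ne_of_mem_erase (Finset.mem_of_mem_erase hc)) (Finset.ne_of_mem_erase hc)]
    have h0 : ∀ a b : Fin (m + 1), a ≠ b →
        (J ∘ Equiv.swap 0 a.succ) b.succ = J b.succ := fun a b hab => by
      rw [Function.comp_apply, Equiv.swap_apply_of_ne_of_ne (Fin.succ_ne_zero b)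
        (fun h => hab (Fin.succ_injective _ h).symm)]
    rw [hq, h0 a b hab, h0 b a hab.symm]
    simp only [Function.comp_apply, Equiv.swap_apply_left, Equiv.swap_apply_right]
    rw [hA' (J a.succ)]
    ring
  have hsum : ∀ J, ∑ a : Fin (m + 1), ∑ b, Z b (J ∘ Equiv.swap 0 a.succ) = ∑ b, Z b J := by
    intro J
    have h1 : ∑ a : Fin (m + 1), ∑ b, (Z b (J ∘ Equiv.swap 0 a.succ) -
        if a = b then Z b J else 0) = 0 := by
      have h2 := Finset.sum_comm (s := (Finset.univ : Finset (Fin (m + 1))))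
        (t := (Finset.univ : Finset (Fin (m + 1))))
        (f := fun a b => Z b (J ∘ Equiv.swap 0 a.succ) - if a = b then Z b J else 0)
      have h3 : ∑ b : Fin (m + 1), ∑ a, (Z b (J ∘ Equiv.swap 0 a.succ) -
          if a = b then Z b J else 0) = - ∑ b : Fin (m + 1), ∑ a,
          (Z a (J ∘ Equiv.swap 0 b.succ) - if b = a then Z a J else 0) := by
        simp only [← Finset.sum_neg_distrib]
        refine Finset.sum_congr rfl fun b _ => Finset.sum_congr rfl fun a _ => ?_
        rcases eq_or_ne a b with rfl | hab
        · simp [hdiag]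
        · rw [if_neg hab, if_neg hab.symm, hoff a b hab]; ring
      linarith
    simp only [Finset.sum_sub_distrib, Finset.sum_ite_eq, Finset.mem_univ, if_true] at h1
    linarith
  ext J
  simp only [swapSum, hX, hsum, sub_self, Pi.zero_apply]

lemma tpow_mulVec_cons (A : Matrix (Fin n) (Fin n) ℝ) (u : (Fin (m + 1) → Fin n) → ℝ)
    (k : Fin n) (K : Fin m → Fin n) :
    (tpow A (m + 1) *ᵥ u) (Fin.cons k K)
      = ∑ l, A k l * (tpow A m *ᵥ fun L => u (Fin.cons l L)) K := by
  simp only [mulVec, dotProduct, sum_cons, tpow_cons, Finset.mul_sum, mul_assoc]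

/-- The pointwise inequality behind the Bochner estimate. Here `Y l` stands for the derivative
`∂_l V` of a multivector field, and `swapSum X` for the exterior derivative of the form obtained by
lowering the indices of `V`. The right side equals `|X|² - ⟨X, swapSum X⟩`. -/
lemma neg_quad_swapSum_le {g : Matrix (Fin n) (Fin n) ℝ} (hg : g.PosDef)
    {Y : Fin n → (Fin (m + 1) → Fin n) → ℝ} (hY : ∀ l, IsAlt (Y l))
    {X : (Fin (m + 2) → Fin n) → ℝ}
    (hX : X = fun J => (tpow g (m + 1) *ᵥ Y (J 0)) (Fin.tail J)) :
    -(swapSum X ⬝ᵥ tpow g⁻¹ (m + 2) *ᵥ swapSum X) / 4 ≤ (m + 1) * ∑ k, ∑ l,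
      ((fun K => Y l (Fin.cons k K)) ⬝ᵥ tpow g m *ᵥ fun K => Y k (Fin.cons l K)) := by
  set N := tpow g⁻¹ (m + 2) with hN
  have hNs : N.IsSymm := tpow_isSymm (posDef_isSymm hg.inv) _
  have hNp : N.PosSemidef := tpow_posSemidef hg.inv.posSemidef _
  have hXc : ∀ l I, X (Fin.cons l I) = (tpow g (m + 1) *ᵥ Y l) I := fun l I => by
    rw [hX]; simp
  have hXa : ∀ l, IsAlt fun I => X (Fin.cons l I) := fun l => by
    simp only [hXc]
    exact (hY l).mulVec_tpow g
  have hgi : g⁻¹ * g = 1 := nonsing_inv_mul _ ((isUnit_iff_isUnit_det _).mp hg.isUnit)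
  have hNX : ∀ k l K, (N *ᵥ X) (Fin.cons k (Fin.cons l K : Fin (m + 1) → Fin n))
      = ∑ r, g⁻¹ k r * Y r (Fin.cons l K) := by
    intro k l K
    rw [hN, tpow_mulVec_cons]
    refine Finset.sum_congr rfl fun r _ => ?_
    simp only [hXc]
    rw [show (fun L => (tpow g (m + 1) *ᵥ Y r) L) = tpow g (m + 1) *ᵥ Y r from rfl,
      mulVec_mulVec, tpow_inv_mul hg, one_mulVec]
  have hB : X ⬝ᵥ N *ᵥ (fun J => X (J ∘ Equiv.swap 0 (Fin.succ 0))) = ∑ k, ∑ l,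
      ((fun K => Y l (Fin.cons k K)) ⬝ᵥ tpow g m *ᵥ fun K => Y k (Fin.cons l K)) := by
    rw [quad_comm hNs]
    simp only [dotProduct]
    rw [sum_cons]
    simp only [sum_cons, cons_cons_comp_swap, hNX, hXc, tpow_mulVec_cons]
    -- contract the metric against its inverse
    calc ∑ k, ∑ l, ∑ K, (∑ s, g k s * (tpow g m *ᵥ fun L => Y l (Fin.cons s L)) K) *
          ∑ r, g⁻¹ k r * Y r (Fin.cons l K)
        = ∑ l, ∑ K, ∑ s, ∑ r, (∑ k, g⁻¹ k r * g k s) *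
          ((tpow g m *ᵥ fun L => Y l (Fin.cons s L)) K * Y r (Fin.cons l K)) := by
          rw [Finset.sum_comm]
          refine Finset.sum_congr rfl fun l _ => ?_
          rw [Finset.sum_comm]
          refine Finset.sum_congr rfl fun K _ => ?_
          simp only [Finset.sum_mul_sum]
          rw [Finset.sum_comm]
          refine Finset.sum_congr rfl fun s _ => ?_
          rw [Finset.sum_comm]
          refine Finset.sum_congr rfl fun r _ => ?_
          rw [Finset.sum_mul]
          exact Finset.sum_congr rfl fun k _ => by ring
      _ = ∑ l, ∑ K, ∑ s, ∑ r, (if r = s then 1 else 0) *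
          ((tpow g m *ᵥ fun L => Y l (Fin.cons s L)) K * Y r (Fin.cons l K)) := by
          refine Finset.sum_congr rfl fun l _ => Finset.sum_congr rfl fun K _ =>
            Finset.sum_congr rfl fun s _ => Finset.sum_congr rfl fun r _ => ?_
          congr 1
          rw [← Matrix.one_apply, ← hgi, mul_apply]
          exact Finset.sum_congr rfl fun k _ => by rw [(posDef_isSymm hg.inv).apply r k]
      _ = _ := by
          simp only [ite_mul, one_mul, zero_mul, Finset.sum_ite_eq', Finset.mem_univ, if_true]
          rw [Finset.sum_congr rfl fun l _ => Finset.sum_comm, Finset.sum_comm]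
          refine Finset.sum_congr rfl fun k _ => Finset.sum_congr rfl fun l _ => ?_
          exact (dotProduct_comm _ _).trans (quad_comm (tpow_isSymm (posDef_isSymm hg) m) _ _)
  rw [← hB]
  have h1 := quad_swapSum g⁻¹ hXa
  -- complete the square
  have h2 := quad_nonneg hNp (X - (2⁻¹ : ℝ) • swapSum X)
  simp only [mulVec_sub, mulVec_smul, dotProduct_sub, sub_dotProduct, smul_dotProduct,
    dotProduct_smul, smul_eq_mul, quad_comm hNs (swapSum X) X] at h2
  rw [← hN] at h1
  linarith

/-- The exterior product of a covector with a form is bounded by the product of the lengths, up to a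
constant that is not sharp. -/
lemma quad_swapSum_mul_le {H : Matrix (Fin n) (Fin n) ℝ} (hH : H.PosSemidef) (a : Fin n → ℝ)
    (u : (Fin (m + 1) → Fin n) → ℝ) :
    swapSum (fun J => a (J 0) * u (Fin.tail J)) ⬝ᵥ tpow H (m + 2) *ᵥ
        swapSum (fun J => a (J 0) * u (Fin.tail J))
      ≤ (m + 2) ^ 2 * ((a ⬝ᵥ H *ᵥ a) * (u ⬝ᵥ tpow H (m + 1) *ᵥ u)) := by
  set X : (Fin (m + 2) → Fin n) → ℝ := fun J => a (J 0) * u (Fin.tail J) with hX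
  have hN := tpow_posSemidef hH (m + 2)
  set N := tpow H (m + 2) with hNdef
  have hQX : X ⬝ᵥ N *ᵥ X = (a ⬝ᵥ H *ᵥ a) * (u ⬝ᵥ tpow H (m + 1) *ᵥ u) := by
    rw [hNdef, quad_tpow_succ, quad_eq_sum H, Finset.sum_mul]
    refine Finset.sum_congr rfl fun k _ => ?_
    rw [Finset.sum_mul]
    refine Finset.sum_congr rfl fun l _ => ?_
    simp only [hX, Fin.cons_zero, Fin.tail_cons]
    have : ∀ k, (fun K => a k * u K) = a k • u := fun _ => rfl
    rw [this, this, mulVec_smul, smul_dotProduct, dotProduct_smul, smul_eq_mul, smul_eq_mul]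
    ring
  -- the sum has `m + 2` terms of equal length
  have hsum : ∀ (s : Finset (Fin (m + 1))), ∀ c : ℝ, c = s.card →
      (X - ∑ a ∈ s, fun J => X (J ∘ Equiv.swap 0 a.succ)) ⬝ᵥ N *ᵥ
        (X - ∑ a ∈ s, fun J => X (J ∘ Equiv.swap 0 a.succ)) ≤ (c + 1) ^ 2 * (X ⬝ᵥ N *ᵥ X) := by
    classical
    intro s
    induction s using Finset.induction_on with
    | empty => intro c hc; simp [hc]
    | insert b s hb ih =>
      intro c hc
      have ih := ih s.card rfl
      rw [Finset.card_insert_of_notMem hb] at hc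
      rw [Finset.sum_insert hb, sub_add_eq_sub_sub_swap,
        sub_eq_add_neg (X - ∑ a ∈ s, fun J => X (J ∘ Equiv.swap 0 a.succ))]
      -- the triangle inequality, with the weight for which the constants are `(card + 1) ^ 2`
      have hpos : (0 : ℝ) < (s.card : ℝ) + 1 := by positivity
      refine (quad_add_le hN _ _ (inv_pos.mpr hpos)).trans ?_
      rw [inv_inv, mulVec_neg, dotProduct_neg, neg_dotProduct, neg_neg,
        hNdef, quad_tpow_comp_perm H (Equiv.swap 0 b.succ) X X, ← hNdef]
      have hq := quad_nonneg hN X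
      have h1 : (1 + ((s.card : ℝ) + 1)⁻¹) * ((s.card + 1) ^ 2 * (X ⬝ᵥ N *ᵥ X))
          + (1 + ((s.card : ℝ) + 1)) * (X ⬝ᵥ N *ᵥ X) = (c + 1) ^ 2 * (X ⬝ᵥ N *ᵥ X) := by
        rw [hc]; push_cast; field_simp; ring
      rw [← h1]
      gcongr
  have h := hsum Finset.univ (m + 1) (by simp)
  have hs : swapSum X = X - ∑ a : Fin (m + 1), fun J => X (J ∘ Equiv.swap 0 a.succ) := by
    ext J; simp [swapSum]
  rw [hs, ← hQX]
  refine h.trans (le_of_eq ?_)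
  ring

/-- The contraction of a multivector with a covector is bounded by the product of the lengths. -/
lemma quad_contract_le {g : Matrix (Fin n) (Fin n) ℝ} (hg : g.PosDef) (a : Fin n → ℝ)
    (w : (Fin (m + 1) → Fin n) → ℝ) :
    (fun K => ∑ k, a k * w (Fin.cons k K)) ⬝ᵥ tpow g m *ᵥ
        (fun K => ∑ k, a k * w (Fin.cons k K))
      ≤ (a ⬝ᵥ g⁻¹ *ᵥ a) * (w ⬝ᵥ tpow g (m + 1) *ᵥ w) := by
  set c : (Fin m → Fin n) → ℝ := fun K => ∑ k, a k * w (Fin.cons k K) with hc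
  set s := a ⬝ᵥ g⁻¹ *ᵥ a with hs
  rcases eq_or_ne a 0 with rfl | ha
  · simp [hc, hs]
  have hspos : 0 < s := by simpa using hg.inv.dotProduct_mulVec_pos ha
  set b := g⁻¹ *ᵥ a with hb
  have hgb : g *ᵥ b = a := by
    rw [hb, mulVec_mulVec, mul_nonsing_inv _ ((isUnit_iff_isUnit_det _).mp hg.isUnit), one_mulVec]
  have hgs := posDef_isSymm hg
  set B : (Fin (m + 1) → Fin n) → ℝ := fun J => b (J 0) * c (Fin.tail J) with hB
  have hBw : B ⬝ᵥ tpow g (m + 1) *ᵥ w = c ⬝ᵥ tpow g m *ᵥ c := by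
    rw [quad_tpow_succ]
    simp only [hB, Fin.cons_zero, Fin.tail_cons]
    have h1 : ∀ k, (fun K => b k * c K) = b k • c := fun _ => rfl
    simp only [h1, smul_dotProduct, smul_eq_mul]
    have h2 : c = ∑ l, a l • fun K => w (Fin.cons l K) := by ext K; simp [hc]
    conv_rhs => rw [h2, mulVec_sum, dotProduct_sum, ← h2]
    rw [Finset.sum_comm]
    refine Finset.sum_congr rfl fun l _ => ?_
    rw [mulVec_smul, dotProduct_smul, smul_eq_mul, ← hgb]
    simp only [← mul_assoc]
    rw [← Finset.sum_mul]
    congr 1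
    exact Finset.sum_congr rfl fun k _ => by rw [hgs.apply]
  have hBB : B ⬝ᵥ tpow g (m + 1) *ᵥ B = s * (c ⬝ᵥ tpow g m *ᵥ c) := by
    rw [quad_tpow_succ]
    simp only [hB, Fin.cons_zero, Fin.tail_cons]
    have h1 : ∀ k, (fun K => b k * c K) = b k • c := fun _ => rfl
    simp only [h1, smul_dotProduct, smul_eq_mul, mulVec_smul, dotProduct_smul]
    have : s = b ⬝ᵥ g *ᵥ b := by rw [hgb, hs, dotProduct_comm]
    rw [this, quad_eq_sum g, Finset.sum_mul]
    refine Finset.sum_congr rfl fun k _ => ?_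
    rw [Finset.sum_mul]
    exact Finset.sum_congr rfl fun l _ => by ring
  -- expand the square of the part of `s w` orthogonal to `B`
  have h := quad_nonneg (tpow_posSemidef hg.posSemidef (m + 1)) (s • w - B)
  simp only [mulVec_sub, mulVec_smul, dotProduct_sub, sub_dotProduct, smul_dotProduct,
    dotProduct_smul, smul_eq_mul, quad_comm (tpow_isSymm hgs (m + 1)) w B, hBw, hBB] at h
  have h' : 0 ≤ s * (s * (w ⬝ᵥ tpow g (m + 1) *ᵥ w) - c ⬝ᵥ tpow g m *ᵥ c) := by linarith
  have := nonneg_of_mul_nonneg_right h' hspos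
  linarith

/-! ### Partial derivatives and Hessian metrics -/

/-- The partial derivative `∂ₖ f`. -/
noncomputable def pd (k : Fin n) (f : Base n → ℝ) (x : Base n) : ℝ := fderiv ℝ f x (stdVec k)

lemma pd_add (k : Fin n) {f g : Base n → ℝ} {x : Base n} (hf : DifferentiableAt ℝ f x)
    (hg : DifferentiableAt ℝ g x) : pd k (fun y => f y + g y) x = pd k f x + pd k g x := by
  simp [pd, fderiv_fun_add hf hg]

lemma pd_sub (k : Fin n) {f g : Base n → ℝ} {x : Base n} (hf : DifferentiableAt ℝ f x)
    (hg : DifferentiableAt ℝ g x) : pd k (fun y => f y - g y) x = pd k f x - pd k g x := by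
  simp [pd, fderiv_fun_sub hf hg]

lemma pd_mul (k : Fin n) {f g : Base n → ℝ} {x : Base n} (hf : DifferentiableAt ℝ f x)
    (hg : DifferentiableAt ℝ g x) :
    pd k (fun y => f y * g y) x = pd k f x * g x + f x * pd k g x := by
  simp [pd, fderiv_fun_mul hf hg]
  ring

lemma pd_const_mul (k : Fin n) {f : Base n → ℝ} {x : Base n} (hf : DifferentiableAt ℝ f x)
    (c : ℝ) : pd k (fun y => c * f y) x = c * pd k f x := by
  simp [pd, fderiv_const_mul hf]

lemma pd_sum {ι : Type*} (s : Finset ι) (k : Fin n) {f : ι → Base n → ℝ} {x : Base n}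
    (hf : ∀ i ∈ s, DifferentiableAt ℝ (f i) x) :
    pd k (fun y => ∑ i ∈ s, f i y) x = ∑ i ∈ s, pd k (f i) x := by
  simp only [pd]
  rw [fderiv_fun_sum hf, _root_.sum_apply]

lemma pd_exp_neg (k : Fin n) {f : Base n → ℝ} {x : Base n} (hf : DifferentiableAt ℝ f x) :
    pd k (fun y => Real.exp (-f y)) x = - pd k f x * Real.exp (-f x) := by
  have h := fderiv_exp hf.fun_neg
  simp only [pd, h]
  simp [fderiv_fun_neg]
  ring

lemma pd_eq_zero_of_eventually {k : Fin n} {f : Base n → ℝ} {K : Set (Base n)} (hK : IsClosed K)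
    (hf : ∀ x ∉ K, f x = 0) {x : Base n} (hx : x ∉ K) : pd k f x = 0 := by
  have : f =ᶠ[nhds x] fun _ => 0 := by
    filter_upwards [hK.isOpen_compl.mem_nhds hx] with y hy using hf y hy
  simp [pd, this.fderiv_eq]

lemma contDiff_pd {f : Base n → ℝ} (hf : ContDiff ℝ (⊤ : ℕ∞) f) (k : Fin n) :
    ContDiff ℝ (⊤ : ℕ∞) (pd k f) :=
  (hf.fderiv_right (m := (⊤ : ℕ∞)) (by simp)).clm_apply contDiff_const

lemma pd_comm {f : Base n → ℝ} (hf : ContDiff ℝ (⊤ : ℕ∞) f) (k l : Fin n) (x : Base n) :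
    pd k (pd l f) x = pd l (pd k f) x := by
  have h : ∀ k l, pd k (pd l f) x = fderiv ℝ (fderiv ℝ f) x (stdVec k) (stdVec l) := by
    intro k l
    have hd : DifferentiableAt ℝ (fderiv ℝ f) x :=
      ((hf.fderiv_right (m := (⊤ : ℕ∞)) (by simp)).differentiable (by simp)).differentiableAt
    change fderiv ℝ (fun y => fderiv ℝ f y (stdVec l)) x (stdVec k) = _
    rw [fderiv_clm_apply hd (differentiableAt_const _)]
    simp
  have hs : IsSymmSndFDerivAt ℝ f x := by
    refine hf.contDiffAt.isSymmSndFDerivAt ?_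
    rw [minSmoothness_of_isRCLikeNormedField]
    exact WithTop.coe_le_coe.mpr (le_top : (2 : ℕ∞) ≤ ⊤)
  rw [h, h, hs.eq]

lemma continuous_pd {f : Base n → ℝ} (hf : ContDiff ℝ (⊤ : ℕ∞) f) (k : Fin n) :
    Continuous (pd k f) := (contDiff_pd hf k).continuous

lemma integrable_of_continuous_of_compact {f : Base n → ℝ} (hf : Continuous f) {K : Set (Base n)}
    (hK : IsCompact K) (h0 : ∀ x ∉ K, f x = 0) : Integrable f :=
  hf.integrable_of_hasCompactSupport (HasCompactSupport.intro hK h0)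

lemma integral_mul_pd {f g : Base n → ℝ} (hf : ContDiff ℝ (⊤ : ℕ∞) f)
    (hg : ContDiff ℝ (⊤ : ℕ∞) g) {K : Set (Base n)} (hK : IsCompact K) (h0 : ∀ x ∉ K, f x = 0)
    (k : Fin n) : ∫ x, f x * pd k g x = - ∫ x, pd k f x * g x := by
  refine integral_mul_fderiv_eq_neg_fderiv_mul_of_integrable ?_ ?_ ?_
    (fun x _ => (hf.differentiable (by simp)).differentiableAt)
    (fun x _ => (hg.differentiable (by simp)).differentiableAt)
  · exact integrable_of_continuous_of_compact ((continuous_pd hf k).mul hg.continuous) hK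
      fun x hx => by
        have := pd_eq_zero_of_eventually (k := k) hK.isClosed h0 hx
        simp only [pd] at this
        simp [this]
  · exact integrable_of_continuous_of_compact (hf.continuous.mul (continuous_pd hg k)) hK
      fun x hx => by simp [h0 x hx]
  · exact integrable_of_continuous_of_compact (hf.continuous.mul hg.continuous) hK
      fun x hx => by simp [h0 x hx]

lemma integral_pd_eq_zero {f : Base n → ℝ} (hf : ContDiff ℝ (⊤ : ℕ∞) f) {K : Set (Base n)}
    (hK : IsCompact K) (h0 : ∀ x ∉ K, f x = 0) (k : Fin n) : ∫ x, pd k f x = 0 := by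
  have h := integral_mul_pd hf (contDiff_const (c := (1 : ℝ))) hK h0 k
  simp only [mul_one] at h
  have h2 : ∀ x : Base n, pd k (fun _ : Base n => (1 : ℝ)) x = 0 := fun x => by simp [pd]
  simp only [h2, mul_zero, integral_zero] at h
  linarith

/-- A smooth Hessian metric `g` on `ℝⁿ` (its first derivatives are symmetric in all three indices)
together with a smooth weight `φ` whose Hessian dominates `ε g`. -/
structure WeightedHessianMetric (g : Base n → Matrix (Fin n) (Fin n) ℝ) (φ : Base n → ℝ) (ε : ℝ) :
    Prop where
  smooth : ∀ i j, ContDiff ℝ (⊤ : ℕ∞) fun x => g x i j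
  posDef : ∀ x, (g x).PosDef
  symm : ∀ x k i j, pd k (fun y => g y i j) x = pd i (fun y => g y k j) x
  smooth_weight : ContDiff ℝ (⊤ : ℕ∞) φ
  hess_ge : ∀ x, (Matrix.of (fun i j => pd i (pd j φ) x) - ε • g x).PosSemidef

section
variable {g : Base n → Matrix (Fin n) (Fin n) ℝ} {φ : Base n → ℝ} {ε : ℝ}

lemma contDiff_tpow (hg : ∀ i j, ContDiff ℝ (⊤ : ℕ∞) fun x => g x i j) (I K : Fin m → Fin n) :
    ContDiff ℝ (⊤ : ℕ∞) fun x => tpow (g x) m I K := by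
  simp only [tpow_apply]
  exact contDiff_prod fun a _ => hg _ _

lemma pd_tpow (hg : ∀ i j, ContDiff ℝ (⊤ : ℕ∞) fun x => g x i j) (k : Fin n) (I K : Fin m → Fin n)
    (x : Base n) : pd k (fun x => tpow (g x) m I K) x
      = tpowDeriv (g x) (Matrix.of fun i j => pd k (fun y => g y i j) x) m I K := by
  simp only [tpow_apply, tpowDeriv, of_apply, pd]
  rw [fderiv_finsetProd fun a _ => ((hg _ _).differentiable (by simp)).differentiableAt,
    _root_.sum_apply]
  exact Finset.sum_congr rfl fun b _ => mul_comm _ _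

lemma WeightedHessianMetric.inv_smooth (h : WeightedHessianMetric g φ ε) (i j : Fin n) :
    ContDiff ℝ (⊤ : ℕ∞) fun x => (g x)⁻¹ i j := by
  have hdet : ∀ x, (g x).det ≠ 0 := fun x => (h.posDef x).det_pos.ne'
  have h1 : ∀ x, (g x)⁻¹ i j = ((g x).det)⁻¹ * (g x).adjugate i j := fun x => by
    rw [inv_def, Matrix.smul_apply, Ring.inverse_eq_inv', smul_eq_mul]
  have hD : ∀ M : Base n → Matrix (Fin n) (Fin n) ℝ,
      (∀ i j, ContDiff ℝ (⊤ : ℕ∞) fun x => M x i j) →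
      ContDiff ℝ (⊤ : ℕ∞) fun x => (M x).det := by
    intro M hM
    simp only [det_apply']
    exact ContDiff.sum fun σ _ => contDiff_const.mul (contDiff_prod fun a _ => hM _ _)
  simp only [h1]
  refine ((hD g h.smooth).inv hdet).mul ?_
  simp only [adjugate_apply]
  refine hD _ fun a b => ?_
  simp only [updateRow_apply]
  split_ifs
  · exact contDiff_const
  · exact h.smooth a b

end

/-! ### The Bochner identity and inequality -/

section
variable {g : Base n → Matrix (Fin n) (Fin n) ℝ} {φ : Base n → ℝ} {ε : ℝ}

lemma tpowDeriv_comm {A A' : Matrix (Fin n) (Fin n) ℝ} (hA : A.IsSymm) (hA' : A'.IsSymm)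
    (I K : Fin m → Fin n) : tpowDeriv A A' m I K = tpowDeriv A A' m K I := by
  simp only [tpowDeriv, of_apply]
  refine Finset.sum_congr rfl fun b _ => ?_
  rw [hA'.apply]
  congr 1
  exact Finset.prod_congr rfl fun c _ => by rw [hA.apply]

/-- The weighted divergence `∂ₗ V^{lK} - ∂ₗφ V^{lK}` of a multivector field. -/
noncomputable def wdiv (φ : Base n → ℝ) (V : Base n → (Fin (m + 1) → Fin n) → ℝ) (x : Base n)
    (K : Fin m → Fin n) : ℝ :=
  ∑ l, (pd l (fun y => V y (Fin.cons l K)) x - pd l φ x * V x (Fin.cons l K))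

/-- The vector field whose divergence is the difference of the two sides of the Bochner identity. -/
noncomputable def bochnerFlux (g : Base n → Matrix (Fin n) (Fin n) ℝ) (φ : Base n → ℝ)
    (V : Base n → (Fin (m + 1) → Fin n) → ℝ) (k : Fin n) (x : Base n) : ℝ :=
  ∑ K, ∑ K', Real.exp (-φ x) * (tpow (g x) m K K' * (V x (Fin.cons k K) * wdiv φ V x K' -
    ∑ l, V x (Fin.cons l K) * pd l (fun y => V y (Fin.cons k K')) x))

lemma contDiff_wdiv (hφ : ContDiff ℝ (⊤ : ℕ∞) φ) {V : Base n → (Fin (m + 1) → Fin n) → ℝ}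
    (hV : ∀ I, ContDiff ℝ (⊤ : ℕ∞) fun x => V x I) (K : Fin m → Fin n) :
    ContDiff ℝ (⊤ : ℕ∞) fun x => wdiv φ V x K :=
  ContDiff.sum fun l _ => (contDiff_pd (hV _) l).sub ((contDiff_pd hφ l).mul (hV _))

lemma contDiff_bochnerFlux (h : WeightedHessianMetric g φ ε)
    {V : Base n → (Fin (m + 1) → Fin n) → ℝ}
    (hV : ∀ I, ContDiff ℝ (⊤ : ℕ∞) fun x => V x I) (k : Fin n) :
    ContDiff ℝ (⊤ : ℕ∞) (bochnerFlux g φ V k) :=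
  ContDiff.sum fun K _ => ContDiff.sum fun K' _ => h.smooth_weight.neg.exp.mul
    ((contDiff_tpow h.smooth K K').mul (((hV _).mul (contDiff_wdiv h.smooth_weight hV K')).sub
      (ContDiff.sum fun l _ => (hV _).mul (contDiff_pd (hV _) l))))

lemma pd_isSymm (h : WeightedHessianMetric g φ ε) (x : Base n) (k : Fin n) :
    (Matrix.of fun i j => pd k (fun y => g y i j) x).IsSymm := by
  ext i j
  simp only [transpose_apply, of_apply]
  congr 1
  ext y
  exact (posDef_isSymm (h.posDef y)).apply i j

lemma isAlt_pd {V : Base n → (Fin m → Fin n) → ℝ}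
    (hV : ∀ I, ContDiff ℝ (⊤ : ℕ∞) fun x => V x I) (ha : ∀ x, IsAlt (V x)) (l : Fin n)
    (x : Base n) : IsAlt fun I => pd l (fun y => V y I) x := by
  intro σ I
  have : (fun y => V y (I ∘ σ)) = fun y => ((Equiv.Perm.sign σ : ℤ) : ℝ) * V y I :=
    funext fun y => ha y σ I
  simp only [this]
  exact pd_const_mul _ (((hV I).differentiable (by simp)).differentiableAt) _

/-- The Bochner identity, in divergence form. The metric may depend on the point, but none of its
derivatives survive. -/
lemma sum_pd_bochnerFlux (h : WeightedHessianMetric g φ ε)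
    {V : Base n → (Fin (m + 1) → Fin n) → ℝ}
    (hV : ∀ I, ContDiff ℝ (⊤ : ℕ∞) fun x => V x I) (ha : ∀ x, IsAlt (V x)) (x : Base n) :
    ∑ k, pd k (bochnerFlux g φ V k) x = Real.exp (-φ x) *
      (wdiv φ V x ⬝ᵥ tpow (g x) m *ᵥ wdiv φ V x
        - ∑ k, ∑ l, pd k (pd l φ) x *
          ((fun K => V x (Fin.cons k K)) ⬝ᵥ tpow (g x) m *ᵥ fun K => V x (Fin.cons l K))
        - ∑ k, ∑ l, ((fun K => pd l (fun y => V y (Fin.cons k K)) x) ⬝ᵥ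
          tpow (g x) m *ᵥ fun K => pd k (fun y => V y (Fin.cons l K)) x)) := by
  have hd : ∀ {f : Base n → ℝ}, ContDiff ℝ (⊤ : ℕ∞) f → DifferentiableAt ℝ f x := fun hf =>
    (hf.differentiable (by simp)).differentiableAt
  have hφ := h.smooth_weight
  set E := Real.exp (-φ x) with hE
  set S : Fin n → (Fin m → Fin n) → (Fin m → Fin n) → ℝ := fun k K K' =>
    V x (Fin.cons k K) * wdiv φ V x K' -
      ∑ l, V x (Fin.cons l K) * pd l (fun y => V y (Fin.cons k K')) x with hS
  set S' : Fin n → (Fin m → Fin n) → (Fin m → Fin n) → ℝ := fun k K K' =>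
    (pd k (fun y => V y (Fin.cons k K)) x * wdiv φ V x K' +
      V x (Fin.cons k K) * ∑ l, (pd k (pd l fun y => V y (Fin.cons l K')) x -
        (pd k (pd l φ) x * V x (Fin.cons l K') +
          pd l φ x * pd k (fun y => V y (Fin.cons l K')) x))) -
      ∑ l, (pd k (fun y => V y (Fin.cons l K)) x * pd l (fun y => V y (Fin.cons k K')) x +
        V x (Fin.cons l K) * pd k (pd l fun y => V y (Fin.cons k K')) x) with hS'
  set T : Fin n → (Fin m → Fin n) → (Fin m → Fin n) → ℝ := fun k K K' =>
    tpowDeriv (g x) (Matrix.of fun i j => pd k (fun y => g y i j) x) m K K' with hT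
  have h1 : ∀ k, pd k (bochnerFlux g φ V k) x = ∑ K, ∑ K',
      (-pd k φ x * E * (tpow (g x) m K K' * S k K K') +
        E * (T k K K' * S k K K' + tpow (g x) m K K' * S' k K K')) := by
    intro k
    have hw : ∀ K', ContDiff ℝ (⊤ : ℕ∞) fun x => wdiv φ V x K' := contDiff_wdiv hφ hV
    have hs : ∀ K K', ContDiff ℝ (⊤ : ℕ∞) fun x =>
        ∑ l, V x (Fin.cons l K) * pd l (fun y => V y (Fin.cons k K')) x := fun K K' =>
      ContDiff.sum fun l _ => (hV _).mul (contDiff_pd (hV _) l)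
    have hS1 : ∀ K K', ContDiff ℝ (⊤ : ℕ∞) fun x => V x (Fin.cons k K) * wdiv φ V x K' -
        ∑ l, V x (Fin.cons l K) * pd l (fun y => V y (Fin.cons k K')) x := fun K K' =>
      ((hV _).mul (hw K')).sub (hs K K')
    have ht : ∀ K K' : Fin m → Fin n, ContDiff ℝ (⊤ : ℕ∞) fun x => tpow (g x) m K K' :=
      contDiff_tpow h.smooth
    have hall : ∀ K K', ContDiff ℝ (⊤ : ℕ∞) fun x => Real.exp (-φ x) * (tpow (g x) m K K' *
        (V x (Fin.cons k K) * wdiv φ V x K' -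
          ∑ l, V x (Fin.cons l K) * pd l (fun y => V y (Fin.cons k K')) x)) := fun K K' =>
      hφ.neg.exp.mul ((ht K K').mul (hS1 K K'))
    unfold bochnerFlux
    rw [pd_sum _ _ fun K _ => hd (ContDiff.sum fun K' _ => hall K K')]
    refine Finset.sum_congr rfl fun K _ => ?_
    rw [pd_sum _ _ fun K' _ => hd (hall K K')]
    refine Finset.sum_congr rfl fun K' _ => ?_
    rw [pd_mul _ (hd hφ.neg.exp) (hd ((ht K K').mul (hS1 K K'))), pd_exp_neg _ (hd hφ),
      pd_mul _ (hd (ht K K')) (hd (hS1 K K')), pd_tpow h.smooth,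
      pd_sub _ (hd ((hV _).mul (hw K'))) (hd (hs K K')), pd_mul _ (hd (hV _)) (hd (hw K')),
      pd_sum _ _ fun l _ => hd ((hV _).mul (contDiff_pd (hV _) l))]
    have e1 : pd k (fun x => wdiv φ V x K') x = ∑ l, (pd k (pd l fun y => V y (Fin.cons l K')) x -
        (pd k (pd l φ) x * V x (Fin.cons l K') +
          pd l φ x * pd k (fun y => V y (Fin.cons l K')) x)) := by
      unfold wdiv
      rw [pd_sum _ _ fun l _ => hd ((contDiff_pd (hV _) l).sub ((contDiff_pd hφ l).mul (hV _)))]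
      refine Finset.sum_congr rfl fun l _ => ?_
      rw [pd_sub _ (hd (contDiff_pd (hV _) l)) (hd ((contDiff_pd hφ l).mul (hV _))),
        pd_mul _ (hd (contDiff_pd hφ l)) (hd (hV _))]
    have e2 : ∀ l, pd k (fun x => V x (Fin.cons l K) * pd l (fun y => V y (Fin.cons k K')) x) x
        = pd k (fun y => V y (Fin.cons l K)) x * pd l (fun y => V y (Fin.cons k K')) x +
        V x (Fin.cons l K) * pd k (pd l fun y => V y (Fin.cons k K')) x := fun l =>
      pd_mul _ (hd (hV _)) (hd (contDiff_pd (hV _) l))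
    simp only [e1, e2]
    rfl
  -- the terms with a derivative of the metric vanish: those derivatives are symmetric, and `V` is
  -- alternating
  have hT1 : ∀ K', ∑ k, ∑ K, T k K K' * V x (Fin.cons k K) = 0 := fun K' =>
    sum_tpowDeriv_mul_eq_zero (h.symm x) (ha x) K'
  have hT2 : ∀ l K, ∑ k, ∑ K', T k K K' * pd l (fun y => V y (Fin.cons k K')) x = 0 := by
    intro l K
    have := sum_tpowDeriv_mul_eq_zero (A := g x)
      (A' := fun k => Matrix.of fun i j => pd k (fun y => g y i j) x) (h.symm x)
      (isAlt_pd hV ha l x) K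
    rw [← this]
    refine Finset.sum_congr rfl fun k _ => Finset.sum_congr rfl fun K' _ => ?_
    rw [hT]
    simp only
    rw [tpowDeriv_comm (posDef_isSymm (h.posDef x)) (pd_isSymm h x k)]
  have hT0 : ∑ k, ∑ K, ∑ K', T k K K' * S k K K' = 0 := by
    simp only [hS, mul_sub, Finset.sum_sub_distrib]
    have t1 : ∑ k, ∑ K, ∑ K', T k K K' * (V x (Fin.cons k K) * wdiv φ V x K') = 0 := by
      calc _ = ∑ K', (∑ k, ∑ K, T k K K' * V x (Fin.cons k K)) * wdiv φ V x K' := by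
            rw [Finset.sum_congr rfl fun k _ => Finset.sum_comm, Finset.sum_comm]
            simp only [Finset.sum_mul, mul_assoc]
        _ = 0 := by simp [hT1]
    have t2 : ∑ k, ∑ K, ∑ K', T k K K' *
        ∑ l, V x (Fin.cons l K) * pd l (fun y => V y (Fin.cons k K')) x = 0 := by
      calc _ = ∑ l, ∑ K, V x (Fin.cons l K) *
            ∑ k, ∑ K', T k K K' * pd l (fun y => V y (Fin.cons k K')) x := by
            simp only [Finset.mul_sum]
            rw [Finset.sum_comm]
            conv_rhs => rw [Finset.sum_comm]
            refine Finset.sum_congr rfl fun K _ => ?_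
            rw [Finset.sum_congr rfl fun k _ => Finset.sum_comm, Finset.sum_comm]
            exact Finset.sum_congr rfl fun _ _ => Finset.sum_congr rfl fun _ _ =>
              Finset.sum_congr rfl fun _ _ => by ring
        _ = 0 := by simp [hT2]
    rw [t1, t2, sub_zero]
  -- the remaining terms, for fixed `K` and `K'`
  have hmain : ∀ K K', ∑ k, (S' k K K' - pd k φ x * S k K K')
      = wdiv φ V x K * wdiv φ V x K'
        - ∑ k, ∑ l, pd k (pd l φ) x * (V x (Fin.cons k K) * V x (Fin.cons l K'))
        - ∑ k, ∑ l, pd l (fun y => V y (Fin.cons k K)) x *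
            pd k (fun y => V y (Fin.cons l K')) x := by
    intro K K'
    have hcomm : ∑ k, ∑ l, V x (Fin.cons l K) * pd k (pd l fun y => V y (Fin.cons k K')) x
        = ∑ k, ∑ l, V x (Fin.cons k K) * pd k (pd l fun y => V y (Fin.cons l K')) x := by
      rw [Finset.sum_comm]
      exact Finset.sum_congr rfl fun k _ => Finset.sum_congr rfl fun l _ => by
        rw [pd_comm (hV _)]
    have hcomm2 : ∑ k, ∑ l, pd k φ x * (V x (Fin.cons l K) * pd l (fun y => V y (Fin.cons k K')) x)
        = ∑ k, ∑ l, V x (Fin.cons k K) * (pd l φ x * pd k (fun y => V y (Fin.cons l K')) x) := by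
      rw [Finset.sum_comm]
      exact Finset.sum_congr rfl fun k _ => Finset.sum_congr rfl fun l _ => by ring
    have hcomm3 : ∑ k, ∑ l, pd k (fun y => V y (Fin.cons l K)) x *
          pd l (fun y => V y (Fin.cons k K')) x
        = ∑ k, ∑ l, pd l (fun y => V y (Fin.cons k K)) x *
            pd k (fun y => V y (Fin.cons l K')) x := Finset.sum_comm
    have hcomm4 : ∑ k, ∑ l, V x (Fin.cons k K) * (pd k (pd l φ) x * V x (Fin.cons l K'))
        = ∑ k, ∑ l, pd k (pd l φ) x * (V x (Fin.cons k K) * V x (Fin.cons l K')) :=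
      Finset.sum_congr rfl fun k _ => Finset.sum_congr rfl fun l _ => by ring
    have hw : wdiv φ V x K * wdiv φ V x K' = ∑ k, pd k (fun y => V y (Fin.cons k K)) x *
        wdiv φ V x K' - ∑ k, pd k φ x * (V x (Fin.cons k K) * wdiv φ V x K') := by
      conv_lhs => rw [wdiv]
      rw [Finset.sum_mul, ← Finset.sum_sub_distrib]
      exact Finset.sum_congr rfl fun k _ => by ring
    rw [hw]
    simp only [hS, hS', mul_sub, mul_add, Finset.sum_sub_distrib, Finset.sum_add_distrib,
      Finset.mul_sum]
    linarith
  have hfin : ∑ k, pd k (bochnerFlux g φ V k) x = E * (∑ k, ∑ K, ∑ K', T k K K' * S k K K' +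
      ∑ K, ∑ K', tpow (g x) m K K' * ∑ k, (S' k K K' - pd k φ x * S k K K')) := by
    have : ∑ K, ∑ K', tpow (g x) m K K' * ∑ k, (S' k K K' - pd k φ x * S k K K')
        = ∑ k, ∑ K, ∑ K', tpow (g x) m K K' * (S' k K K' - pd k φ x * S k K K') := by
      simp only [Finset.mul_sum]
      rw [Finset.sum_congr rfl fun K _ => Finset.sum_comm, Finset.sum_comm]
    rw [this, ← Finset.sum_add_distrib, Finset.mul_sum]
    refine Finset.sum_congr rfl fun k _ => ?_
    rw [h1 k, ← Finset.sum_add_distrib, Finset.mul_sum]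
    refine Finset.sum_congr rfl fun K _ => ?_
    rw [← Finset.sum_add_distrib, Finset.mul_sum]
    exact Finset.sum_congr rfl fun K' _ => by ring
  rw [hfin, hT0, zero_add]
  congr 1
  simp only [hmain, quad_eq_sum, mul_sub, Finset.sum_sub_distrib]
  congr 1
  · congr 1
    · exact Finset.sum_congr rfl fun _ _ => Finset.sum_congr rfl fun _ _ => by ring
    · simp only [Finset.mul_sum]
      rw [Finset.sum_congr rfl fun K _ => Finset.sum_comm, Finset.sum_comm]
      refine Finset.sum_congr rfl fun k _ => ?_
      rw [Finset.sum_congr rfl fun K _ => Finset.sum_comm, Finset.sum_comm]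
      exact Finset.sum_congr rfl fun _ _ => Finset.sum_congr rfl fun _ _ =>
        Finset.sum_congr rfl fun _ _ => by ring
  · simp only [Finset.mul_sum]
    rw [Finset.sum_congr rfl fun K _ => Finset.sum_comm, Finset.sum_comm]
    refine Finset.sum_congr rfl fun k _ => ?_
    rw [Finset.sum_congr rfl fun K _ => Finset.sum_comm, Finset.sum_comm]
    exact Finset.sum_congr rfl fun _ _ => Finset.sum_congr rfl fun _ _ =>
      Finset.sum_congr rfl fun _ _ => by ring

/-- The Bochner inequality for compactly supported multivector fields `V`: the weighted divergence
and the exterior derivative of the form with lowered indices control `V`. -/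
theorem bochner_inequality (h : WeightedHessianMetric g φ ε)
    {V : Base n → (Fin (m + 1) → Fin n) → ℝ}
    (hV : ∀ I, ContDiff ℝ (⊤ : ℕ∞) fun x => V x I) (ha : ∀ x, IsAlt (V x))
    {C : Set (Base n)} (hC : IsCompact C) (hVC : ∀ x ∉ C, V x = 0) :
    ε * ∫ x, Real.exp (-φ x) * (V x ⬝ᵥ tpow (g x) (m + 1) *ᵥ V x) ≤
      (∫ x, Real.exp (-φ x) * (wdiv φ V x ⬝ᵥ tpow (g x) m *ᵥ wdiv φ V x)) +
      ∫ x, Real.exp (-φ x) * (swapSum (fun J : Fin (m + 2) → Fin n =>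
          pd (J 0) (fun y => (tpow (g y) (m + 1) *ᵥ V y) (Fin.tail J)) x) ⬝ᵥ
        tpow (g x)⁻¹ (m + 2) *ᵥ swapSum (fun J : Fin (m + 2) → Fin n =>
          pd (J 0) (fun y => (tpow (g y) (m + 1) *ᵥ V y) (Fin.tail J)) x)) := by
  have hφ := h.smooth_weight
  have hE : Continuous fun x => Real.exp (-φ x) := (hφ.continuous.neg).rexp
  have hcl := hC.isClosed
  have hVI : ∀ I, ∀ x ∉ C, V x I = 0 := fun I x hx => by rw [hVC x hx]; rfl
  have hpdV : ∀ l I, ∀ x ∉ C, pd l (fun y => V y I) x = 0 := fun l I x hx =>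
    pd_eq_zero_of_eventually hcl (hVI I) hx
  have hwd : ∀ x ∉ C, wdiv φ V x = 0 := fun x hx => by
    ext K; simp [wdiv, hpdV _ _ x hx, hVI _ x hx]
  have htp : ∀ {m : ℕ} (I K : Fin m → Fin n), Continuous fun x => tpow (g x) m I K :=
    fun I K => (contDiff_tpow h.smooth I K).continuous
  have htpi : ∀ {m : ℕ} (I K : Fin m → Fin n), Continuous fun x => tpow (g x)⁻¹ m I K :=
    fun I K => (contDiff_tpow h.inv_smooth I K).continuous
  have hlow : ∀ I, ContDiff ℝ (⊤ : ℕ∞) fun y => (tpow (g y) (m + 1) *ᵥ V y) I := fun I =>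
    ContDiff.sum fun K _ => (contDiff_tpow h.smooth I K).mul (hV K)
  set X : Base n → (Fin (m + 2) → Fin n) → ℝ := fun x J =>
    pd (J 0) (fun y => (tpow (g y) (m + 1) *ᵥ V y) (Fin.tail J)) x with hX
  have hXc : ∀ J, Continuous fun x => X x J := fun J => continuous_pd (hlow _) _
  have hX0 : ∀ x ∉ C, X x = 0 := fun x hx => by
    ext J
    exact pd_eq_zero_of_eventually hcl (fun y hy => by rw [hVC y hy, mulVec_zero]; rfl) hx
  have hSc : ∀ J, Continuous fun x => swapSum (X x) J := fun J =>
    (hXc J).sub (continuous_finsetSum _ fun a _ => hXc _)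
  have hS0 : ∀ x ∉ C, swapSum (X x) = 0 := fun x hx => by
    rw [hX0 x hx]; ext J; simp [swapSum]
  -- the three integrands are continuous with compact support
  have hquad : ∀ {ι : Type} [Fintype ι] {M : Base n → Matrix ι ι ℝ} {u : Base n → ι → ℝ},
      (∀ i k, Continuous fun x => M x i k) → (∀ i, Continuous fun x => u x i) →
      (∀ x ∉ C, u x = 0) → Integrable fun x => Real.exp (-φ x) * (u x ⬝ᵥ M x *ᵥ u x) := by
    intro ι _ M u hM hu hu0
    refine integrable_of_continuous_of_compact ?_ hC fun x hx => by rw [hu0 x hx]; simp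
    simp only [quad_eq_sum]
    exact hE.mul (continuous_finsetSum _ fun i _ => continuous_finsetSum _ fun k _ =>
      ((hM i k).mul (hu i)).mul (hu k))
  have i1 := hquad (fun I K => htp I K) (fun I => (hV I).continuous) hVC
  have i2 := hquad (fun I K => htp I K) (fun I => (contDiff_wdiv hφ hV I).continuous) hwd
  have i3 := hquad (fun I K => htpi I K) hSc hS0
  have hflux0 : ∀ k, ∀ x ∉ C, bochnerFlux g φ V k x = 0 := fun k x hx => by
    simp [bochnerFlux, hVI _ x hx]
  have hflux : ∀ k, Integrable (pd k (bochnerFlux g φ V k)) := fun k =>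
    integrable_of_continuous_of_compact (continuous_pd (contDiff_bochnerFlux h hV k) k) hC
      fun x hx => pd_eq_zero_of_eventually hcl (hflux0 k) hx
  have i4 : Integrable fun x => ∑ k, pd k (bochnerFlux g φ V k) x :=
    integrable_finsetSum _ fun k _ => hflux k
  have hz : ∫ x, ∑ k, pd k (bochnerFlux g φ V k) x = 0 := by
    rw [integral_finsetSum _ fun k _ => hflux k]
    exact Finset.sum_eq_zero fun k _ =>
      integral_pd_eq_zero (contDiff_bochnerFlux h hV k) hC (hflux0 k) k
  have hpt : ∀ x, ε * (Real.exp (-φ x) * (V x ⬝ᵥ tpow (g x) (m + 1) *ᵥ V x)) ≤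
      Real.exp (-φ x) * (wdiv φ V x ⬝ᵥ tpow (g x) m *ᵥ wdiv φ V x) +
      Real.exp (-φ x) * (swapSum (X x) ⬝ᵥ tpow (g x)⁻¹ (m + 2) *ᵥ swapSum (X x)) -
      ∑ k, pd k (bochnerFlux g φ V k) x := by
    intro x
    have hgx := h.posDef x
    rw [sum_pd_bochnerFlux h hV ha x]
    have hH := sum_quad_nonneg (h.hess_ge x) (tpow_posSemidef hgx.posSemidef m)
      fun k K => V x (Fin.cons k K)
    simp only [Matrix.sub_apply, Matrix.smul_apply, of_apply, smul_eq_mul, sub_mul,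
      Finset.sum_sub_distrib, mul_assoc, ← Finset.mul_sum] at hH
    rw [← quad_tpow_succ] at hH
    set Y : Fin n → (Fin (m + 1) → Fin n) → ℝ := fun l I => pd l (fun y => V y I) x with hY
    have hXY : swapSum (X x) = swapSum fun J => (tpow (g x) (m + 1) *ᵥ Y (J 0)) (Fin.tail J) := by
      have h1 : X x = (fun J => (tpow (g x) (m + 1) *ᵥ Y (J 0)) (Fin.tail J)) + fun J =>
          (tpowDeriv (g x) (Matrix.of fun i j => pd (J 0) (fun y => g y i j) x) (m + 1) *ᵥ V x)
            (Fin.tail J) := by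
        ext J
        simp only [hX, hY, mulVec, dotProduct, Pi.add_apply]
        have hd : ∀ {f : Base n → ℝ}, ContDiff ℝ (⊤ : ℕ∞) f → DifferentiableAt ℝ f x := fun hf =>
          (hf.differentiable (by simp)).differentiableAt
        rw [pd_sum _ _ fun K _ => hd ((contDiff_tpow h.smooth _ K).mul (hV K)),
          ← Finset.sum_add_distrib]
        refine Finset.sum_congr rfl fun K _ => ?_
        rw [pd_mul _ (hd (contDiff_tpow h.smooth _ K)) (hd (hV K)), pd_tpow h.smooth, add_comm]
      have h2 := swapSum_tpowDeriv_eq_zero (A := g x)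
        (A' := fun k => Matrix.of fun i j => pd k (fun y => g y i j) x) (h.symm x) (ha x)
      rw [h1, swapSum_add, h2, add_zero]
    have hB := neg_quad_swapSum_le hgx (fun l => isAlt_pd hV ha l x) (Y := Y) rfl
    rw [← hXY] at hB
    have hSn := quad_nonneg (tpow_posSemidef hgx.inv.posSemidef (m + 2)) (swapSum (X x))
    set S := swapSum (X x) ⬝ᵥ tpow (g x)⁻¹ (m + 2) *ᵥ swapSum (X x) with hS
    set B := ∑ k, ∑ l, ((fun K => Y l (Fin.cons k K)) ⬝ᵥ tpow (g x) m *ᵥ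
      fun K => Y k (Fin.cons l K)) with hBdef
    -- `hB` reads `-S / 4 ≤ (m + 1) B`; the constant in front of `S` is of no importance, since `S`
    -- comes from the cutoff function alone in the application
    have hBS : -S ≤ B := by
      rcases le_or_gt 0 B with hB0 | hB0
      · linarith
      · have : ((m : ℝ) + 1) * B ≤ 1 * B :=
          mul_le_mul_of_nonpos_right (by linarith [(Nat.cast_nonneg m : (0 : ℝ) ≤ m)]) hB0.le
        linarith
    have hEp := Real.exp_pos (-φ x)
    have := mul_le_mul_of_nonneg_left (add_le_add hH hBS) hEp.le
    simp only [mul_sub, mul_add] at this ⊢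
    linarith
  have hint := integral_mono (i1.const_mul ε) ((i2.add i3).sub i4) hpt
  rw [integral_const_mul, integral_sub' (i2.add i3) i4, integral_add' i2 i3, hz, sub_zero] at hint
  exact hint

end

/-! ### Weighted spaces of square integrable tensor fields -/

section WeightedSpace
variable {T : Type} [Fintype T]

/-- `S` is a continuous field of symmetric square roots of the matrix field `P`, with inverse `R`. -/
structure IsMatrixSqrt [DecidableEq T] (P S R : Base n → Matrix T T ℝ) : Prop where
  cont : ∀ i j, Continuous fun x => S x i j
  cont_inv : ∀ i j, Continuous fun x => R x i j
  symm : ∀ x, (S x).IsSymm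
  symm_inv : ∀ x, (R x).IsSymm
  sq : ∀ x, S x * S x = P x
  inv_mul : ∀ x, R x * S x = 1
  mul_inv : ∀ x, S x * R x = 1

/-- The square root is given by the continuous functional calculus, hence depends continuously on the
point. It trivializes the weighted space: `u ↦ S u` is an isometry onto an unweighted `L²` space. -/
lemma exists_isMatrixSqrt [DecidableEq T] {P : Base n → Matrix T T ℝ} (hP : ∀ x, (P x).PosDef)
    (hc : ∀ i j, Continuous fun x => P x i j) : ∃ S R, IsMatrixSqrt P S R := by
  open scoped Matrix.Norms.L2Operator MatrixOrder in
  have hcont : Continuous fun x => CFC.sqrt (P x) := by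
    have h1 : ContinuousOn (CFC.sqrt) {a : Matrix T T ℝ | 0 ≤ a} := CFC.continuousOn_sqrt
    exact h1.comp_continuous (continuous_matrix hc) fun x => (hP x).posSemidef.nonneg
  have hS : ∀ x, (CFC.sqrt (P x)) * CFC.sqrt (P x) = P x := fun x =>
    CFC.sqrt_mul_sqrt_self (P x) (hP x).posSemidef.nonneg
  have hpos : ∀ x, (CFC.sqrt (P x)).PosDef := fun x => by
    rw [(CFC.sqrt_nonneg (P x)).posSemidef.posDef_iff_isUnit]
    have := (hP x).isUnit
    rw [← hS x] at this
    exact isUnit_of_mul_isUnit_left this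
  have hdet : ∀ x, IsUnit (CFC.sqrt (P x)).det := fun x =>
    (isUnit_iff_isUnit_det _).mp (hpos x).isUnit
  refine ⟨fun x => CFC.sqrt (P x), fun x => (CFC.sqrt (P x))⁻¹, ?_, ?_, fun x =>
    posDef_isSymm (hpos x), fun x => posDef_isSymm (hpos x).inv, hS,
    fun x => nonsing_inv_mul _ (hdet x), fun x => mul_nonsing_inv _ (hdet x)⟩
  · exact fun i j => hcont.matrix_elem i j
  · intro i j
    have h1 : ∀ x, (CFC.sqrt (P x))⁻¹ = ((CFC.sqrt (P x)).det)⁻¹ • (CFC.sqrt (P x)).adjugate :=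
      fun x => by rw [inv_def, Ring.inverse_eq_inv']
    simp only [h1, Matrix.smul_apply, smul_eq_mul]
    exact (hcont.matrix_det.inv₀ fun x => (hpos x).det_pos.ne').mul
      (hcont.matrix_adjugate.matrix_elem i j)

/-- Membership in the Hilbert space of tensor fields `u` with `∫ P(u, u) < ∞`. -/
structure WMem (P : Base n → Matrix T T ℝ) (u : Base n → T → ℝ) : Prop where
  aesm : ∀ i, AEStronglyMeasurable (fun x => u x i) volume
  integrable : Integrable fun x => u x ⬝ᵥ P x *ᵥ u x

/-- The section `S u`, whose pointwise Euclidean norm is the `P`-length of `u`. -/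
noncomputable def twist (S : Base n → Matrix T T ℝ) (u : Base n → T → ℝ) (x : Base n) :
    EuclideanSpace ℝ T := WithLp.toLp 2 (S x *ᵥ u x)

lemma aesm_twist {S : Base n → Matrix T T ℝ} (hS : ∀ i j, Continuous fun x => S x i j)
    {u : Base n → T → ℝ} (hu : ∀ i, AEStronglyMeasurable (fun x => u x i) volume) :
    AEStronglyMeasurable (twist S u) volume := by
  refine (PiLp.continuous_toLp 2 _).comp_aestronglyMeasurable ?_
  refine (aemeasurable_pi_iff.mpr fun i => AEStronglyMeasurable.aemeasurable ?_).aestronglyMeasurable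
  simp only [mulVec, dotProduct]
  exact Finset.aestronglyMeasurable_fun_sum _ fun j _ => (hS i j).aestronglyMeasurable.mul (hu j)

section
variable [DecidableEq T] {P S R : Base n → Matrix T T ℝ}

lemma inner_twist (h : IsMatrixSqrt P S R) (u v : Base n → T → ℝ) (x : Base n) :
    inner ℝ (twist S u x) (twist S v x) = u x ⬝ᵥ P x *ᵥ v x := by
  rw [twist, twist, EuclideanSpace.inner_toLp_toLp, star_trivial, ← h.sq x, ← mulVec_mulVec,
    quad_comm (h.symm x), dotProduct_comm]

lemma inner_twist_inv (h : IsMatrixSqrt P S R) (u c : Base n → T → ℝ) (x : Base n) :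
    inner ℝ (twist S u x) (twist R c x) = u x ⬝ᵥ c x := by
  rw [twist, twist, EuclideanSpace.inner_toLp_toLp, star_trivial, dotProduct_comm,
    dotProduct_mulVec, ← mulVec_transpose, mulVec_mulVec, (h.symm_inv x).eq, h.inv_mul x,
    one_mulVec]

lemma memLp_twist (h : IsMatrixSqrt P S R) {u : Base n → T → ℝ} (hu : WMem P u) :
    MemLp (twist S u) 2 volume := by
  rw [memLp_two_iff_integrable_sq_norm (aesm_twist h.cont hu.aesm)]
  refine hu.integrable.congr (Filter.Eventually.of_forall fun x => ?_)
  simp only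
  rw [← inner_twist h, real_inner_self_eq_norm_sq]

lemma memLp_twist_inv (h : IsMatrixSqrt P S R) {c : Base n → T → ℝ}
    (hc : ∀ i, Continuous fun x => c x i) {C : Set (Base n)} (hC : IsCompact C)
    (h0 : ∀ x ∉ C, c x = 0) : MemLp (twist R c) 2 volume := by
  refine Continuous.memLp_of_hasCompactSupport ?_ (HasCompactSupport.intro hC fun x hx => ?_)
  · refine (PiLp.continuous_toLp 2 _).comp (continuous_pi fun i => ?_)
    simp only [mulVec, dotProduct]
    exact continuous_finsetSum _ fun j _ => (h.cont_inv i j).mul (hc j)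
  · simp [twist, h0 x hx]

/-- Every element of the unweighted `L²` space comes from the weighted one. -/
lemma exists_twist_eq (h : IsMatrixSqrt P S R) (f : Lp (EuclideanSpace ℝ T) 2 (volume (α := Base n))) :
    ∃ u, WMem P u ∧ twist S u = f := by
  have htw : twist S (fun x => R x *ᵥ (f x).ofLp) = f := by
    ext1 x
    simp [twist, mulVec_mulVec, h.mul_inv x]
  have hm : ∀ i, AEStronglyMeasurable (fun x => (R x *ᵥ (f x).ofLp) i) volume := fun i => by
    simp only [mulVec, dotProduct]
    refine Finset.aestronglyMeasurable_fun_sum _ fun j _ =>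
      (h.cont_inv i j).aestronglyMeasurable.mul ?_
    exact (PiLp.continuous_apply 2 _ j).comp_aestronglyMeasurable (Lp.aestronglyMeasurable f)
  refine ⟨fun x => R x *ᵥ (f x).ofLp, ⟨hm, ?_⟩, htw⟩
  have h2 := (memLp_two_iff_integrable_sq_norm (Lp.aestronglyMeasurable f)).mp (Lp.memLp f)
  refine h2.congr (Filter.Eventually.of_forall fun x => ?_)
  simp only
  rw [← inner_twist h (fun x => R x *ᵥ (f x).ofLp) (fun x => R x *ᵥ (f x).ofLp), htw,
    real_inner_self_eq_norm_sq]

lemma inner_toLp_twist (h : IsMatrixSqrt P S R) {u v : Base n → T → ℝ} (hu : WMem P u)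
    (hv : WMem P v) : inner ℝ ((memLp_twist h hu).toLp _) ((memLp_twist h hv).toLp _)
      = ∫ x, u x ⬝ᵥ P x *ᵥ v x := by
  rw [L2.inner_def]
  refine integral_congr_ae ?_
  filter_upwards [(memLp_twist h hu).coeFn_toLp, (memLp_twist h hv).coeFn_toLp] with x h1 h2
  rw [h1, h2, inner_twist h]

/-- Pairing with a test field `c` is an inner product in the Hilbert space, with the element `R c`. -/
lemma inner_toLp_twist_inv (h : IsMatrixSqrt P S R) {u c : Base n → T → ℝ} (hu : WMem P u)
    (hc : MemLp (twist R c) 2 volume) : inner ℝ ((memLp_twist h hu).toLp _) (hc.toLp _)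
      = ∫ x, u x ⬝ᵥ c x := by
  rw [L2.inner_def]
  refine integral_congr_ae ?_
  filter_upwards [(memLp_twist h hu).coeFn_toLp, hc.coeFn_toLp] with x h1 h2
  rw [h1, h2, inner_twist_inv h]

lemma norm_sq_toLp_twist_inv (h : IsMatrixSqrt P S R) {c : Base n → T → ℝ}
    (hc : MemLp (twist R c) 2 volume) : ‖hc.toLp _‖ ^ 2 = ∫ x, c x ⬝ᵥ (P x)⁻¹ *ᵥ c x := by
  rw [← real_inner_self_eq_norm_sq, L2.inner_def]
  refine integral_congr_ae ?_
  filter_upwards [hc.coeFn_toLp] with x h1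
  have hPi : (P x)⁻¹ = R x * R x := by
    refine inv_eq_right_inv ?_
    rw [← h.sq x, mul_assoc, ← mul_assoc (S x) (R x), h.mul_inv, one_mul, h.mul_inv]
  rw [h1, twist, EuclideanSpace.inner_toLp_toLp, star_trivial, hPi, ← mulVec_mulVec,
    quad_comm (h.symm_inv x), dotProduct_comm]

end

section
variable {P : Base n → Matrix T T ℝ}

/-- The Cauchy–Schwarz inequality in the weighted space. -/
lemma WMem.cauchy_schwarz (hP : ∀ x, (P x).PosDef) (hc : ∀ i j, Continuous fun x => P x i j)
    {u v : Base n → T → ℝ} (hu : WMem P u) (hv : WMem P v) :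
    (∫ x, u x ⬝ᵥ P x *ᵥ v x) ^ 2 ≤
      (∫ x, u x ⬝ᵥ P x *ᵥ u x) * ∫ x, v x ⬝ᵥ P x *ᵥ v x := by
  classical
  obtain ⟨S, R, h⟩ := exists_isMatrixSqrt hP hc
  rw [← inner_toLp_twist h hu hv, ← inner_toLp_twist h hu hu, ← inner_toLp_twist h hv hv, sq]
  exact real_inner_mul_inner_self_le _ _

/-- Elements of the weighted space are locally square integrable. -/
lemma WMem.memLp_restrict (hP : ∀ x, (P x).PosDef) (hc : ∀ i j, Continuous fun x => P x i j)
    {u : Base n → T → ℝ} (hu : WMem P u) {C : Set (Base n)} (hC : IsCompact C) (i : T) :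
    MemLp (fun x => u x i) 2 (volume.restrict C) := by
  classical
  obtain ⟨S, R, h⟩ := exists_isMatrixSqrt hP hc
  have h1 : (fun x => u x i) = fun x => ∑ j, R x i j * (twist S u x) j := by
    ext x
    have : u x = R x *ᵥ (S x *ᵥ u x) := by rw [mulVec_mulVec, h.inv_mul, one_mulVec]
    conv_lhs => rw [this]
    rfl
  rw [h1]
  refine memLp_finsetSum _ fun j _ => ?_
  obtain ⟨B, hB⟩ := hC.exists_bound_of_continuousOn (h.cont_inv i j).continuousOn
  have h2 : MemLp (fun x => (twist S u x) j) 2 (volume.restrict C) :=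
    ((memLp_twist h hu).restrict C).eval_piLp j
  refine MemLp.of_le_mul (c := B) h2
    ((h.cont_inv i j).aestronglyMeasurable.mul h2.aestronglyMeasurable) ?_
  filter_upwards [ae_restrict_mem hC.measurableSet] with x hx
  rw [norm_mul]
  exact mul_le_mul_of_nonneg_right (hB x hx) (norm_nonneg _)

/-- The Riesz representation theorem in the weighted space, for a functional that is bounded in
terms of an operator `B` with values in continuous, compactly supported tensor fields. -/
theorem weighted_riesz [DecidableEq T] (hP : ∀ x, (P x).PosDef) (hc : ∀ i j, Continuous fun x => P x i j)
    {V : Type*} [AddCommGroup V] [Module ℝ V] (B : V →ₗ[ℝ] (Base n → T → ℝ))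
    (hBc : ∀ v i, Continuous fun x => B v x i)
    (hBs : ∀ v, ∃ C, IsCompact C ∧ ∀ x ∉ C, B v x = 0) (ℓ : V →ₗ[ℝ] ℝ) {c : ℝ} (hc0 : 0 ≤ c)
    (hℓ : ∀ v, ℓ v ^ 2 ≤ c * ∫ x, B v x ⬝ᵥ (P x)⁻¹ *ᵥ B v x) :
    ∃ u, WMem P u ∧ (∫ x, u x ⬝ᵥ P x *ᵥ u x) ≤ c ∧ ∀ v, ∫ x, u x ⬝ᵥ B v x = ℓ v := by
  obtain ⟨S, R, h⟩ := exists_isMatrixSqrt hP hc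
  have hB : ∀ v, MemLp (twist R (B v)) 2 volume := fun v => by
    obtain ⟨C, hC, h0⟩ := hBs v
    exact memLp_twist_inv h (hBc v) hC h0
  set L : V →ₗ[ℝ] Lp (EuclideanSpace ℝ T) 2 (volume (α := Base n)) :=
    { toFun := fun v => (hB v).toLp _
      map_add' := fun v w => by
        rw [← MemLp.toLp_add]
        congr 1
        ext1 x
        simp [twist, mulVec_add]
      map_smul' := fun r v => by
        rw [RingHom.id_apply, ← MemLp.toLp_const_smul]
        congr 1
        ext1 x
        simp [twist, mulVec_smul] } with hL
  have hLn : ∀ v, ‖L v‖ ^ 2 = ∫ x, B v x ⬝ᵥ (P x)⁻¹ *ᵥ B v x := fun v =>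
    norm_sq_toLp_twist_inv h (hB v)
  have hbound : ∀ v, |ℓ v| ≤ Real.sqrt c * ‖L v‖ := fun v => by
    refine abs_le_of_sq_le_sq ?_ (by positivity)
    rw [mul_pow, Real.sq_sqrt hc0, hLn]
    exact hℓ v
  -- the functional descends to the range of `B`
  obtain ⟨r, hr⟩ := LinearMap.exists_rightInverse_of_surjective L.rangeRestrict
    (LinearMap.range_rangeRestrict L)
  have hr' : ∀ y : LinearMap.range L, L (r y) = y := fun y =>
    congrArg Subtype.val (LinearMap.congr_fun hr y)
  set F : StrongDual ℝ (LinearMap.range L) := (ℓ ∘ₗ r).mkContinuous (Real.sqrt c) fun y => by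
    have := hbound (r y)
    rwa [hr'] at this with hF
  obtain ⟨G, hG, hGn⟩ := exists_extension_norm_eq _ F
  set f := (InnerProductSpace.toDual ℝ (Lp (EuclideanSpace ℝ T) 2 (volume (α := Base n)))).symm G
    with hf
  obtain ⟨u, hu, huf⟩ := exists_twist_eq h f
  have hutoLp : (memLp_twist h hu).toLp _ = f := by
    refine Lp.ext ?_
    filter_upwards [(memLp_twist h hu).coeFn_toLp] with x hx
    rw [hx, huf]
  refine ⟨u, hu, ?_, fun v => ?_⟩
  · rw [← inner_toLp_twist h hu hu, hutoLp, real_inner_self_eq_norm_sq, hf,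
      LinearIsometryEquiv.norm_map, hGn]
    have : ‖F‖ ≤ Real.sqrt c := LinearMap.mkContinuous_norm_le _ (Real.sqrt_nonneg _) _
    calc ‖F‖ ^ 2 ≤ Real.sqrt c ^ 2 := by gcongr
      _ = c := Real.sq_sqrt hc0
  · rw [← inner_toLp_twist_inv h hu (hB v), hutoLp, hf]
    change inner ℝ _ (L v) = _
    rw [InnerProductSpace.toDual_symm_apply]
    have h1 := hG ⟨L v, LinearMap.mem_range_self L v⟩
    rw [h1, hF]
    change ℓ (r ⟨L v, LinearMap.mem_range_self L v⟩) = ℓ v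
    have h2 : L (r ⟨L v, LinearMap.mem_range_self L v⟩ - v) = 0 := by rw [map_sub, hr', sub_self]
    have h3 := hbound (r ⟨L v, LinearMap.mem_range_self L v⟩ - v)
    rw [h2, norm_zero, mul_zero] at h3
    have h4 := abs_nonpos_iff.mp h3
    rw [map_sub, sub_eq_zero] at h4
    exact h4

/-- Orthogonal projection in the weighted space, onto the subspace of the `u` that are annihilated
by a set of continuous, compactly supported test fields. -/
theorem weighted_projection (hP : ∀ x, (P x).PosDef) (hc : ∀ i j, Continuous fun x => P x i j)
    (𝒯 : Set (Base n → T → ℝ)) (h𝒯 : ∀ c ∈ 𝒯, (∀ i, Continuous fun x => c x i) ∧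
      ∃ C, IsCompact C ∧ ∀ x ∉ C, c x = 0) {w : Base n → T → ℝ} (hw : WMem P w) :
    ∃ u, WMem P u ∧ (∀ c ∈ 𝒯, ∫ x, u x ⬝ᵥ c x = 0) ∧
      ∀ v, WMem P v → (∀ c ∈ 𝒯, ∫ x, v x ⬝ᵥ c x = 0) →
        ∫ x, v x ⬝ᵥ P x *ᵥ u x = ∫ x, v x ⬝ᵥ P x *ᵥ w x := by
  classical
  obtain ⟨S, R, h⟩ := exists_isMatrixSqrt hP hc
  have hm : ∀ c ∈ 𝒯, MemLp (twist R c) 2 volume := fun c hc => by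
    obtain ⟨h1, C, hC, h0⟩ := h𝒯 c hc
    exact memLp_twist_inv h h1 hC h0
  set W := Submodule.span ℝ (Set.range fun c : 𝒯 => (hm c c.2).toLp _) with hW
  have hK : ∀ {v : Base n → T → ℝ} (hv : WMem P v), (memLp_twist h hv).toLp _ ∈ Wᗮ ↔
      ∀ c ∈ 𝒯, ∫ x, v x ⬝ᵥ c x = 0 := by
    intro v hv
    rw [hW, Submodule.mem_orthogonal']
    constructor
    · intro H c hc
      rw [← inner_toLp_twist_inv h hv (hm c hc)]
      exact H _ (Submodule.subset_span ⟨⟨c, hc⟩, rfl⟩)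
    · intro H y hy
      induction hy using Submodule.span_induction with
      | mem y hy =>
        obtain ⟨c, rfl⟩ := hy
        rw [inner_toLp_twist_inv h hv (hm c c.2)]
        exact H c c.2
      | zero => simp
      | add a b _ _ ha hb => rw [inner_add_right, ha, hb, add_zero]
      | smul a y _ hy => rw [inner_smul_right, hy, mul_zero]
  have : CompleteSpace Wᗮ := Submodule.instOrthogonalCompleteSpace W
  have : Wᗮ.HasOrthogonalProjection := Submodule.HasOrthogonalProjection.ofCompleteSpace Wᗮ
  set f := Wᗮ.starProjection ((memLp_twist h hw).toLp _) with hf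
  obtain ⟨u, hu, huf⟩ := exists_twist_eq h f
  have hutoLp : (memLp_twist h hu).toLp _ = f := by
    refine Lp.ext ?_
    filter_upwards [(memLp_twist h hu).coeFn_toLp] with x hx
    rw [hx, huf]
  refine ⟨u, hu, ?_, fun v hv hv0 => ?_⟩
  · rw [← hK hu, hutoLp, hf]
    exact Submodule.starProjection_apply_mem _ _
  · have hvK := (hK hv).mpr hv0
    rw [← inner_toLp_twist h hv hu, ← inner_toLp_twist h hv hw, hutoLp, hf,
      ← sub_eq_zero, ← inner_sub_right]
    have h1 := Submodule.sub_starProjection_mem_orthogonal (K := Wᗮ) ((memLp_twist h hw).toLp _)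
    have h2 := (Submodule.mem_orthogonal _ _).mp h1 _ hvK
    rw [← neg_sub, inner_neg_right, h2, neg_zero]

end

end WeightedSpace

/-! ### Oscillation in L² -/

lemma sq_eLpNorm_two {α : Type*} [MeasurableSpace α] (f : α → ℝ) (μ : Measure α) :
    eLpNorm f 2 μ ^ 2 = ∫⁻ x, ‖f x‖ₑ ^ 2 ∂μ := by
  have h := eLpNorm_nnreal_pow_eq_lintegral (f := f) (μ := μ) (p := 2) (by norm_num)
  simpa using h

/-- Translations are continuous in `L²`. -/
lemma lintegral_translate_sub_le {v : Base n → ℝ} (hv : MemLp v 2 volume) {η : ℝ≥0∞} (hη : 0 < η) :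
    ∃ δ > 0, ∀ z : Base n, ‖z‖ < δ → ∫⁻ x, ‖v (x - z) - v x‖ₑ ^ 2 ≤ η := by
  set τ : Base n → C(Base n, Base n) := fun z =>
    (ContinuousMap.mk (fun a : Base n × Base n => a.2 - a.1) (by fun_prop)).curry z with hτ
  have hτc : Continuous τ := ContinuousMap.continuous _
  have hmp : ∀ z, MeasurePreserving (τ z) (volume : Measure (Base n)) volume := fun z =>
    measurePreserving_sub_right volume z
  have hc : Continuous fun z => Lp.compMeasurePreserving (τ z) (hmp z) (hv.toLp v) :=
    continuous_const.compMeasurePreservingLp hτc hmp (by norm_num)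
  have h0 : Tendsto (fun z => ‖Lp.compMeasurePreserving (τ z) (hmp z) (hv.toLp v)
      - hv.toLp v‖ₑ ^ 2) (𝓝 0) (𝓝 0) := by
    have h1 : Lp.compMeasurePreserving (τ 0) (hmp 0) (hv.toLp v) = hv.toLp v := by
      refine Lp.ext ?_
      filter_upwards [Lp.coeFn_compMeasurePreserving (hv.toLp v) (hmp 0)] with x hx
      rw [hx]
      simp [hτ]
    have h2 : Continuous fun z => ‖Lp.compMeasurePreserving (τ z) (hmp z) (hv.toLp v)
      - hv.toLp v‖ₑ ^ 2 := (ENNReal.continuous_pow 2).comp (hc.sub continuous_const).enorm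
    have := h2.tendsto 0
    simpa [h1] using this
  have h3 : ∀ z, ‖Lp.compMeasurePreserving (τ z) (hmp z) (hv.toLp v) - hv.toLp v‖ₑ ^ 2
      = ∫⁻ x, ‖v (x - z) - v x‖ₑ ^ 2 := by
    intro z
    rw [Lp.enorm_def, sq_eLpNorm_two]
    refine lintegral_congr_ae ?_
    filter_upwards [Lp.coeFn_sub (Lp.compMeasurePreserving (τ z) (hmp z) (hv.toLp v)) (hv.toLp v),
      Lp.coeFn_compMeasurePreserving (hv.toLp v) (hmp z), hv.coeFn_toLp,
      (hmp z).quasiMeasurePreserving.ae hv.coeFn_toLp] with x h1 h2 h3 h4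
    rw [h1, Pi.sub_apply, h2, h3, Function.comp_apply, h4]
    rfl
  simp only [h3] at h0
  obtain ⟨δ, hδ, hball⟩ := Metric.eventually_nhds_iff.mp (h0.eventually (ge_mem_nhds hη))
  exact ⟨δ, hδ, fun z hz => hball (by simpa using hz)⟩

/-- The Cauchy–Schwarz inequality against the constant function. -/
lemma sq_lintegral_le {α : Type*} [MeasurableSpace α] (μ : Measure α) {f : α → ℝ≥0∞}
    (hf : AEMeasurable f μ) : (∫⁻ x, f x ∂μ) ^ 2 ≤ μ Set.univ * ∫⁻ x, f x ^ 2 ∂μ := by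
  have h := ENNReal.lintegral_mul_le_Lp_mul_Lq μ Real.HolderConjugate.two_two hf
    (aemeasurable_const (b := 1))
  simp only [Pi.mul_apply, mul_one, ENNReal.one_rpow, lintegral_const, one_mul] at h
  calc (∫⁻ x, f x ∂μ) ^ 2
      ≤ ((∫⁻ x, f x ^ (2 : ℝ) ∂μ) ^ (1 / 2 : ℝ) * μ Set.univ ^ (1 / 2 : ℝ)) ^ 2 := by gcongr
    _ = μ Set.univ * ∫⁻ x, f x ^ 2 ∂μ := by
      rw [mul_pow, ← ENNReal.rpow_natCast, ← ENNReal.rpow_natCast, ← ENNReal.rpow_mul,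
        ← ENNReal.rpow_mul]
      norm_num
      rw [mul_comm]

lemma ennreal_add_sq_le (a b : ℝ≥0∞) : (a + b) ^ 2 ≤ 2 * (a ^ 2 + b ^ 2) := by
  have := ENNReal.rpow_add_le_mul_rpow_add_rpow a b (one_le_two (α := ℝ))
  norm_num at this
  exact this

/-- A family of functions that is pointwise dominated by the mean oscillation of a fixed
square integrable function at scale `κ` tends to zero in `L²`. -/
theorem tendsto_lintegral_of_oscillation {v : Base n → ℝ} (hv : MemLp v 2 volume)
    (hvm : Measurable v) {h : ℝ → Base n → ℝ} {C : Set (Base n)} (hC : MeasurableSet C)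
    {A B : ℝ≥0} (hh : ∀ κ, 0 < κ → κ ≤ 1 → ∀ x ∈ C, ‖h κ x‖ₑ ≤
      A * (∫⁻ w in Metric.ball (0 : Base n) 1, ‖v (x - κ • w) - v x‖ₑ)
        + B * ENNReal.ofReal κ * ‖v x‖ₑ) :
    Tendsto (fun κ => ∫⁻ x in C, ‖h κ x‖ₑ ^ 2) (𝓝[>] 0) (𝓝 0) := by
  set U := Metric.ball (0 : Base n) 1 with hU
  have hUfin : volume U < ∞ := measure_ball_lt_top
  have hvn : ∫⁻ x, ‖v x‖ₑ ^ 2 < ∞ := by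
    rw [← sq_eLpNorm_two]
    exact ENNReal.pow_lt_top hv.2
  -- the mean oscillation: Cauchy–Schwarz and Fubini reduce it to the continuity of translations
  have hosc : Tendsto (fun κ : ℝ => ∫⁻ x, (∫⁻ w in U, ‖v (x - κ • w) - v x‖ₑ) ^ 2) (𝓝[>] 0)
      (𝓝 0) := by
    rw [ENNReal.tendsto_nhds_zero]
    intro η hη
    obtain ⟨η', hη', hle⟩ : ∃ η' > 0, volume U * (volume U * η') ≤ η := by
      by_cases h0 : volume U = 0
      · exact ⟨1, one_pos, by simp [h0]⟩
      rcases eq_or_ne η ∞ with rfl | hηt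
      · exact ⟨1, one_pos, le_top⟩
      refine ⟨η / (volume U * volume U), ENNReal.div_pos hη.ne'
        (ENNReal.mul_ne_top hUfin.ne hUfin.ne), ?_⟩
      rw [← mul_assoc, ENNReal.mul_div_cancel (mul_ne_zero h0 h0)
        (ENNReal.mul_ne_top hUfin.ne hUfin.ne)]
    obtain ⟨δ, hδ, hτ⟩ := lintegral_translate_sub_le hv hη'
    filter_upwards [Ioo_mem_nhdsGT hδ] with κ hκ
    have hm : Measurable fun p : Base n × Base n => ‖v (p.1 - κ • p.2) - v p.1‖ₑ ^ 2 :=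
      (((hvm.comp (by fun_prop)).sub (hvm.comp measurable_fst)).enorm).pow_const 2
    calc ∫⁻ x, (∫⁻ w in U, ‖v (x - κ • w) - v x‖ₑ) ^ 2
        ≤ ∫⁻ x, volume U * ∫⁻ w in U, ‖v (x - κ • w) - v x‖ₑ ^ 2 := by
          refine lintegral_mono fun x => ?_
          have := sq_lintegral_le (volume.restrict U) (f := fun w => ‖v (x - κ • w) - v x‖ₑ)
            (((hvm.comp (by fun_prop)).sub measurable_const).enorm.aemeasurable)
          simpa using this
      _ = volume U * ∫⁻ w in U, ∫⁻ x, ‖v (x - κ • w) - v x‖ₑ ^ 2 := by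
          rw [lintegral_const_mul' _ _ hUfin.ne, lintegral_lintegral_swap]
          exact hm.aemeasurable
      _ ≤ volume U * ∫⁻ w in U, η' := by
          gcongr 1
          refine setLIntegral_mono measurable_const fun w hw => hτ _ ?_
          rw [norm_smul, Real.norm_of_nonneg hκ.1.le]
          have : ‖w‖ < 1 := by simpa [hU] using hw
          nlinarith [norm_nonneg w, hκ.1, hκ.2]
      _ = volume U * (volume U * η') := by simp [mul_comm]
      _ ≤ η := hle
  have hlin : Tendsto (fun κ : ℝ => (B * ENNReal.ofReal κ) ^ 2 * ∫⁻ x, ‖v x‖ₑ ^ 2) (𝓝[>] 0)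
      (𝓝 0) := by
    have h1 : Tendsto (fun κ : ℝ => ENNReal.ofReal κ) (𝓝[>] 0) (𝓝 0) := by
      have := (ENNReal.continuous_ofReal.tendsto 0).mono_left (nhdsWithin_le_nhds (s := Set.Ioi 0))
      simpa using this
    have h2 := ENNReal.Tendsto.const_mul (a := (B : ℝ≥0∞)) h1 (Or.inr ENNReal.coe_ne_top)
    rw [mul_zero] at h2
    have h3 := ENNReal.Tendsto.mul_const (b := ∫⁻ x, ‖v x‖ₑ ^ 2)
      (((ENNReal.continuous_pow 2).tendsto 0).comp h2) (Or.inr hvn.ne)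
    simpa using h3
  have hsum : Tendsto (fun κ : ℝ => 2 * ((A : ℝ≥0∞) ^ 2 *
      (∫⁻ x, (∫⁻ w in U, ‖v (x - κ • w) - v x‖ₑ) ^ 2) +
      (B * ENNReal.ofReal κ) ^ 2 * ∫⁻ x, ‖v x‖ₑ ^ 2)) (𝓝[>] 0) (𝓝 0) := by
    have h1 := ENNReal.Tendsto.const_mul (a := (A : ℝ≥0∞) ^ 2) hosc
      (Or.inr (ENNReal.pow_ne_top ENNReal.coe_ne_top))
    have h2 := ENNReal.Tendsto.const_mul (a := (2 : ℝ≥0∞)) (h1.add hlin) (Or.inr (by norm_num))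
    simpa using h2
  refine tendsto_of_tendsto_of_tendsto_of_le_of_le' tendsto_const_nhds hsum
    (Eventually.of_forall fun _ => zero_le) ?_
  filter_upwards [Ioc_mem_nhdsGT (zero_lt_one (α := ℝ))] with κ hκ
  calc ∫⁻ x in C, ‖h κ x‖ₑ ^ 2
      ≤ ∫⁻ x in C, 2 * ((A : ℝ≥0∞) ^ 2 * (∫⁻ w in U, ‖v (x - κ • w) - v x‖ₑ) ^ 2 +
        (B * ENNReal.ofReal κ) ^ 2 * ‖v x‖ₑ ^ 2) := by
        refine setLIntegral_mono' hC fun x hx => ?_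
        rw [← mul_pow, ← mul_pow]
        exact (pow_le_pow_left₀ (zero_le) (hh κ hκ.1 hκ.2 x hx) 2).trans (ennreal_add_sq_le _ _)
    _ ≤ ∫⁻ x, 2 * ((A : ℝ≥0∞) ^ 2 * (∫⁻ w in U, ‖v (x - κ • w) - v x‖ₑ) ^ 2 +
        (B * ENNReal.ofReal κ) ^ 2 * ‖v x‖ₑ ^ 2) := setLIntegral_le_lintegral _ _
    _ = _ := by
        have hBt : (B * ENNReal.ofReal κ) ^ 2 ≠ ∞ :=
          ENNReal.pow_ne_top (ENNReal.mul_ne_top ENNReal.coe_ne_top ENNReal.ofReal_ne_top)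
        rw [lintegral_const_mul' _ _ (by norm_num), lintegral_add_right,
          lintegral_const_mul' _ _ (ENNReal.pow_ne_top ENNReal.coe_ne_top),
          lintegral_const_mul' _ _ hBt]
        exact (hvm.enorm.pow_const 2).const_mul _

/-! ### Mollification -/

/-- A smooth bump function with integral one, supported in the unit ball. -/
noncomputable def bump (n : ℕ) : Base n → ℝ :=
  (ContDiffBump.mk (c := (0 : Base n)) 2⁻¹ 1 (by norm_num) (by norm_num)).normed volume

lemma contDiff_bump : ContDiff ℝ (⊤ : ℕ∞) (bump n) := ContDiffBump.contDiff_normed _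

lemma bump_eq_zero {x : Base n} (hx : x ∉ Metric.ball (0 : Base n) 1) : bump n x = 0 := by
  have h := ContDiffBump.support_normed_eq (μ := (volume : Measure (Base n)))
    (ContDiffBump.mk (c := (0 : Base n)) 2⁻¹ 1 (by norm_num) (by norm_num))
  by_contra h0
  exact hx (h ▸ (Function.mem_support.mpr h0))

lemma integral_bump : ∫ x, bump n x = 1 := ContDiffBump.integral_normed _

lemma isCompact_unit : IsCompact (Metric.closedBall (0 : Base n) 1) := isCompact_closedBall 0 1

lemma bump_eq_zero' {x : Base n} (hx : x ∉ Metric.closedBall (0 : Base n) 1) : bump n x = 0 :=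
  bump_eq_zero fun h => hx (Metric.ball_subset_closedBall h)

lemma pd_bump_eq_zero {k : Fin n} {x : Base n} (hx : x ∉ Metric.ball (0 : Base n) 1) :
    pd k (bump n) x = 0 := by
  -- a nonnegative function has a critical point where it vanishes
  have hmin : IsLocalMin (bump n) x := Eventually.of_forall fun y => by
    rw [bump_eq_zero hx]
    exact ContDiffBump.nonneg_normed _ y
  simp [pd, hmin.fderiv_eq_zero]

/-- The rescaled bump function, supported in the ball of radius `κ`. -/
noncomputable def bumpScaled (κ : ℝ) (x : Base n) : ℝ := (κ ^ n)⁻¹ * bump n (κ⁻¹ • x)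

lemma contDiff_bumpScaled (κ : ℝ) : ContDiff ℝ (⊤ : ℕ∞) (bumpScaled (n := n) κ) :=
  contDiff_const.mul (contDiff_bump.comp (contDiff_const_smul κ⁻¹))

lemma bumpScaled_eq_zero {κ : ℝ} (hκ : 0 < κ) {x : Base n} (hx : x ∉ Metric.closedBall 0 κ) :
    bumpScaled κ x = 0 := by
  rw [bumpScaled, bump_eq_zero', mul_zero]
  simp only [mem_closedBall_zero_iff, not_le, norm_smul, norm_inv, Real.norm_of_nonneg hκ.le]
    at hx ⊢
  rw [inv_mul_eq_div, one_lt_div hκ]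
  exact hx

lemma hasCompactSupport_bumpScaled {κ : ℝ} (hκ : 0 < κ) :
    HasCompactSupport (bumpScaled (n := n) κ) :=
  HasCompactSupport.intro (isCompact_closedBall 0 κ) fun _ hx => bumpScaled_eq_zero hκ hx

lemma pd_bumpScaled (κ : ℝ) (k : Fin n) (x : Base n) :
    pd k (bumpScaled κ) x = (κ ^ n)⁻¹ * (κ⁻¹ * pd k (bump n) (κ⁻¹ • x)) := by
  have hd : DifferentiableAt ℝ (bump n) (κ⁻¹ • x) :=
    (contDiff_bump.differentiable (by simp)).differentiableAt
  have h1 : HasFDerivAt (fun x : Base n => bump n (κ⁻¹ • x))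
      ((fderiv ℝ (bump n) (κ⁻¹ • x)).comp (κ⁻¹ • ContinuousLinearMap.id ℝ (Base n))) x :=
    hd.hasFDerivAt.comp x ((hasFDerivAt_id x).const_smul κ⁻¹)
  have h2 := h1.const_mul ((κ ^ n)⁻¹)
  change fderiv ℝ (fun x => (κ ^ n)⁻¹ * bump n (κ⁻¹ • x)) x (stdVec k) = _
  rw [h2.fderiv]
  simp [pd]

/-- Change of variables `y = x - κ w`. -/
lemma integral_scale {κ : ℝ} (hκ : 0 < κ) (x : Base n) (F : Base n → ℝ) :
    ∫ y, F y = κ ^ n * ∫ w, F (x - κ • w) := by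
  have h1 := Measure.integral_comp_smul_of_nonneg volume (fun z => F (x - z)) κ (hR := hκ.le)
  rw [h1, integral_sub_left_eq_self F volume x, finrank_euclideanSpace_fin, smul_eq_mul,
    ← mul_assoc, mul_inv_cancel₀ (pow_pos hκ n).ne', one_mul]

/-- The mollification of a locally integrable function at scale `κ`. -/
noncomputable def moll (κ : ℝ) (u : Base n → ℝ) (x : Base n) : ℝ :=
  ∫ y, u y * bumpScaled κ (x - y)

lemma moll_eq_convolution (κ : ℝ) (u : Base n → ℝ) :
    moll κ u = convolution u (bumpScaled κ) (ContinuousLinearMap.mul ℝ ℝ) volume := rfl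

lemma contDiff_moll {κ : ℝ} (hκ : 0 < κ) {u : Base n → ℝ} (hu : LocallyIntegrable u volume) :
    ContDiff ℝ (⊤ : ℕ∞) (moll κ u) := by
  rw [moll_eq_convolution]
  exact (hasCompactSupport_bumpScaled hκ).contDiff_convolution_right _ hu (contDiff_bumpScaled κ)

lemma hasCompactSupport_fderiv_bumpScaled {κ : ℝ} (hκ : 0 < κ) :
    HasCompactSupport (fderiv ℝ (bumpScaled (n := n) κ)) :=
  (hasCompactSupport_bumpScaled hκ).fderiv ℝ

lemma pd_moll {κ : ℝ} (hκ : 0 < κ) {u : Base n → ℝ} (hu : LocallyIntegrable u volume) (k : Fin n)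
    (x : Base n) : pd k (moll κ u) x = ∫ y, u y * pd k (bumpScaled κ) (x - y) := by
  have h1 : ContDiff ℝ 1 (bumpScaled (n := n) κ) := (contDiff_bumpScaled κ).of_le (by simp)
  have h := (hasCompactSupport_bumpScaled hκ).hasFDerivAt_convolution_right
    (ContinuousLinearMap.mul ℝ ℝ) hu h1 x
  rw [pd, moll_eq_convolution, h.fderiv, convolution_precompR_apply _ hu
    (hasCompactSupport_fderiv_bumpScaled hκ) (h1.continuous_fderiv one_ne_zero)]
  rfl

lemma integrable_mul_comp_sub {u ψ : Base n → ℝ} (hu : LocallyIntegrable u volume)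
    (hψ : Continuous ψ) (hψc : HasCompactSupport ψ) (x : Base n) :
    Integrable fun y => u y * ψ (x - y) :=
  hψc.convolutionExists_right (ContinuousLinearMap.mul ℝ ℝ) hu hψ x

/-! ### Friedrichs' lemma -/

lemma exists_lipschitz_closedBall {f : Base n → ℝ} (hf : ContDiff ℝ (⊤ : ℕ∞) f) (r : ℝ) :
    ∃ L : ℝ≥0, ∀ x ∈ Metric.closedBall (0 : Base n) r, ∀ y ∈ Metric.closedBall (0 : Base n) r,
      |f x - f y| ≤ L * ‖x - y‖ := by
  have hc : Continuous (fderiv ℝ f) := hf.continuous_fderiv (by simp)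
  obtain ⟨L, hL⟩ := (isCompact_closedBall (0 : Base n) r).exists_bound_of_continuousOn
    hc.continuousOn
  refine ⟨L.toNNReal, fun x hx y hy => ?_⟩
  have h := (convex_closedBall (0 : Base n) r).norm_image_sub_le_of_norm_fderiv_le
    (f := f) (𝕜 := ℝ) (C := L) (fun z _ => (hf.differentiable (by simp)).differentiableAt) hL hy hx
  exact h.trans (mul_le_mul_of_nonneg_right (Real.le_coe_toNNReal L) (norm_nonneg _))

lemma exists_bound_of_ball {q : Base n → ℝ} (hq : Continuous q)
    (h0 : ∀ w ∉ Metric.ball (0 : Base n) 1, q w = 0) : ∃ M : ℝ≥0, ∀ w, |q w| ≤ M := by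
  obtain ⟨M, hM⟩ := (isCompact_unit (n := n)).exists_bound_of_continuousOn hq.continuousOn
  refine ⟨M.toNNReal, fun w => ?_⟩
  by_cases hw : w ∈ Metric.ball (0 : Base n) 1
  · exact (hM w (Metric.ball_subset_closedBall hw)).trans (Real.le_coe_toNNReal M)
  · rw [h0 w hw]; simp

lemma hasCompactSupport_of_ball {q : Base n → ℝ}
    (h0 : ∀ w ∉ Metric.ball (0 : Base n) 1, q w = 0) : HasCompactSupport q :=
  HasCompactSupport.intro isCompact_unit fun w hw =>
    h0 w fun h => hw (Metric.ball_subset_closedBall h)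

/-- Averaging `u` against a kernel `q` at scale `κ` differs from `u x * ∫ q` by at most the mean
oscillation of `u` near `x`. -/
lemma enorm_integral_mul_sub_le {u q : Base n → ℝ} (hu : LocallyIntegrable u volume) {κ : ℝ}
    (hκ : 0 < κ) (hq : Continuous q) (h0 : ∀ w ∉ Metric.ball (0 : Base n) 1, q w = 0) {M : ℝ≥0}
    (hM : ∀ w, |q w| ≤ M) (x : Base n) :
    ‖(∫ w, u (x - κ • w) * q w) - u x * ∫ w, q w‖ₑ ≤
      M * ∫⁻ w in Metric.ball (0 : Base n) 1, ‖u (x - κ • w) - u x‖ₑ := by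
  have hqc := hasCompactSupport_of_ball h0
  have hi : Integrable fun w => u (x - κ • w) * q w := by
    have h1 : Integrable fun y => u y * q (κ⁻¹ • (x - y)) := by
      refine integrable_mul_comp_sub (ψ := fun z => q (κ⁻¹ • z)) hu (hq.comp (by fun_prop)) ?_ x
      exact hqc.comp_homeomorph (Homeomorph.smulOfNeZero κ⁻¹ (inv_pos.mpr hκ).ne')
    have h2 := (h1.comp_sub_left x).comp_smul hκ.ne'
    refine h2.congr (Eventually.of_forall fun w => ?_)
    simp [smul_smul, inv_mul_cancel₀ hκ.ne']
  have hi2 : Integrable fun w => u x * q w := (hq.integrable_of_hasCompactSupport hqc).const_mul _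
  rw [← integral_const_mul, ← integral_sub hi hi2]
  calc _ ≤ ∫⁻ w, ‖u (x - κ • w) * q w - u x * q w‖ₑ := enorm_integral_le_lintegral_enorm _
    _ ≤ ∫⁻ w, (Metric.ball (0 : Base n) 1).indicator
        (fun w => M * ‖u (x - κ • w) - u x‖ₑ) w := by
      refine lintegral_mono fun w => ?_
      by_cases hw : w ∈ Metric.ball (0 : Base n) 1
      · rw [Set.indicator_of_mem hw, ← sub_mul, enorm_mul, mul_comm]
        gcongr
        rw [enorm_le_coe, ← NNReal.coe_le_coe]
        exact hM w
      · simp [h0 w hw]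
    _ = M * ∫⁻ w in Metric.ball (0 : Base n) 1, ‖u (x - κ • w) - u x‖ₑ := by
      rw [lintegral_indicator measurableSet_ball, lintegral_const_mul' _ _ ENNReal.coe_ne_top]

/-- Local square integrability. -/
def LocL2 (u : Base n → ℝ) : Prop := ∀ C, IsCompact C → MemLp u 2 (volume.restrict C)

lemma LocL2.locallyIntegrable {u : Base n → ℝ} (hu : LocL2 u) : LocallyIntegrable u volume := by
  rw [locallyIntegrable_iff]
  intro C hC
  have : IsFiniteMeasure (volume.restrict C) := ⟨by simpa using hC.measure_lt_top⟩
  exact (hu C hC).integrable (by norm_num)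

/-- A localized form of `tendsto_lintegral_of_oscillation`. -/
lemma tendsto_lintegral_of_local_oscillation {u : Base n → ℝ} (hu : LocL2 u) (hum : Measurable u)
    {h : ℝ → Base n → ℝ} {C : Set (Base n)} (hC : IsCompact C) {A B : ℝ≥0}
    (hh : ∀ κ, 0 < κ → κ ≤ 1 → ∀ x ∈ C, ‖h κ x‖ₑ ≤
      A * (∫⁻ w in Metric.ball (0 : Base n) 1, ‖u (x - κ • w) - u x‖ₑ)
        + B * ENNReal.ofReal κ * ‖u x‖ₑ) :
    Tendsto (fun κ => ∫⁻ x in C, ‖h κ x‖ₑ ^ 2) (𝓝[>] 0) (𝓝 0) := by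
  obtain ⟨r, hr⟩ := hC.isBounded.subset_closedBall (0 : Base n)
  set D := Metric.closedBall (0 : Base n) (r + 1) with hD
  have hv : MemLp (D.indicator u) 2 volume :=
    (memLp_indicator_iff_restrict measurableSet_closedBall).mpr (hu D (isCompact_closedBall 0 _))
  refine tendsto_lintegral_of_oscillation hv (hum.indicator measurableSet_closedBall)
    hC.measurableSet (A := A) (B := B) fun κ h0 h1 x hx => ?_
  have hxr : ‖x‖ ≤ r := by simpa using hr hx
  have hxD : x ∈ D := by rw [hD, mem_closedBall_zero_iff]; linarith
  rw [Set.indicator_of_mem hxD]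
  convert! hh κ h0 h1 x hx using 3
  refine setLIntegral_congr_fun measurableSet_ball fun w hw => ?_
  have : x - κ • w ∈ D := by
    rw [hD, mem_closedBall_zero_iff]
    have h2 : ‖w‖ < 1 := by simpa using hw
    have h3 : ‖κ • w‖ ≤ 1 := by
      rw [norm_smul, Real.norm_of_nonneg h0.le]
      nlinarith [norm_nonneg w]
    linarith [norm_sub_le x (κ • w)]
  simp only [Set.indicator_of_mem this]

lemma moll_eq {κ : ℝ} (hκ : 0 < κ) (u : Base n → ℝ) (x : Base n) :
    moll κ u x = ∫ w, u (x - κ • w) * bump n w := by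
  rw [moll, integral_scale hκ x, ← integral_const_mul]
  congr 1
  ext w
  rw [bumpScaled, sub_sub_cancel, smul_smul, inv_mul_cancel₀ hκ.ne', one_smul]
  have := (pow_pos hκ n).ne'
  field_simp

/-- Mollifications converge in `L²` on compact sets. -/
theorem tendsto_moll {u : Base n → ℝ} (hu : LocL2 u) (hum : Measurable u) {C : Set (Base n)}
    (hC : IsCompact C) :
    Tendsto (fun κ => ∫⁻ x in C, ‖moll κ u x - u x‖ₑ ^ 2) (𝓝[>] 0) (𝓝 0) := by
  obtain ⟨M, hM⟩ := exists_bound_of_ball contDiff_bump.continuous fun w hw =>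
    bump_eq_zero (n := n) hw
  refine tendsto_lintegral_of_local_oscillation hu hum hC (A := M) (B := 0) fun κ h0 _ x _ => ?_
  have := enorm_integral_mul_sub_le hu.locallyIntegrable h0 contDiff_bump.continuous
    (fun w hw => bump_eq_zero hw) hM x
  rw [integral_bump, mul_one, ← moll_eq h0] at this
  simpa using this

/-- Friedrichs' lemma: the commutator of a first order operator with mollification tends to zero in
`L²` on compact sets. After rescaling, the commutator has a bounded kernel `q` with integral `O(κ)`,
so it is controlled by the oscillation of `u`. -/
theorem tendsto_friedrichs {u : Base n → ℝ} (hu : LocL2 u) (hum : Measurable u) {c : Base n → ℝ}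
    (hc : ContDiff ℝ (⊤ : ℕ∞) c) (k : Fin n) {C : Set (Base n)} (hC : IsCompact C) :
    Tendsto (fun κ => ∫⁻ x in C, ‖pd k (fun y => c y * moll κ u y) x -
      ∫ y, c y * u y * pd k (bumpScaled κ) (x - y)‖ₑ ^ 2) (𝓝[>] 0) (𝓝 0) := by
  obtain ⟨r, hr⟩ := hC.isBounded.subset_closedBall (0 : Base n)
  obtain ⟨L, hL⟩ := exists_lipschitz_closedBall hc (r + 1)
  obtain ⟨L', hL'⟩ := exists_lipschitz_closedBall (contDiff_pd hc k) (r + 1)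
  obtain ⟨M0, hM0⟩ := exists_bound_of_ball contDiff_bump.continuous fun w hw =>
    bump_eq_zero (n := n) hw
  obtain ⟨M1, hM1⟩ := exists_bound_of_ball (continuous_pd contDiff_bump k) fun w hw =>
    pd_bump_eq_zero hw
  obtain ⟨N, hN⟩ := hC.exists_bound_of_continuousOn (continuous_pd hc k).continuousOn
  have hul := hu.locallyIntegrable
  have hcul : LocallyIntegrable (fun y => c y * u y) volume := by
    rw [locallyIntegrable_iff]
    intro D hD
    exact (hul.integrableOn_isCompact hD).continuousOn_mul hc.continuous.continuousOn hD
  refine tendsto_lintegral_of_local_oscillation hu hum hC (A := N.toNNReal * M0 + L * M1) (B := L')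
    fun κ h0 h1 x hx => ?_
  have hxr : ‖x‖ ≤ r := by simpa using hr hx
  have hxD : x ∈ Metric.closedBall (0 : Base n) (r + 1) := by
    rw [mem_closedBall_zero_iff]; linarith
  have hwD : ∀ w ∈ Metric.ball (0 : Base n) 1,
      x - κ • w ∈ Metric.closedBall (0 : Base n) (r + 1) := fun w hw => by
    rw [mem_closedBall_zero_iff]
    have h2 : ‖w‖ < 1 := by simpa using hw
    have h3 : ‖κ • w‖ ≤ 1 := by
      rw [norm_smul, Real.norm_of_nonneg h0.le]
      nlinarith [norm_nonneg w]
    linarith [norm_sub_le x (κ • w)]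
  have hdist : ∀ w, ‖x - (x - κ • w)‖ = κ * ‖w‖ := fun w => by
    rw [sub_sub_cancel, norm_smul, Real.norm_of_nonneg h0.le]
  -- the kernel of the commutator, in the variable `w = (x - y) / κ`
  set q : Base n → ℝ := fun w => pd k c x * bump n w +
    κ⁻¹ * (c x - c (x - κ • w)) * pd k (bump n) w with hq
  have hcw : Continuous fun w : Base n => c x - c (x - κ • w) :=
    continuous_const.sub (hc.continuous.comp (by fun_prop))
  have hqc : Continuous q := (continuous_const.mul contDiff_bump.continuous).add
    ((continuous_const.mul hcw).mul (continuous_pd contDiff_bump k))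
  have hq0 : ∀ w ∉ Metric.ball (0 : Base n) 1, q w = 0 := fun w hw => by
    simp [hq, bump_eq_zero hw, pd_bump_eq_zero hw]
  have hqM : ∀ w, |q w| ≤ (N.toNNReal * M0 + L * M1 : ℝ≥0) := fun w => by
    by_cases hw : w ∈ Metric.ball (0 : Base n) 1
    · have hw1 : ‖w‖ < 1 := by simpa using hw
      have e1 : |κ⁻¹ * (c x - c (x - κ • w))| ≤ L := by
        rw [abs_mul, abs_of_pos (inv_pos.mpr h0), inv_mul_le_iff₀ h0]
        refine (hL x hxD _ (hwD w hw)).trans ?_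
        rw [hdist]
        have : (0 : ℝ) ≤ L := L.coe_nonneg
        nlinarith [mul_nonneg this h0.le, norm_nonneg w]
      have e2 : |pd k c x| ≤ N.toNNReal := (hN x hx).trans (Real.le_coe_toNNReal N)
      calc |q w| ≤ |pd k c x| * |bump n w| + |κ⁻¹ * (c x - c (x - κ • w))| * |pd k (bump n) w| := by
            rw [← abs_mul, ← abs_mul]; exact abs_add_le _ _
        _ ≤ N.toNNReal * M0 + L * M1 := by
            gcongr
            · exact hM0 w
            · exact hM1 w
        _ = _ := by push_cast; rfl
    · rw [hq0 w hw, abs_zero]; exact NNReal.coe_nonneg _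
  have hrepr : pd k (fun y => c y * moll κ u y) x - ∫ y, c y * u y * pd k (bumpScaled κ) (x - y)
      = ∫ w, u (x - κ • w) * q w := by
    rw [pd_mul k (hc.differentiable (by simp)).differentiableAt
      ((contDiff_moll h0 hul).differentiable (by simp)).differentiableAt, pd_moll h0 hul, moll]
    have hψ := contDiff_bumpScaled (n := n) κ
    have i1 := integrable_mul_comp_sub hul hψ.continuous (hasCompactSupport_bumpScaled h0) x
    have hpc : HasCompactSupport (pd k (bumpScaled (n := n) κ)) :=
      HasCompactSupport.intro (isCompact_closedBall 0 κ) fun _ hy =>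
        pd_eq_zero_of_eventually Metric.isClosed_closedBall (fun _ => bumpScaled_eq_zero h0) hy
    have i2 := integrable_mul_comp_sub hul (continuous_pd hψ k) hpc x
    have i3 := integrable_mul_comp_sub hcul (continuous_pd hψ k) hpc x
    have i12 : Integrable fun y => pd k c x * (u y * bumpScaled κ (x - y)) +
        c x * (u y * pd k (bumpScaled κ) (x - y)) := (i1.const_mul _).add (i2.const_mul _)
    rw [← integral_const_mul, ← integral_const_mul,
      ← integral_add (i1.const_mul _) (i2.const_mul _), ← integral_sub i12 i3,
      integral_scale h0 x, ← integral_const_mul]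
    congr 1
    ext w
    rw [sub_sub_cancel, bumpScaled, pd_bumpScaled, smul_smul, inv_mul_cancel₀ h0.ne', one_smul, hq]
    have := (pow_pos h0 n).ne'
    field_simp
    ring
  -- integration by parts cancels the main terms of the integral of the kernel
  have hqint : |∫ w, q w| ≤ L' * κ := by
    have hg : ContDiff ℝ (⊤ : ℕ∞) fun w : Base n => c x - c (x - κ • w) :=
      contDiff_const.sub (hc.comp (contDiff_const.sub (contDiff_const_smul κ)))
    have hpg : ∀ w, pd k (fun w : Base n => c x - c (x - κ • w)) w = κ * pd k c (x - κ • w) := by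
      intro w
      have hd : HasFDerivAt c (fderiv ℝ c (x - κ • w)) (x - κ • w) :=
        ((hc.differentiable (by simp)).differentiableAt).hasFDerivAt
      have h2 : HasFDerivAt (fun w : Base n => x - κ • w)
          (-(κ • ContinuousLinearMap.id ℝ (Base n))) w :=
        ((hasFDerivAt_id w).const_smul κ).const_sub x
      have h3 := (hd.comp w h2).const_sub (c x)
      change fderiv ℝ (fun w : Base n => c x - c (x - κ • w)) w (stdVec k) = _
      have h4 : fderiv ℝ (fun w : Base n => c x - c (x - κ • w)) w = _ := h3.fderiv
      rw [h4]
      simp [pd]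
    have hibp := integral_mul_pd contDiff_bump hg isCompact_unit (fun w hw => bump_eq_zero' hw) k
    simp only [hpg] at hibp
    have hb := contDiff_bump (n := n)
    have hcs : ∀ {f g : Base n → ℝ}, Continuous f → Continuous g →
        (∀ w ∉ Metric.closedBall (0 : Base n) 1, f w = 0) → Integrable fun w => f w * g w :=
      fun hf hg h0 => integrable_of_continuous_of_compact (hf.mul hg) isCompact_unit
        fun w hw => by rw [h0 w hw, zero_mul]
    have hcont : Continuous fun w : Base n => pd k c (x - κ • w) :=
      (continuous_pd hc k).comp (by fun_prop)
    have hqeq : ∫ w, q w = ∫ w, bump n w * (pd k c x - pd k c (x - κ • w)) := by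
      have e1 : ∫ w, q w = (∫ w, bump n w * pd k c x) +
          κ⁻¹ * ∫ w, pd k (bump n) w * (c x - c (x - κ • w)) := by
        rw [← integral_const_mul, ← integral_add (hcs hb.continuous continuous_const
          fun w hw => bump_eq_zero' hw) ((hcs (continuous_pd hb k) hcw fun w hw =>
            pd_bump_eq_zero fun h => hw (Metric.ball_subset_closedBall h)).const_mul _)]
        congr 1
        ext w
        rw [hq]
        ring
      have e2 : ∫ w, pd k (bump n) w * (c x - c (x - κ • w))
          = -(κ * ∫ w, bump n w * pd k c (x - κ • w)) := by
        rw [← integral_const_mul]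
        have e3 : ∫ w, bump n w * (κ * pd k c (x - κ • w))
            = ∫ w, κ * (bump n w * pd k c (x - κ • w)) := by
          congr 1; ext w; ring
        linarith
      rw [e1, e2, mul_neg, ← mul_assoc, inv_mul_cancel₀ h0.ne', one_mul, ← sub_eq_add_neg,
        ← integral_sub (hcs hb.continuous continuous_const fun w hw => bump_eq_zero' hw)
          (hcs hb.continuous hcont fun w hw => bump_eq_zero' hw)]
      congr 1
      ext w
      ring
    rw [hqeq]
    have hint : Integrable fun w => bump n w * (L' * κ) :=
      hcs hb.continuous continuous_const fun w hw => bump_eq_zero' hw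
    calc |∫ w, bump n w * (pd k c x - pd k c (x - κ • w))|
        ≤ ∫ w, bump n w * (L' * κ) := by
          rw [← Real.norm_eq_abs]
          refine norm_integral_le_of_norm_le hint (Eventually.of_forall fun w => ?_)
          have hbn : 0 ≤ bump n w := ContDiffBump.nonneg_normed _ w
          rw [norm_mul, Real.norm_of_nonneg hbn]
          by_cases hw : w ∈ Metric.ball (0 : Base n) 1
          · refine mul_le_mul_of_nonneg_left ?_ hbn
            refine (hL' x hxD _ (hwD w hw)).trans ?_
            rw [hdist]
            have hw1 : ‖w‖ < 1 := by simpa using hw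
            have : (0 : ℝ) ≤ L' := L'.coe_nonneg
            nlinarith [mul_nonneg this h0.le]
          · simp [bump_eq_zero hw]
      _ = L' * κ := by rw [integral_mul_const, integral_bump, one_mul]
  rw [hrepr]
  calc ‖∫ w, u (x - κ • w) * q w‖ₑ
      ≤ ‖(∫ w, u (x - κ • w) * q w) - u x * ∫ w, q w‖ₑ + ‖u x * ∫ w, q w‖ₑ := by
        conv_lhs => rw [← sub_add_cancel (∫ w, u (x - κ • w) * q w) (u x * ∫ w, q w)]
        exact enorm_add_le _ _
    _ ≤ _ := by
        refine add_le_add (enorm_integral_mul_sub_le hul h0 hqc hq0 hqM x) ?_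
        rw [enorm_mul, mul_comm]
        gcongr
        rw [← ofReal_norm, ← ENNReal.ofReal_coe_nnreal (p := L'),
          ← ENNReal.ofReal_mul L'.coe_nonneg]
        exact ENNReal.ofReal_le_ofReal hqint

/-! ### Weakly closed forms -/

section L2Convergence

lemma tendsto_eLpNorm_of_sq {ι : Type*} {l : Filter ι} {μ : Measure (Base n)}
    {f : ι → Base n → ℝ} (h : Tendsto (fun j => ∫⁻ x, ‖f j x‖ₑ ^ 2 ∂μ) l (𝓝 0)) :
    Tendsto (fun j => eLpNorm (f j) 2 μ) l (𝓝 0) := by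
  have h1 : ∀ j, eLpNorm (f j) 2 μ = (∫⁻ x, ‖f j x‖ₑ ^ 2 ∂μ) ^ (1 / 2 : ℝ) := fun j => by
    rw [← sq_eLpNorm_two, ← ENNReal.rpow_natCast, ← ENNReal.rpow_mul]
    norm_num
  simp only [h1]
  have h2 := ((ENNReal.continuous_rpow_const (y := (1 / 2 : ℝ))).tendsto 0).comp h
  simpa [Function.comp_def] using h2

variable {T : Type} [Fintype T]

/-- Quadratic expressions with bounded coefficients pass to the limit under `L²` convergence. -/
lemma tendsto_integral_quad {C : Set (Base n)} (hC : IsCompact C) {M : Base n → Matrix T T ℝ}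
    (hM : ∀ i j, Continuous fun x => M x i j) {f : ℕ → Base n → T → ℝ} {f₀ : Base n → T → ℝ}
    (hf : ∀ j i, MemLp (fun x => f j x i) 2 (volume.restrict C))
    (hf₀ : ∀ i, MemLp (fun x => f₀ x i) 2 (volume.restrict C))
    (hlim : ∀ i, Tendsto (fun j => eLpNorm (fun x => f j x i - f₀ x i) 2 (volume.restrict C)) atTop
      (𝓝 0)) :
    Tendsto (fun j => ∫ x in C, f j x ⬝ᵥ M x *ᵥ f j x) atTop
      (𝓝 (∫ x in C, f₀ x ⬝ᵥ M x *ᵥ f₀ x)) := by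
  set μ := volume.restrict C with hμ
  -- multiplication by an entry of `M`
  have hb : ∀ i k, ∃ B : ℝ, ∀ᵐ x ∂μ, ‖M x i k‖ ≤ B := fun i k => by
    obtain ⟨B, hB⟩ := hC.exists_bound_of_continuousOn (hM i k).continuousOn
    exact ⟨B, (ae_restrict_mem hC.measurableSet).mono fun x hx => hB x hx⟩
  have hMul : ∀ i k {a : Base n → ℝ}, MemLp a 2 μ → MemLp (fun x => M x i k * a x) 2 μ := by
    intro i k a ha
    obtain ⟨B, hB⟩ := hb i k
    refine MemLp.of_le_mul (c := B) ha ((hM i k).aestronglyMeasurable.mul ha.1) ?_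
    filter_upwards [hB] with x hx
    rw [norm_mul]
    exact mul_le_mul_of_nonneg_right hx (norm_nonneg _)
  have hlimM : ∀ i k, Tendsto (fun j => eLpNorm (fun x => M x i k * f j x k - M x i k * f₀ x k) 2 μ)
      atTop (𝓝 0) := by
    intro i k
    obtain ⟨B, hB⟩ := hb i k
    have h1 := ENNReal.Tendsto.const_mul (a := ENNReal.ofReal B) (hlim k)
      (Or.inr ENNReal.ofReal_ne_top)
    rw [mul_zero] at h1
    refine tendsto_of_tendsto_of_tendsto_of_le_of_le tendsto_const_nhds h1 (fun _ => zero_le)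
      fun j => ?_
    refine eLpNorm_le_mul_eLpNorm_of_ae_le_mul ?_ 2
    filter_upwards [hB] with x hx
    rw [← mul_sub, norm_mul]
    exact mul_le_mul_of_nonneg_right hx (norm_nonneg _)
  have hint : ∀ {a : Base n → T → ℝ}, (∀ i, MemLp (fun x => a x i) 2 μ) →
      ∫ x, a x ⬝ᵥ M x *ᵥ a x ∂μ = ∑ i, ∑ k, ∫ x, a x i * (M x i k * a x k) ∂μ := by
    intro a ha
    have hi : ∀ i k, Integrable (fun x => a x i * (M x i k * a x k)) μ := fun i k =>
      (ha i).integrable_mul (hMul i k (ha k))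
    have h1 : ∀ x, a x ⬝ᵥ M x *ᵥ a x = ∑ i, ∑ k, a x i * (M x i k * a x k) := fun x => by
      rw [quad_eq_sum]
      exact Finset.sum_congr rfl fun i _ => Finset.sum_congr rfl fun k _ => by ring
    simp only [h1]
    rw [integral_finsetSum _ fun i _ => integrable_finsetSum _ fun k _ => hi i k]
    exact Finset.sum_congr rfl fun i _ => integral_finsetSum _ fun k _ => hi i k
  simp only [hint hf₀, fun j => hint (hf j)]
  refine tendsto_finsetSum _ fun i _ => tendsto_finsetSum _ fun k _ => ?_
  have hinner : ∀ {a b : Base n → ℝ} (ha : MemLp a 2 μ) (hb : MemLp b 2 μ),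
      ∫ x, a x * b x ∂μ = inner ℝ (ha.toLp a) (hb.toLp b) := by
    intro a b ha hb
    rw [L2.inner_def]
    refine integral_congr_ae ?_
    filter_upwards [ha.coeFn_toLp, hb.coeFn_toLp] with x h1 h2
    rw [h1, h2, RCLike.inner_apply, conj_trivial, mul_comm]
  have t1 : Tendsto (fun j => (hf j i).toLp _) atTop (𝓝 ((hf₀ i).toLp _)) := by
    rw [Lp.tendsto_Lp_iff_tendsto_eLpNorm'']
    exact hlim i
  have t2 : Tendsto (fun j => (hMul i k (hf j k)).toLp _) atTop (𝓝 ((hMul i k (hf₀ k)).toLp _)) := by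
    rw [Lp.tendsto_Lp_iff_tendsto_eLpNorm'']
    exact hlimM i k
  have := t1.inner (𝕜 := ℝ) t2
  simp only [hinner (hf₀ i) (hMul i k (hf₀ k)), fun j => hinner (hf j i) (hMul i k (hf j k))]
  exact this

end L2Convergence

section Closed

/-- For an alternating family, `swapSum` is the usual alternating sum. -/
lemma swapSum_eq_sum {X : (Fin (m + 2) → Fin n) → ℝ} (hX : ∀ l, IsAlt fun I => X (Fin.cons l I))
    (J : Fin (m + 2) → Fin n) :
    swapSum X J = ∑ b : Fin (m + 2), (-1) ^ (b : ℕ) * X (Fin.cons (J b) (J ∘ b.succAbove)) := by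
  rw [Fin.sum_univ_succ, swapSum, sub_eq_add_neg, ← Finset.sum_neg_distrib]
  congr 1
  · have : (Fin.cons (J 0) (J ∘ Fin.succAbove 0) : Fin (m + 2) → Fin n) = J := by
      ext c
      refine Fin.cases ?_ (fun c => ?_) c <;> simp
    rw [this]
    simp
  · refine Finset.sum_congr rfl fun a _ => ?_
    have h1 : J ∘ Equiv.swap 0 a.succ
        = Fin.cons (J a.succ) ((J ∘ a.succ.succAbove) ∘ a.cycleRange) := by
      ext c
      refine Fin.cases ?_ (fun c => ?_) c
      · simp
      · simp [Fin.succAbove_cycleRange]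
    have h2 := hX (J a.succ) a.cycleRange (J ∘ a.succ.succAbove)
    simp only at h2
    rw [h1, h2, Fin.sign_cycleRange, Fin.val_succ, pow_succ]
    push_cast
    ring

/-- The tensor field `u` is a closed form in the sense of distributions: for each `J` and each test
function `η`, the component `J` of `dη ∧ u` has integral zero. -/
def WeaklyClosed (u : Base n → (Fin (m + 1) → Fin n) → ℝ) : Prop :=
  ∀ (J : Fin (m + 2) → Fin n) (η : Base n → ℝ), ContDiff ℝ (⊤ : ℕ∞) η → HasCompactSupport η →
    ∫ x, ∑ b : Fin (m + 2), (-1) ^ (b : ℕ) * (pd (J b) η x * u x (J ∘ b.succAbove)) = 0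

/-- Mollification of all components. -/
noncomputable def mollT (κ : ℝ) (u : Base n → (Fin m → Fin n) → ℝ) (x : Base n)
    (I : Fin m → Fin n) : ℝ := moll κ (fun y => u y I) x

lemma mollT_isAlt {κ : ℝ} {u : Base n → (Fin m → Fin n) → ℝ} (hu : ∀ x, IsAlt (u x)) (x : Base n) :
    IsAlt (mollT κ u x) := by
  intro σ I
  simp only [mollT, moll]
  rw [← integral_const_mul]
  congr 1
  ext y
  rw [hu y σ I]
  ring

lemma contDiff_comp_sub {κ : ℝ} (x : Base n) :
    ContDiff ℝ (⊤ : ℕ∞) fun y : Base n => bumpScaled κ (x - y) :=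
  (contDiff_bumpScaled κ).comp (contDiff_const.sub contDiff_id)

lemma hasCompactSupport_comp_sub {κ : ℝ} (hκ : 0 < κ) (x : Base n) :
    HasCompactSupport fun y : Base n => bumpScaled κ (x - y) :=
  (hasCompactSupport_bumpScaled hκ).comp_homeomorph (Homeomorph.subLeft x)

lemma pd_comp_sub (κ : ℝ) (k : Fin n) (x y : Base n) :
    pd k (fun y : Base n => bumpScaled κ (x - y)) y = - pd k (bumpScaled κ) (x - y) := by
  have hd : HasFDerivAt (bumpScaled κ) (fderiv ℝ (bumpScaled κ) (x - y)) (x - y) :=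
    (((contDiff_bumpScaled κ).differentiable (by simp)).differentiableAt).hasFDerivAt
  have h2 : HasFDerivAt (fun y : Base n => x - y) (-(ContinuousLinearMap.id ℝ (Base n))) y :=
    (hasFDerivAt_id y).const_sub x
  have h3 : fderiv ℝ (fun y : Base n => bumpScaled κ (x - y)) y = _ := (hd.comp y h2).fderiv
  rw [pd, h3]
  simp [pd]

lemma contDiff_mollT {κ : ℝ} (hκ : 0 < κ) {u : Base n → (Fin m → Fin n) → ℝ}
    (hu : ∀ I, LocL2 fun x => u x I) (I : Fin m → Fin n) :
    ContDiff ℝ (⊤ : ℕ∞) fun x => mollT κ u x I :=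
  contDiff_moll hκ (hu I).locallyIntegrable

lemma integrable_mul_pd_bump {κ : ℝ} (hκ : 0 < κ) {u : Base n → ℝ}
    (hu : LocallyIntegrable u volume) (k : Fin n) (x : Base n) :
    Integrable fun y => u y * pd k (bumpScaled κ) (x - y) :=
  integrable_mul_comp_sub hu (continuous_pd (contDiff_bumpScaled κ) k)
    (HasCompactSupport.intro (isCompact_closedBall 0 κ) fun _ hy =>
      pd_eq_zero_of_eventually Metric.isClosed_closedBall (fun _ => bumpScaled_eq_zero hκ) hy) x

/-- Mollifications of weakly closed forms are closed. -/
lemma swapSum_pd_mollT {κ : ℝ} (hκ : 0 < κ) {u : Base n → (Fin (m + 1) → Fin n) → ℝ}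
    (hu : ∀ I, LocL2 fun x => u x I) (ha : ∀ x, IsAlt (u x)) (hcl : WeaklyClosed u) (x : Base n) :
    swapSum (fun J : Fin (m + 2) → Fin n => pd (J 0) (fun y => mollT κ u y (Fin.tail J)) x) = 0 := by
  ext J
  rw [swapSum_eq_sum]
  · simp only [Fin.cons_zero, Fin.tail_cons, Pi.zero_apply]
    have h1 : ∀ b : Fin (m + 2), pd (J b) (fun y => mollT κ u y (J ∘ b.succAbove)) x
        = ∫ y, u y (J ∘ b.succAbove) * pd (J b) (bumpScaled κ) (x - y) := fun b =>
      pd_moll hκ (hu _).locallyIntegrable _ x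
    have h2 := hcl J _ (contDiff_comp_sub (κ := κ) x) (hasCompactSupport_comp_sub hκ x)
    simp only [pd_comp_sub] at h2
    simp only [h1, ← integral_const_mul]
    rw [← integral_finsetSum _ fun b _ =>
      (integrable_mul_pd_bump hκ (hu _).locallyIntegrable (J b) x).const_mul _, ← neg_eq_zero,
      ← integral_neg, ← h2]
    congr 1
    ext y
    rw [← Finset.sum_neg_distrib]
    exact Finset.sum_congr rfl fun b _ => by ring
  · intro l
    simp only [Fin.cons_zero, Fin.tail_cons]
    exact isAlt_pd (contDiff_mollT hκ hu) (mollT_isAlt ha) l x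

end Closed

/-! ### The localized estimate for smooth forms -/

section
variable {g : Base n → Matrix (Fin n) (Fin n) ℝ} {φ : Base n → ℝ} {ε : ℝ}

/-- The matrix field `e^{-φ} g⁻¹ ⊗ ⋯ ⊗ g⁻¹` of the weighted inner product of forms. -/
noncomputable def weight (g : Base n → Matrix (Fin n) (Fin n) ℝ) (φ : Base n → ℝ) (m : ℕ)
    (x : Base n) : Matrix (Fin m → Fin n) (Fin m → Fin n) ℝ :=
  Real.exp (-φ x) • tpow (g x)⁻¹ m

lemma weight_posDef (hg : ∀ x, (g x).PosDef) (m : ℕ) (x : Base n) : (weight g φ m x).PosDef :=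
  (tpow_posDef (hg x).inv m).smul (Real.exp_pos _)

lemma weight_mulVec (g : Base n → Matrix (Fin n) (Fin n) ℝ) (φ : Base n → ℝ) (x : Base n)
    (u : (Fin m → Fin n) → ℝ) :
    weight g φ m x *ᵥ u = Real.exp (-φ x) • (tpow (g x)⁻¹ m *ᵥ u) := smul_mulVec _ _ _

lemma weight_inv (hg : ∀ x, (g x).PosDef) (m : ℕ) (x : Base n) :
    (weight g φ m x)⁻¹ = Real.exp (φ x) • tpow (g x) m := by
  refine inv_eq_right_inv ?_
  rw [weight, smul_mul, Matrix.mul_smul, smul_smul, tpow_inv_mul (hg x), ← Real.exp_add]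
  simp

lemma WeightedHessianMetric.contDiff_weight (h : WeightedHessianMetric g φ ε)
    (I K : Fin m → Fin n) : ContDiff ℝ (⊤ : ℕ∞) fun x => weight g φ m x I K := by
  simp only [weight, Matrix.smul_apply, smul_eq_mul]
  exact h.smooth_weight.neg.exp.mul (contDiff_tpow h.inv_smooth I K)

lemma WeightedHessianMetric.contDiff_weight_mulVec (h : WeightedHessianMetric g φ ε)
    {v : Base n → (Fin m → Fin n) → ℝ} (hv : ∀ I, ContDiff ℝ (⊤ : ℕ∞) fun x => v x I)
    (I : Fin m → Fin n) : ContDiff ℝ (⊤ : ℕ∞) fun x => (weight g φ m x *ᵥ v x) I :=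
  ContDiff.sum fun K _ => (h.contDiff_weight I K).mul (hv K)

lemma pd_exp (k : Fin n) {f : Base n → ℝ} {x : Base n} (hf : DifferentiableAt ℝ f x) :
    pd k (fun y => Real.exp (f y)) x = pd k f x * Real.exp (f x) := by
  simp only [pd, fderiv_exp hf]
  simp [mul_comm]

/-- The divergence of the multivector field `P v` for a form `v`. -/
noncomputable def divWeight (g : Base n → Matrix (Fin n) (Fin n) ℝ) (φ : Base n → ℝ)
    (v : Base n → (Fin (m + 1) → Fin n) → ℝ) (x : Base n) (K : Fin m → Fin n) : ℝ :=
  ∑ k, pd k (fun y => (weight g φ (m + 1) y *ᵥ v y) (Fin.cons k K)) x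

/-- The a priori estimate for a smooth closed form `v`, localized by a cutoff function `χ`: it is the
Bochner inequality for the multivector field obtained by raising the indices of `χ v`. The bound `b`
on the squared length of the gradient of `χ` controls both error terms. -/
lemma cutoff_estimate (h : WeightedHessianMetric g φ ε) {v : Base n → (Fin (m + 1) → Fin n) → ℝ}
    (hv : ∀ I, ContDiff ℝ (⊤ : ℕ∞) fun x => v x I) (ha : ∀ x, IsAlt (v x))
    (hcl : ∀ x, swapSum (fun J : Fin (m + 2) → Fin n => pd (J 0) (fun y => v y (Fin.tail J)) x) = 0)
    {χ : Base n → ℝ} (hχ : ContDiff ℝ (⊤ : ℕ∞) χ) {C : Set (Base n)} (hC : IsCompact C)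
    (hχC : ∀ x ∉ C, χ x = 0) {b : ℝ}
    (hb : ∀ x, (fun k => pd k χ x) ⬝ᵥ (g x)⁻¹ *ᵥ (fun k => pd k χ x) ≤ b) {θ : ℝ} (hθ : 0 < θ) :
    ε * ∫ x in C, v x ⬝ᵥ (χ x ^ 2 • weight g φ (m + 1) x) *ᵥ v x ≤
      (1 + θ) * (∫ x in C, divWeight g φ v x ⬝ᵥ
        (χ x ^ 2 • Real.exp (φ x) • tpow (g x) m) *ᵥ divWeight g φ v x) +
      ((1 + θ⁻¹) + (m + 2) ^ 2) * b * ∫ x in C, v x ⬝ᵥ weight g φ (m + 1) x *ᵥ v x := by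
  have hφ := h.smooth_weight
  have hd : ∀ {f : Base n → ℝ} {x : Base n}, ContDiff ℝ (⊤ : ℕ∞) f → DifferentiableAt ℝ f x :=
    fun hf => (hf.differentiable (by simp)).differentiableAt
  set a : Base n → Fin n → ℝ := fun x k => pd k χ x with hadef
  set D := divWeight g φ v with hD
  set P := weight g φ (m + 1) with hP
  have ha0 : ∀ x ∉ C, a x = 0 := fun x hx => by
    ext k; exact pd_eq_zero_of_eventually hC.isClosed hχC hx
  set V : Base n → (Fin (m + 1) → Fin n) → ℝ := fun x => χ x • (tpow (g x)⁻¹ (m + 1) *ᵥ v x) with hV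
  have hVs : ∀ I, ContDiff ℝ (⊤ : ℕ∞) fun x => V x I := fun I => by
    simp only [hV, Pi.smul_apply, smul_eq_mul]
    exact hχ.mul (ContDiff.sum fun K _ => (contDiff_tpow h.inv_smooth I K).mul (hv K))
  have hVa : ∀ x, IsAlt (V x) := fun x => ((ha x).mulVec_tpow _).smul _
  have hVC : ∀ x ∉ C, V x = 0 := fun x hx => by simp [hV, hχC x hx]
  have hB := bochner_inequality h hVs hVa hC hVC
  have hL : ∀ x, Real.exp (-φ x) * (V x ⬝ᵥ tpow (g x) (m + 1) *ᵥ V x)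
      = v x ⬝ᵥ (χ x ^ 2 • P x) *ᵥ v x := fun x => by
    simp only [hV, hP, weight, mulVec_smul, smul_dotProduct, dotProduct_smul, smul_eq_mul,
      smul_mulVec, mulVec_mulVec, tpow_mul_inv (h.posDef x), one_mulVec]
    rw [dotProduct_comm]
    ring
  -- the divergence of `V` is that of `P v`, cut off, up to a contraction with the gradient of `χ`
  have hPs := h.contDiff_weight_mulVec hv
  have hW : ∀ x, wdiv φ V x = Real.exp (φ x) • (χ x • D x + fun K => ∑ k, a x k *
      (P x *ᵥ v x) (Fin.cons k K)) := fun x => by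
    ext K
    have h1 : ∀ I, (fun y => V y I) = fun y => Real.exp (φ y) * (χ y * (P y *ᵥ v y) I) := by
      intro I
      ext y
      simp only [hV, hP, weight_mulVec, Pi.smul_apply, smul_eq_mul, Real.exp_neg]
      field_simp
    simp only [wdiv, hD, divWeight, Pi.smul_apply, Pi.add_apply, smul_eq_mul, Finset.mul_sum,
      ← Finset.sum_add_distrib]
    refine Finset.sum_congr rfl fun l _ => ?_
    have h2 := congrFun (h1 (Fin.cons l K)) x
    rw [h1, pd_mul l (hd hφ.exp) (hd (hχ.mul (hPs _))), pd_exp l (hd hφ),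
      pd_mul l (hd hχ) (hd (hPs _)), h2]
    ring
  have hdiv : ∀ x, Real.exp (-φ x) * (wdiv φ V x ⬝ᵥ tpow (g x) m *ᵥ wdiv φ V x) ≤
      (1 + θ) * (D x ⬝ᵥ (χ x ^ 2 • Real.exp (φ x) • tpow (g x) m) *ᵥ D x) +
      (1 + θ⁻¹) * ((a x ⬝ᵥ (g x)⁻¹ *ᵥ a x) * (v x ⬝ᵥ P x *ᵥ v x)) := fun x => by
    rw [hW]
    set c : (Fin m → Fin n) → ℝ := fun K => ∑ k, a x k * (P x *ᵥ v x) (Fin.cons k K) with hc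
    have hgp := tpow_posSemidef (h.posDef x).posSemidef m
    have h1 := quad_add_le hgp (χ x • D x) c hθ
    have h2 := quad_contract_le (h.posDef x) (a x) (P x *ᵥ v x)
    rw [← hc] at h2
    have h3 : Real.exp (φ x) * ((P x *ᵥ v x) ⬝ᵥ tpow (g x) (m + 1) *ᵥ (P x *ᵥ v x))
        = v x ⬝ᵥ P x *ᵥ v x := by
      simp only [hP, weight_mulVec, mulVec_smul, smul_dotProduct, dotProduct_smul, smul_eq_mul,
        mulVec_mulVec, tpow_mul_inv (h.posDef x), one_mulVec]
      rw [dotProduct_comm, Real.exp_neg]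
      field_simp
    have hE := Real.exp_pos (φ x)
    have h4 : Real.exp (-φ x) * Real.exp (φ x) = 1 := by rw [← Real.exp_add]; simp
    calc Real.exp (-φ x) * ((Real.exp (φ x) • (χ x • D x + c)) ⬝ᵥ
          tpow (g x) m *ᵥ (Real.exp (φ x) • (χ x • D x + c)))
        = (Real.exp (-φ x) * Real.exp (φ x)) * Real.exp (φ x) *
          ((χ x • D x + c) ⬝ᵥ tpow (g x) m *ᵥ (χ x • D x + c)) := by
          simp only [mulVec_smul, smul_dotProduct, dotProduct_smul, smul_eq_mul]; ring
      _ ≤ Real.exp (φ x) * ((1 + θ) * ((χ x • D x) ⬝ᵥ tpow (g x) m *ᵥ (χ x • D x)) +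
          (1 + θ⁻¹) * ((a x ⬝ᵥ (g x)⁻¹ *ᵥ a x) *
            ((P x *ᵥ v x) ⬝ᵥ tpow (g x) (m + 1) *ᵥ (P x *ᵥ v x)))) := by
          rw [h4, one_mul]
          refine mul_le_mul_of_nonneg_left (h1.trans ?_) hE.le
          have : 0 < 1 + θ⁻¹ := by positivity
          gcongr
      _ = _ := by
          rw [← h3]
          simp only [mulVec_smul, smul_dotProduct, dotProduct_smul, smul_eq_mul, smul_mulVec]
          ring
  -- the exterior derivative of `χ v` is `dχ ∧ v`, since `v` is closed
  have hSw : ∀ x, Real.exp (-φ x) * (swapSum (fun J : Fin (m + 2) → Fin n =>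
          pd (J 0) (fun y => (tpow (g y) (m + 1) *ᵥ V y) (Fin.tail J)) x) ⬝ᵥ
        tpow (g x)⁻¹ (m + 2) *ᵥ swapSum (fun J : Fin (m + 2) → Fin n =>
          pd (J 0) (fun y => (tpow (g y) (m + 1) *ᵥ V y) (Fin.tail J)) x)) ≤
      (m + 2) ^ 2 * ((a x ⬝ᵥ (g x)⁻¹ *ᵥ a x) * (v x ⬝ᵥ P x *ᵥ v x)) := fun x => by
    have h1 : ∀ y, tpow (g y) (m + 1) *ᵥ V y = χ y • v y := fun y => by
      simp only [hV, mulVec_smul, mulVec_mulVec, tpow_mul_inv (h.posDef y), one_mulVec]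
    have h2 : (fun J : Fin (m + 2) → Fin n =>
        pd (J 0) (fun y => (tpow (g y) (m + 1) *ᵥ V y) (Fin.tail J)) x)
        = (fun J => a x (J 0) * v x (Fin.tail J)) +
          χ x • fun J : Fin (m + 2) → Fin n => pd (J 0) (fun y => v y (Fin.tail J)) x := by
      ext J
      simp only [h1, Pi.smul_apply, smul_eq_mul, Pi.add_apply]
      rw [pd_mul _ (hd hχ) (hd (hv _))]
    rw [h2, swapSum_add, swapSum_smul, hcl x, smul_zero, add_zero]
    have h3 := quad_swapSum_mul_le (h.posDef x).inv.posSemidef (a x) (v x)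
    refine (mul_le_mul_of_nonneg_left h3 (Real.exp_pos (-φ x)).le).trans (le_of_eq ?_)
    simp only [hP, weight_mulVec, dotProduct_smul, smul_eq_mul]
    ring
  have hDs : ∀ K, ContDiff ℝ (⊤ : ℕ∞) fun x => D x K := fun K =>
    ContDiff.sum fun k _ => contDiff_pd (hPs _) k
  have hquadc : ∀ {ι : Type} [Fintype ι] {M : Base n → Matrix ι ι ℝ} {u : Base n → ι → ℝ},
      (∀ i k, Continuous fun x => M x i k) → (∀ i, Continuous fun x => u x i) →
      Continuous fun x => u x ⬝ᵥ M x *ᵥ u x := by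
    intro ι _ M u hM hu
    simp only [quad_eq_sum]
    exact continuous_finsetSum _ fun i _ => continuous_finsetSum _ fun k _ =>
      ((hM i k).mul (hu i)).mul (hu k)
  have hPc : ∀ I K, Continuous fun x => P x I K := fun I K => (h.contDiff_weight I K).continuous
  have c1 : Continuous fun x => v x ⬝ᵥ P x *ᵥ v x := hquadc hPc fun I => (hv I).continuous
  have c2 : Continuous fun x => D x ⬝ᵥ (χ x ^ 2 • Real.exp (φ x) • tpow (g x) m) *ᵥ D x := by
    refine hquadc (fun I K => ?_) fun K => (hDs K).continuous
    simp only [Matrix.smul_apply, smul_eq_mul]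
    exact (hχ.continuous.pow 2).mul (hφ.continuous.rexp.mul (contDiff_tpow h.smooth I K).continuous)
  have c3 : Continuous fun x => a x ⬝ᵥ (g x)⁻¹ *ᵥ a x :=
    hquadc (fun i j => (h.inv_smooth i j).continuous) fun k => continuous_pd hχ k
  have z2 : ∀ x ∉ C, D x ⬝ᵥ (χ x ^ 2 • Real.exp (φ x) • tpow (g x) m) *ᵥ D x = 0 := fun x hx => by
    simp [hχC x hx]
  have z4 : ∀ x ∉ C, v x ⬝ᵥ (χ x ^ 2 • P x) *ᵥ v x = 0 := fun x hx => by simp [hχC x hx]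
  have z5 : ∀ x ∉ C, (a x ⬝ᵥ (g x)⁻¹ *ᵥ a x) * (v x ⬝ᵥ P x *ᵥ v x) = 0 := fun x hx => by
    simp [ha0 x hx]
  have i2 := integrable_of_continuous_of_compact c2 hC z2
  have i5 : Integrable fun x => (a x ⬝ᵥ (g x)⁻¹ *ᵥ a x) * (v x ⬝ᵥ P x *ᵥ v x) :=
    integrable_of_continuous_of_compact (c3.mul c1) hC z5
  have e4 : ∫ x in C, v x ⬝ᵥ (χ x ^ 2 • P x) *ᵥ v x = ∫ x, v x ⬝ᵥ (χ x ^ 2 • P x) *ᵥ v x :=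
    setIntegral_eq_integral_of_forall_compl_eq_zero z4
  have e2 := setIntegral_eq_integral_of_forall_compl_eq_zero (μ := volume) z2
  have e5 := setIntegral_eq_integral_of_forall_compl_eq_zero (μ := volume) z5
  have hlast : ∫ x in C, (a x ⬝ᵥ (g x)⁻¹ *ᵥ a x) * (v x ⬝ᵥ P x *ᵥ v x) ≤
      b * ∫ x in C, v x ⬝ᵥ P x *ᵥ v x := by
    rw [← integral_const_mul]
    refine setIntegral_mono_on (i5.integrableOn)
      ((c1.continuousOn.integrableOn_compact hC).const_mul b) hC.measurableSet fun x _ => ?_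
    exact mul_le_mul_of_nonneg_right (hb x)
      (quad_nonneg (weight_posDef h.posDef (m + 1) x).posSemidef _)
  simp only [hL] at hB
  rw [e4, e2]
  refine hB.trans ?_
  have hsum : (∫ x, Real.exp (-φ x) * (wdiv φ V x ⬝ᵥ tpow (g x) m *ᵥ wdiv φ V x)) ≤
      (1 + θ) * (∫ x, D x ⬝ᵥ (χ x ^ 2 • Real.exp (φ x) • tpow (g x) m) *ᵥ D x) +
      (1 + θ⁻¹) * ∫ x, (a x ⬝ᵥ (g x)⁻¹ *ᵥ a x) * (v x ⬝ᵥ P x *ᵥ v x) := by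
    rw [← integral_const_mul, ← integral_const_mul, ← integral_add (i2.const_mul _) (i5.const_mul _)]
    refine integral_mono_of_nonneg (Eventually.of_forall fun x => ?_)
      ((i2.const_mul _).add (i5.const_mul _)) (Eventually.of_forall hdiv)
    exact mul_nonneg (Real.exp_pos _).le
      (quad_nonneg (tpow_posSemidef (h.posDef x).posSemidef m) _)
  have hsum2 : (∫ x, Real.exp (-φ x) * (swapSum (fun J : Fin (m + 2) → Fin n =>
          pd (J 0) (fun y => (tpow (g y) (m + 1) *ᵥ V y) (Fin.tail J)) x) ⬝ᵥ
        tpow (g x)⁻¹ (m + 2) *ᵥ swapSum (fun J : Fin (m + 2) → Fin n =>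
          pd (J 0) (fun y => (tpow (g y) (m + 1) *ᵥ V y) (Fin.tail J)) x))) ≤
      (m + 2) ^ 2 * ∫ x, (a x ⬝ᵥ (g x)⁻¹ *ᵥ a x) * (v x ⬝ᵥ P x *ᵥ v x) := by
    rw [← integral_const_mul]
    refine integral_mono_of_nonneg (Eventually.of_forall fun x => ?_)
      (i5.const_mul _) (Eventually.of_forall hSw)
    exact mul_nonneg (Real.exp_pos _).le
      (quad_nonneg (tpow_posSemidef (h.posDef x).inv.posSemidef _) _)
  have hA : 0 ≤ (1 + θ⁻¹) + ((m : ℝ) + 2) ^ 2 := by positivity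
  have := mul_le_mul_of_nonneg_left (e5 ▸ hlast) hA
  linarith

end

/-! ### The a priori estimate for weakly closed forms -/

section Limit

lemma tendsto_eLpNorm_sum {ι κ : Type*} {l : Filter ι} {μ : Measure (Base n)} (s : Finset κ)
    {f : κ → ι → Base n → ℝ} (hm : ∀ i j, AEStronglyMeasurable (f i j) μ)
    (h : ∀ i ∈ s, Tendsto (fun j => eLpNorm (f i j) 2 μ) l (𝓝 0)) :
    Tendsto (fun j => eLpNorm (fun x => ∑ i ∈ s, f i j x) 2 μ) l (𝓝 0) := by
  have h1 := tendsto_finsetSum s h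
  rw [Finset.sum_const_zero] at h1
  refine tendsto_of_tendsto_of_tendsto_of_le_of_le tendsto_const_nhds h1 (fun _ => zero_le)
    fun j => ?_
  have h2 : (fun x => ∑ i ∈ s, f i j x) = ∑ i ∈ s, f i j := by ext x; simp
  simp only [h2]
  exact eLpNorm_sum_le (fun i _ => hm i j) (by norm_num)

lemma locL2_of_continuous {f : Base n → ℝ} (hf : Continuous f) : LocL2 f := fun C hC => by
  obtain ⟨B, hB⟩ := hC.exists_bound_of_continuousOn hf.continuousOn
  have : IsFiniteMeasure (volume.restrict C) := ⟨by simpa using hC.measure_lt_top⟩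
  exact MemLp.of_bound hf.aestronglyMeasurable B
    ((ae_restrict_mem hC.measurableSet).mono fun x hx => hB x hx)

lemma LocL2.continuous_mul {u c : Base n → ℝ} (hu : LocL2 u) (hc : Continuous c) :
    LocL2 fun x => c x * u x := fun C hC => by
  obtain ⟨B, hB⟩ := hC.exists_bound_of_continuousOn hc.continuousOn
  refine MemLp.of_le_mul (c := B) (hu C hC) (hc.aestronglyMeasurable.mul (hu C hC).1) ?_
  filter_upwards [ae_restrict_mem hC.measurableSet] with x hx
  rw [norm_mul]
  exact mul_le_mul_of_nonneg_right (hB x hx) (norm_nonneg _)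

variable {g : Base n → Matrix (Fin n) (Fin n) ℝ} {φ : Base n → ℝ} {ε : ℝ}

/-- A null sequence of mollification radii. -/
noncomputable def radius (j : ℕ) : ℝ := 1 / ((j : ℝ) + 1)

lemma radius_pos (j : ℕ) : 0 < radius j := by unfold radius; positivity

lemma tendsto_radius : Tendsto radius atTop (𝓝[>] 0) :=
  tendsto_nhdsWithin_iff.mpr ⟨tendsto_one_div_add_atTop_nhds_zero_nat,
    Eventually.of_forall radius_pos⟩

/-- If `P u` has the weak divergence `-G`, then the divergences of the mollifications of `u`
converge to `-G` in `L²` on compact sets. -/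
lemma tendsto_divWeight_mollT (h : WeightedHessianMetric g φ ε)
    {u : Base n → (Fin (m + 1) → Fin n) → ℝ} (hum : ∀ I, Measurable fun x => u x I)
    (hu : ∀ I, LocL2 fun x => u x I) {G : Base n → (Fin m → Fin n) → ℝ}
    (hGc : ∀ K, Continuous fun x => G x K)
    (hG : ∀ K (η : Base n → ℝ), ContDiff ℝ (⊤ : ℕ∞) η → HasCompactSupport η →
      ∫ x, ∑ k, (weight g φ (m + 1) x *ᵥ u x) (Fin.cons k K) * pd k η x = ∫ x, G x K * η x)
    {C : Set (Base n)} (hC : IsCompact C) (K : Fin m → Fin n) :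
    Tendsto (fun j => eLpNorm (fun x => divWeight g φ (mollT (radius j) u) x K - -G x K) 2
      (volume.restrict C)) atTop (𝓝 0) := by
  set P := weight g φ (m + 1) with hP
  have hd : ∀ {f : Base n → ℝ} {x : Base n}, ContDiff ℝ (⊤ : ℕ∞) f → DifferentiableAt ℝ f x :=
    fun hf => (hf.differentiable (by simp)).differentiableAt
  have hPs : ∀ I J, ContDiff ℝ (⊤ : ℕ∞) fun x => P x I J := h.contDiff_weight
  have hPu : ∀ I J, LocL2 fun x => P x I J * u x J := fun I J =>
    (hu J).continuous_mul (hPs I J).continuous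
  -- the commutators of differentiation of `P u` with mollification
  set e : Fin n × (Fin (m + 1) → Fin n) → ℕ → Base n → ℝ := fun q j x =>
    pd q.1 (fun y => P y (Fin.cons q.1 K) q.2 * moll (radius j) (fun y => u y q.2) y) x -
      ∫ y, P y (Fin.cons q.1 K) q.2 * u y q.2 * pd q.1 (bumpScaled (radius j)) (x - y) with he
  set r : ℕ → Base n → ℝ := fun j x => moll (radius j) (fun y => G y K) x - G x K with hr
  have hms : ∀ j I, ContDiff ℝ (⊤ : ℕ∞) (moll (radius j) (fun y => u y I)) := fun j I =>
    contDiff_moll (radius_pos j) (hu I).locallyIntegrable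
  have hec : ∀ q j, Continuous (e q j) := fun q j => by
    have h1 : (fun x => ∫ y, P y (Fin.cons q.1 K) q.2 * u y q.2 *
        pd q.1 (bumpScaled (radius j)) (x - y)) =
        pd q.1 (moll (radius j) fun y => P y (Fin.cons q.1 K) q.2 * u y q.2) := by
      ext x
      rw [pd_moll (radius_pos j) (hPu _ _).locallyIntegrable]
    simp only [he]
    refine (continuous_pd ((hPs _ _).mul (hms j _)) _).sub ?_
    rw [h1]
    exact continuous_pd (contDiff_moll (radius_pos j) (hPu _ _).locallyIntegrable) _
  have hrc : ∀ j, Continuous (r j) := fun j =>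
    (contDiff_moll (radius_pos j) (hGc K).locallyIntegrable).continuous.sub (hGc K)
  have key : ∀ j x, divWeight g φ (mollT (radius j) u) x K - -G x K =
      (∑ q, e q j x) - r j x := by
    intro j x
    have h1 : divWeight g φ (mollT (radius j) u) x K = ∑ k, ∑ I,
        pd k (fun y => P y (Fin.cons k K) I * moll (radius j) (fun y => u y I) y) x := by
      refine Finset.sum_congr rfl fun k _ => ?_
      rw [← pd_sum _ _ fun I _ => hd ((hPs _ _).mul (hms j I))]
      rfl
    have h2 : ∑ k, ∑ I, ∫ y, P y (Fin.cons k K) I * u y I * pd k (bumpScaled (radius j)) (x - y)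
        = - moll (radius j) (fun y => G y K) x := by
      have h3 := hG K _ (contDiff_comp_sub (κ := radius j) x)
        (hasCompactSupport_comp_sub (radius_pos j) x)
      rw [moll, ← h3, ← integral_neg]
      have hi : ∀ k I, Integrable fun y =>
          P y (Fin.cons k K) I * u y I * pd k (bumpScaled (radius j)) (x - y) := fun k I =>
        integrable_mul_pd_bump (radius_pos j) (hPu _ _).locallyIntegrable k x
      simp only [← integral_finsetSum _ fun I _ => hi _ I]
      rw [← integral_finsetSum _ fun k _ => integrable_finsetSum _ fun I _ => hi k I]
      congr 1
      ext y
      rw [← Finset.sum_neg_distrib]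
      refine Finset.sum_congr rfl fun k _ => ?_
      rw [pd_comp_sub, mul_neg, neg_neg, ← Finset.sum_mul]
      rfl
    rw [h1]
    simp only [he, hr, Fintype.sum_prod_type, Finset.sum_sub_distrib]
    rw [h2]
    ring
  simp only [key]
  have t1 : Tendsto (fun j => eLpNorm (fun x => ∑ q, e q j x) 2 (volume.restrict C)) atTop (𝓝 0) :=
    tendsto_eLpNorm_sum _ (fun q j => (hec q j).aestronglyMeasurable) fun q _ =>
      tendsto_eLpNorm_of_sq ((tendsto_friedrichs (hu q.2) (hum q.2) (hPs _ q.2) q.1 hC).comp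
        tendsto_radius)
  have t2 : Tendsto (fun j => eLpNorm (r j) 2 (volume.restrict C)) atTop (𝓝 0) :=
    tendsto_eLpNorm_of_sq ((tendsto_moll (locL2_of_continuous (hGc K)) (hGc K).measurable hC).comp
      tendsto_radius)
  have t3 := t1.add t2
  rw [add_zero] at t3
  refine tendsto_of_tendsto_of_tendsto_of_le_of_le tendsto_const_nhds t3 (fun _ => zero_le)
    fun j => ?_
  exact eLpNorm_sub_le (continuous_finsetSum _ fun q _ => hec q j).aestronglyMeasurable
    (hrc j).aestronglyMeasurable (by norm_num)

/-- The localized a priori estimate for closed forms with square integrable coefficients, by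
application of `cutoff_estimate` to mollifications, which are closed as well. -/
lemma weak_cutoff_estimate (h : WeightedHessianMetric g φ ε)
    {u : Base n → (Fin (m + 1) → Fin n) → ℝ} (hum : ∀ I, Measurable fun x => u x I)
    (hu : ∀ I, LocL2 fun x => u x I) (ha : ∀ x, IsAlt (u x)) (hcl : WeaklyClosed u)
    {G : Base n → (Fin m → Fin n) → ℝ} (hGc : ∀ K, Continuous fun x => G x K)
    (hG : ∀ K (η : Base n → ℝ), ContDiff ℝ (⊤ : ℕ∞) η → HasCompactSupport η →
      ∫ x, ∑ k, (weight g φ (m + 1) x *ᵥ u x) (Fin.cons k K) * pd k η x = ∫ x, G x K * η x)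
    {χ : Base n → ℝ} (hχ : ContDiff ℝ (⊤ : ℕ∞) χ) {C : Set (Base n)} (hC : IsCompact C)
    (hχC : ∀ x ∉ C, χ x = 0) {b : ℝ}
    (hb : ∀ x, (fun k => pd k χ x) ⬝ᵥ (g x)⁻¹ *ᵥ (fun k => pd k χ x) ≤ b) {θ : ℝ} (hθ : 0 < θ) :
    ε * ∫ x in C, u x ⬝ᵥ (χ x ^ 2 • weight g φ (m + 1) x) *ᵥ u x ≤
      (1 + θ) * (∫ x in C, G x ⬝ᵥ (χ x ^ 2 • Real.exp (φ x) • tpow (g x) m) *ᵥ G x) +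
      ((1 + θ⁻¹) + (m + 2) ^ 2) * b * ∫ x in C, u x ⬝ᵥ weight g φ (m + 1) x *ᵥ u x := by
  have hms : ∀ j I, ContDiff ℝ (⊤ : ℕ∞) fun x => mollT (radius j) u x I := fun j I =>
    contDiff_mollT (radius_pos j) hu I
  have hPc : ∀ I J, Continuous fun x => weight g φ (m + 1) x I J := fun I J =>
    (h.contDiff_weight I J).continuous
  have hχP : ∀ I J, Continuous fun x => (χ x ^ 2 • weight g φ (m + 1) x) I J := fun I J =>
    (hχ.continuous.pow 2).mul (hPc I J)
  have hχg : ∀ I J, Continuous fun x => (χ x ^ 2 • Real.exp (φ x) • tpow (g x) m) I J := fun I J =>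
    (hχ.continuous.pow 2).mul (h.smooth_weight.continuous.rexp.mul
      (contDiff_tpow h.smooth I J).continuous)
  have m1 : ∀ j I, MemLp (fun x => mollT (radius j) u x I) 2 (volume.restrict C) := fun j I =>
    locL2_of_continuous (hms j I).continuous C hC
  have t1 : ∀ I, Tendsto (fun j => eLpNorm (fun x => mollT (radius j) u x I - u x I) 2
      (volume.restrict C)) atTop (𝓝 0) := fun I =>
    tendsto_eLpNorm_of_sq ((tendsto_moll (hu I) (hum I) hC).comp tendsto_radius)
  have hDc : ∀ j K, Continuous fun x => divWeight g φ (mollT (radius j) u) x K := fun j K =>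
    continuous_finsetSum _ fun k _ => continuous_pd (h.contDiff_weight_mulVec (hms j) _) _
  have t2 : Tendsto (fun j => ∫ x in C, divWeight g φ (mollT (radius j) u) x ⬝ᵥ
        (χ x ^ 2 • Real.exp (φ x) • tpow (g x) m) *ᵥ divWeight g φ (mollT (radius j) u) x) atTop
      (𝓝 (∫ x in C, (-G x) ⬝ᵥ (χ x ^ 2 • Real.exp (φ x) • tpow (g x) m) *ᵥ (-G x))) := by
    refine tendsto_integral_quad hC hχg (fun j K => locL2_of_continuous (hDc j K) C hC)
      (fun K => locL2_of_continuous (hGc K).neg C hC) fun K => ?_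
    exact tendsto_divWeight_mollT h hum hu hGc hG hC K
  have t3 := tendsto_integral_quad hC hχP m1 (fun I => hu I C hC) t1
  have t4 := tendsto_integral_quad hC hPc m1 (fun I => hu I C hC) t1
  simp only [mulVec_neg, neg_dotProduct, dotProduct_neg, neg_neg] at t2
  refine le_of_tendsto_of_tendsto' (t3.const_mul ε)
    ((t2.const_mul (1 + θ)).add (t4.const_mul (((1 + θ⁻¹) + ((m : ℝ) + 2) ^ 2) * b))) fun j => ?_
  exact cutoff_estimate h (hms j) (mollT_isAlt ha) (swapSum_pd_mollT (radius_pos j) hu ha hcl) hχ hC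
    hχC hb hθ

end Limit

section Complete
variable {g : Base n → Matrix (Fin n) (Fin n) ℝ} {φ : Base n → ℝ} {ε : ℝ}

/-- Cutoff functions with gradients tending to zero. -/
lemma exists_cutoff (n : ℕ) : ∃ (χ : ℕ → Base n → ℝ) (M : ℝ), (∀ j, ContDiff ℝ (⊤ : ℕ∞) (χ j)) ∧
    (∀ j, ∃ C, IsCompact C ∧ ∀ x ∉ C, χ j x = 0) ∧ (∀ j x, 0 ≤ χ j x ∧ χ j x ≤ 1) ∧
    (∀ x, ∀ᶠ j in atTop, χ j x = 1) ∧ ∀ j k x, |pd k (χ j) x| ≤ radius j * M := by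
  set ψ : ContDiffBump (0 : Base n) := ⟨1, 2, by norm_num, by norm_num⟩ with hψ
  have hs : ContDiff ℝ (⊤ : ℕ∞) ψ := ψ.contDiff
  have hcs : HasCompactSupport (fderiv ℝ ψ) := ψ.hasCompactSupport.fderiv ℝ
  obtain ⟨M, hM⟩ := hcs.exists_bound_of_continuous (hs.continuous_fderiv (by simp))
  have hpd : ∀ j k x, pd k (fun x => ψ (radius j • x)) x = radius j * pd k ψ (radius j • x) := by
    intro j k x
    rw [pd, fderiv_comp_smul]
    simp [pd]
  refine ⟨fun j x => ψ (radius j • x), M, fun j => hs.comp (contDiff_const_smul _), fun j => ?_,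
    fun j x => ⟨ψ.nonneg, ψ.le_one⟩, fun x => ?_, fun j k x => ?_⟩
  · refine ⟨Metric.closedBall 0 (2 * (radius j)⁻¹), isCompact_closedBall _ _, fun x hx => ?_⟩
    refine ψ.zero_of_le_dist ?_
    rw [mem_closedBall_zero_iff, not_le] at hx
    rw [dist_zero_right, norm_smul, Real.norm_of_nonneg (radius_pos j).le]
    have := mul_lt_mul_of_pos_left hx (radius_pos j)
    have h2 : radius j * (2 * (radius j)⁻¹) = 2 := by
      field_simp [(radius_pos j).ne']
    rw [h2] at this
    exact this.le
  · have h1 : Tendsto (fun j => radius j * ‖x‖) atTop (𝓝 0) := by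
      simpa using (tendsto_nhdsWithin_iff.mp tendsto_radius).1.mul_const ‖x‖
    filter_upwards [h1.eventually_lt_const one_pos] with j hj
    refine ψ.one_of_mem_closedBall ?_
    rw [mem_closedBall_zero_iff, norm_smul, Real.norm_of_nonneg (radius_pos j).le]
    exact hj.le
  · rw [hpd, abs_mul, abs_of_pos (radius_pos j)]
    refine mul_le_mul_of_nonneg_left ?_ (radius_pos j).le
    have := (fderiv ℝ ψ (radius j • x)).le_opNorm (stdVec k)
    rw [Real.norm_eq_abs] at this
    refine this.trans ?_
    have h1 : ‖(stdVec k : Base n)‖ = 1 := by simp [stdVec]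
    rw [h1, mul_one]
    exact hM _

/-- The a priori estimate for closed forms, for a metric bounded below by a constant one, which makes
it complete: there are cutoff functions whose gradients tend to zero in the metric. -/
theorem apriori_of_bounded_below (h : WeightedHessianMetric g φ ε) {δ : ℝ} (hδ : 0 < δ)
    (hgδ : ∀ x, (g x - δ • (1 : Matrix (Fin n) (Fin n) ℝ)).PosSemidef)
    {u : Base n → (Fin (m + 1) → Fin n) → ℝ} (hum : ∀ I, Measurable fun x => u x I)
    (hu : WMem (weight g φ (m + 1)) u) (ha : ∀ x, IsAlt (u x)) (hcl : WeaklyClosed u)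
    {G : Base n → (Fin m → Fin n) → ℝ} (hGc : ∀ K, Continuous fun x => G x K)
    {C₀ : Set (Base n)} (hC₀ : IsCompact C₀) (hG0 : ∀ x ∉ C₀, G x = 0)
    (hG : ∀ K (η : Base n → ℝ), ContDiff ℝ (⊤ : ℕ∞) η → HasCompactSupport η →
      ∫ x, ∑ k, (weight g φ (m + 1) x *ᵥ u x) (Fin.cons k K) * pd k η x = ∫ x, G x K * η x) :
    ε * ∫ x, u x ⬝ᵥ weight g φ (m + 1) x *ᵥ u x ≤
      ∫ x, Real.exp (φ x) * (G x ⬝ᵥ tpow (g x) m *ᵥ G x) := by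
  have hPd := weight_posDef (φ := φ) h.posDef (m + 1)
  have hPc : ∀ I J, Continuous fun x => weight g φ (m + 1) x I J := fun I J =>
    (h.contDiff_weight I J).continuous
  have hL : ∀ I, LocL2 fun x => u x I := fun I C hC => hu.memLp_restrict hPd hPc hC I
  obtain ⟨χ, M, hχ, hχc, hχ01, hχ1, hχM⟩ := exists_cutoff n
  set E := ∫ x, u x ⬝ᵥ weight g φ (m + 1) x *ᵥ u x with hE
  set F := ∫ x, Real.exp (φ x) * (G x ⬝ᵥ tpow (g x) m *ᵥ G x) with hF
  have hE0 : ∀ x, 0 ≤ u x ⬝ᵥ weight g φ (m + 1) x *ᵥ u x := fun x =>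
    quad_nonneg (hPd x).posSemidef _
  have hF0 : ∀ x, 0 ≤ Real.exp (φ x) * (G x ⬝ᵥ tpow (g x) m *ᵥ G x) := fun x =>
    mul_nonneg (Real.exp_pos _).le (quad_nonneg (tpow_posSemidef (h.posDef x).posSemidef m) _)
  have hFi : Integrable fun x => Real.exp (φ x) * (G x ⬝ᵥ tpow (g x) m *ᵥ G x) := by
    refine integrable_of_continuous_of_compact ?_ hC₀ fun x hx => by simp [hG0 x hx]
    simp only [quad_eq_sum]
    exact h.smooth_weight.continuous.rexp.mul (continuous_finsetSum _ fun I _ =>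
      continuous_finsetSum _ fun K _ =>
        ((contDiff_tpow h.smooth I K).continuous.mul (hGc I)).mul (hGc K))
  -- the gradients of the cutoff functions are small since `g` is bounded below
  set b : ℕ → ℝ := fun j => δ⁻¹ * (n * (radius j * M) ^ 2) with hb
  have hbj : ∀ j x, (fun k => pd k (χ j) x) ⬝ᵥ (g x)⁻¹ *ᵥ (fun k => pd k (χ j) x) ≤ b j := by
    intro j x
    set a : Fin n → ℝ := fun k => pd k (χ j) x with ha
    have h1 : (δ • (1 : Matrix (Fin n) (Fin n) ℝ)).PosDef := PosDef.one.smul hδ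
    have h2 := quad_nonneg (inv_sub_inv_posSemidef h1 (h.posDef x) (hgδ x)) a
    have h3 : (δ • (1 : Matrix (Fin n) (Fin n) ℝ))⁻¹ = δ⁻¹ • 1 :=
      inv_eq_right_inv (by simp [smul_smul, hδ.ne'])
    rw [h3, sub_mulVec, dotProduct_sub, smul_mulVec, one_mulVec, dotProduct_smul, smul_eq_mul] at h2
    have h4 : a ⬝ᵥ a ≤ n * (radius j * M) ^ 2 := by
      calc a ⬝ᵥ a ≤ ∑ _k : Fin n, (radius j * M) ^ 2 := by
            refine Finset.sum_le_sum fun k _ => ?_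
            have := hχM j k x
            rw [← sq, ← sq_abs]
            exact pow_le_pow_left₀ (abs_nonneg _) this 2
        _ = n * (radius j * M) ^ 2 := by simp
    have h5 := mul_le_mul_of_nonneg_left h4 (inv_pos.mpr hδ).le
    simp only [hb]
    linarith
  have hb0 : ∀ j, 0 ≤ b j := fun j => by simp only [hb]; positivity
  have hblim : Tendsto b atTop (𝓝 0) := by
    have h1 := ((((tendsto_nhdsWithin_iff.mp tendsto_radius).1.mul_const M).pow 2).const_mul
      (n : ℝ)).const_mul δ⁻¹
    simpa [hb] using h1
  -- the left-hand side converges by dominated convergence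
  have hlim : Tendsto (fun j => ∫ x, χ j x ^ 2 * (u x ⬝ᵥ weight g φ (m + 1) x *ᵥ u x)) atTop
      (𝓝 E) := by
    refine tendsto_integral_of_dominated_convergence _
      (fun j => ((hχ j).continuous.pow 2).aestronglyMeasurable.mul hu.integrable.1)
      hu.integrable (fun j => Eventually.of_forall fun x => ?_) (Eventually.of_forall fun x => ?_)
    · rw [Real.norm_of_nonneg (mul_nonneg (sq_nonneg _) (hE0 x))]
      exact mul_le_of_le_one_left (hE0 x) (pow_le_one₀ (hχ01 j x).1 (hχ01 j x).2)
    · refine tendsto_const_nhds.congr' ?_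
      filter_upwards [hχ1 x] with j hj
      simp [hj]
  have hmain : ∀ θ : ℝ, 0 < θ → ε * E ≤ (1 + θ) * F := by
    intro θ hθ
    have hA : 0 ≤ (1 + θ⁻¹) + ((m : ℝ) + 2) ^ 2 := by positivity
    have hR : Tendsto (fun j => (1 + θ) * F + ((1 + θ⁻¹) + ((m : ℝ) + 2) ^ 2) * b j * E) atTop
        (𝓝 ((1 + θ) * F)) := by
      have := ((hblim.const_mul ((1 + θ⁻¹) + ((m : ℝ) + 2) ^ 2)).mul_const E).const_add ((1 + θ) * F)
      simpa using this
    refine le_of_tendsto_of_tendsto' (hlim.const_mul ε) hR fun j => ?_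
    obtain ⟨C, hC, hCχ⟩ := hχc j
    have h1 := weak_cutoff_estimate h hum hL ha hcl hGc hG (hχ j) hC hCχ (hbj j) hθ
    have e1 : ∫ x in C, u x ⬝ᵥ (χ j x ^ 2 • weight g φ (m + 1) x) *ᵥ u x =
        ∫ x, χ j x ^ 2 * (u x ⬝ᵥ weight g φ (m + 1) x *ᵥ u x) := by
      rw [setIntegral_eq_integral_of_forall_compl_eq_zero fun x hx => by simp [hCχ x hx]]
      simp only [smul_mulVec, dotProduct_smul, smul_eq_mul]
    have e2 : ∫ x in C, G x ⬝ᵥ (χ j x ^ 2 • Real.exp (φ x) • tpow (g x) m) *ᵥ G x ≤ F := by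
      refine le_trans ?_ (setIntegral_le_integral hFi (Eventually.of_forall hF0) (s := C))
      refine integral_mono_of_nonneg (Eventually.of_forall fun x => ?_) hFi.integrableOn
        (Eventually.of_forall fun x => ?_)
      · simp only [smul_mulVec, dotProduct_smul, smul_eq_mul]
        exact mul_nonneg (sq_nonneg _) (hF0 x)
      · simp only [smul_mulVec, dotProduct_smul, smul_eq_mul]
        exact mul_le_of_le_one_left (hF0 x) (pow_le_one₀ (hχ01 j x).1 (hχ01 j x).2)
    have e3 : ∫ x in C, u x ⬝ᵥ weight g φ (m + 1) x *ᵥ u x ≤ E :=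
      setIntegral_le_integral hu.integrable (Eventually.of_forall hE0)
    rw [e1] at h1
    refine h1.trans (add_le_add (mul_le_mul_of_nonneg_left e2 (by positivity))
      (mul_le_mul_of_nonneg_left e3 (mul_nonneg hA (hb0 j))))
  have hθlim : Tendsto (fun θ : ℝ => (1 + θ) * F) (𝓝[>] 0) (𝓝 F) := by
    have : Continuous fun θ : ℝ => (1 + θ) * F := by fun_prop
    simpa using (this.tendsto 0).mono_left nhdsWithin_le_nhds
  exact ge_of_tendsto hθlim (eventually_mem_nhdsWithin.mono fun θ hθ => hmain θ hθ)

end Complete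

/-! ### Projection to closed forms and the basic inequality -/

section Constraints
variable {T : Type} [Fintype T]

lemma wMem_of_continuous {P : Base n → Matrix T T ℝ} (hP : ∀ i j, Continuous fun x => P x i j)
    {w : Base n → T → ℝ} (hw : ∀ i, Continuous fun x => w x i) {C : Set (Base n)}
    (hC : IsCompact C) (h0 : ∀ x ∉ C, w x = 0) : WMem P w := by
  refine ⟨fun i => (hw i).aestronglyMeasurable, ?_⟩
  refine integrable_of_continuous_of_compact ?_ hC fun x hx => by simp [h0 x hx]
  simp only [quad_eq_sum]
  exact continuous_finsetSum _ fun i _ => continuous_finsetSum _ fun k _ =>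
    ((hP i k).mul (hw i)).mul (hw k)

lemma WMem.congr {P : Base n → Matrix T T ℝ} {u v : Base n → T → ℝ} (hu : WMem P u)
    (huv : u =ᵐ[volume] v) : WMem P v :=
  ⟨fun i => (hu.aesm i).congr (huv.mono fun x hx => congrFun hx i),
    hu.integrable.congr (huv.mono fun x hx => by simp only [hx])⟩

lemma WeaklyClosed.congr {u v : Base n → (Fin (m + 1) → Fin n) → ℝ} (hu : WeaklyClosed u)
    (huv : u =ᵐ[volume] v) : WeaklyClosed v := fun J η h1 h2 => by
  rw [← hu J η h1 h2]
  exact integral_congr_ae (huv.mono fun x hx => by simp only [hx])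

/-- The test field representing one component of the weak form of `du = 0`. -/
noncomputable def closedTest (J : Fin (m + 2) → Fin n) (η : Base n → ℝ) (x : Base n)
    (I : Fin (m + 1) → Fin n) : ℝ :=
  ∑ b : Fin (m + 2), (-1) ^ (b : ℕ) * (pd (J b) η x * if I = J ∘ b.succAbove then 1 else 0)

/-- The test field representing one instance of the alternation law. -/
noncomputable def altTest (σ : Equiv.Perm (Fin m)) (K : Fin m → Fin n) (η : Base n → ℝ)
    (x : Base n) (I : Fin m → Fin n) : ℝ :=
  η x * ((if I = K ∘ σ then 1 else 0) - ((Equiv.Perm.sign σ : ℤ) : ℝ) * if I = K then 1 else 0)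

lemma dotProduct_closedTest (u : (Fin (m + 1) → Fin n) → ℝ) (J : Fin (m + 2) → Fin n)
    (η : Base n → ℝ) (x : Base n) : u ⬝ᵥ closedTest J η x =
      ∑ b : Fin (m + 2), (-1) ^ (b : ℕ) * (pd (J b) η x * u (J ∘ b.succAbove)) := by
  simp only [dotProduct, closedTest, Finset.mul_sum]
  rw [Finset.sum_comm]
  refine Finset.sum_congr rfl fun b _ => ?_
  simp only [mul_ite, mul_one, mul_zero, Finset.sum_ite_eq', Finset.mem_univ, if_true]
  ring

lemma dotProduct_altTest (u : (Fin m → Fin n) → ℝ) (σ : Equiv.Perm (Fin m)) (K : Fin m → Fin n)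
    (η : Base n → ℝ) (x : Base n) : u ⬝ᵥ altTest σ K η x =
      η x * (u (K ∘ σ) - ((Equiv.Perm.sign σ : ℤ) : ℝ) * u K) := by
  simp only [dotProduct, altTest, mul_sub, Finset.sum_sub_distrib]
  simp only [mul_ite, mul_one, mul_zero, Finset.sum_ite_eq', Finset.mem_univ, if_true]
  ring

/-- The test fields cutting out the weakly closed alternating fields. -/
def constraints (n m : ℕ) : Set (Base n → (Fin (m + 1) → Fin n) → ℝ) :=
  {c | ∃ J η, ContDiff ℝ (⊤ : ℕ∞) η ∧ HasCompactSupport η ∧ c = closedTest J η} ∪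
    {c | ∃ σ K η, ContDiff ℝ (⊤ : ℕ∞) η ∧ HasCompactSupport η ∧ c = altTest σ K η}

lemma constraints_regular : ∀ c ∈ constraints n m, (∀ I, Continuous fun x => c x I) ∧
    ∃ C, IsCompact C ∧ ∀ x ∉ C, c x = 0 := by
  rintro c (⟨J, η, h1, h2, rfl⟩ | ⟨σ, K, η, h1, h2, rfl⟩)
  · refine ⟨fun I => ?_, tsupport η, h2, fun x hx => ?_⟩
    · exact continuous_finsetSum _ fun b _ =>
        ((continuous_pd h1 _).mul continuous_const).const_mul _
    · ext I
      simp [closedTest, pd_eq_zero_of_eventually (isClosed_tsupport η)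
        (fun y hy => image_eq_zero_of_notMem_tsupport hy) hx]
  · refine ⟨fun I => h1.continuous.mul continuous_const, tsupport η, h2, fun x hx => ?_⟩
    ext I
    simp [altTest, image_eq_zero_of_notMem_tsupport hx]

lemma integral_constraints_eq_zero {u : Base n → (Fin (m + 1) → Fin n) → ℝ}
    (hcl : WeaklyClosed u) (ha : ∀ x, IsAlt (u x)) :
    ∀ c ∈ constraints n m, ∫ x, u x ⬝ᵥ c x = 0 := by
  rintro c (⟨J, η, h1, h2, rfl⟩ | ⟨σ, K, η, h1, h2, rfl⟩)
  · simp only [dotProduct_closedTest]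
    exact hcl J η h1 h2
  · have : ∀ x, u x ⬝ᵥ altTest σ K η x = 0 := fun x => by
      rw [dotProduct_altTest, ha x σ K, sub_self, mul_zero]
    simp [this]

/-- A field satisfying the constraints agrees almost everywhere with a measurable, weakly closed
field which is alternating at every point. -/
lemma exists_alternating_representative {u : Base n → (Fin (m + 1) → Fin n) → ℝ}
    (hm : ∀ I, AEStronglyMeasurable (fun x => u x I) volume)
    (hL : ∀ I, LocL2 fun x => u x I) (hu : ∀ c ∈ constraints n m, ∫ x, u x ⬝ᵥ c x = 0) :
    ∃ u', u =ᵐ[volume] u' ∧ (∀ I, Measurable fun x => u' x I) ∧ (∀ x, IsAlt (u' x)) ∧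
      WeaklyClosed u' := by
  have h1 : ∀ (σ : Equiv.Perm (Fin (m + 1))) K,
      ∀ᵐ x, u x (K ∘ σ) - ((Equiv.Perm.sign σ : ℤ) : ℝ) * u x K = 0 := by
    intro σ K
    have h0 : LocallyIntegrable
        (fun x => u x (K ∘ σ) - ((Equiv.Perm.sign σ : ℤ) : ℝ) * u x K) volume :=
      (hL (K ∘ σ)).locallyIntegrable.sub ((hL K).continuous_mul continuous_const).locallyIntegrable
    refine ae_eq_zero_of_integral_contDiff_smul_eq_zero h0 fun η h1 h2 => ?_
    have := hu _ (Or.inr ⟨σ, K, η, h1, h2, rfl⟩)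
    simpa only [dotProduct_altTest, smul_eq_mul] using this
  have h2 : ∀ᵐ x, IsAlt (u x) := by
    have : ∀ᵐ x, ∀ (σ : Equiv.Perm (Fin (m + 1))) K,
        u x (K ∘ σ) - ((Equiv.Perm.sign σ : ℤ) : ℝ) * u x K = 0 :=
      ae_all_iff.mpr fun σ => ae_all_iff.mpr fun K => h1 σ K
    exact this.mono fun x hx σ K => sub_eq_zero.mp (hx σ K)
  have h3 : ∀ᵐ x, ∀ I, u x I = (hm I).mk _ x := ae_all_iff.mpr fun I => (hm I).ae_eq_mk
  set u' : Base n → (Fin (m + 1) → Fin n) → ℝ := fun x J =>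
    ((m + 1).factorial : ℝ)⁻¹ * ∑ I, (hm I).mk _ x * gdelta I J with hu'
  have hae : u =ᵐ[volume] u' := by
    filter_upwards [h2, h3] with x hx2 hx3
    ext J
    simp only [hu', ← hx3, sum_mul_gdelta hx2]
    field_simp
  refine ⟨u', hae, fun J => ?_, fun x σ J => ?_, ?_⟩
  · exact (Finset.measurable_fun_sum _ fun I _ =>
      (hm I).stronglyMeasurable_mk.measurable.mul_const _).const_mul _
  · simp only [hu', gdelta_isAlt_right _ σ J, Finset.mul_sum]
    exact Finset.sum_congr rfl fun I _ => by ring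
  · refine WeaklyClosed.congr (fun J η h1 h2 => ?_) hae
    have := hu _ (Or.inl ⟨J, η, h1, h2, rfl⟩)
    simpa only [dotProduct_closedTest] using this

/-- Smooth closed forms are weakly closed. -/
lemma weaklyClosed_of_smooth {v : Base n → (Fin (m + 1) → Fin n) → ℝ}
    (hv : ∀ I, ContDiff ℝ (⊤ : ℕ∞) fun x => v x I)
    (hcl : ∀ J x, ∑ b : Fin (m + 2), (-1) ^ (b : ℕ) * pd (J b) (fun y => v y (J ∘ b.succAbove)) x = 0) :
    WeaklyClosed v := by
  intro J η h1 h2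
  have h0 : ∀ x ∉ tsupport η, η x = 0 := fun x hx => image_eq_zero_of_notMem_tsupport hx
  have hp0 : ∀ k, ∀ x ∉ tsupport η, pd k η x = 0 := fun k x hx =>
    pd_eq_zero_of_eventually (isClosed_tsupport η) h0 hx
  have hi : ∀ b : Fin (m + 2),
      Integrable fun x => (-1 : ℝ) ^ (b : ℕ) * (pd (J b) η x * v x (J ∘ b.succAbove)) := fun b =>
    integrable_of_continuous_of_compact
      (((continuous_pd h1 (J b)).mul (hv _).continuous).const_mul _) h2
      fun x hx => by simp [hp0 _ x hx]
  rw [integral_finsetSum _ fun b _ => hi b]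
  have h3 : ∀ b : Fin (m + 2), ∫ x, (-1 : ℝ) ^ (b : ℕ) * (pd (J b) η x * v x (J ∘ b.succAbove)) =
      - ∫ x, η x * ((-1) ^ (b : ℕ) * pd (J b) (fun y => v y (J ∘ b.succAbove)) x) := fun b => by
    have h4 := integral_mul_pd h1 (hv (J ∘ b.succAbove)) h2 h0 (J b)
    rw [integral_const_mul, ← neg_eq_iff_eq_neg.mpr h4, mul_neg, ← integral_const_mul]
    simp only [mul_left_comm]
  simp only [h3]
  rw [Finset.sum_neg_distrib, ← integral_finsetSum _ fun b _ => ?_]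
  · simp only [← Finset.mul_sum, hcl, mul_zero, integral_zero, neg_zero]
  · exact integrable_of_continuous_of_compact
      (h1.continuous.mul ((continuous_pd (hv _) _).const_mul _)) h2 fun x hx => by simp [h0 x hx]

/-- The exact form `d (η dx_K) = ∑ₖ ∂ₖη dx_k ∧ dx_K`, as a tensor field. -/
noncomputable def exactTest (K : Fin m → Fin n) (η : Base n → ℝ) (x : Base n)
    (I : Fin (m + 1) → Fin n) : ℝ := ∑ k, pd k η x * gdelta I (Fin.cons k K)

lemma contDiff_exactTest (K : Fin m → Fin n) {η : Base n → ℝ} (hη : ContDiff ℝ (⊤ : ℕ∞) η)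
    (I : Fin (m + 1) → Fin n) : ContDiff ℝ (⊤ : ℕ∞) fun x => exactTest K η x I :=
  ContDiff.sum fun _ _ => (contDiff_pd hη _).mul contDiff_const

lemma exactTest_isAlt (K : Fin m → Fin n) (η : Base n → ℝ) (x : Base n) :
    IsAlt (exactTest K η x) := by
  intro σ I
  simp only [exactTest, Finset.mul_sum]
  refine Finset.sum_congr rfl fun k _ => ?_
  have := gdelta_isAlt (Fin.cons k K : Fin (m + 1) → Fin n) σ I
  simp only at this
  rw [this]
  ring

lemma weaklyClosed_exactTest (K : Fin m → Fin n) {η : Base n → ℝ} (hη : ContDiff ℝ (⊤ : ℕ∞) η) :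
    WeaklyClosed (exactTest K η) := by
  refine weaklyClosed_of_smooth (contDiff_exactTest K hη) fun J x => ?_
  have hd : ∀ {f : Base n → ℝ} {x : Base n}, ContDiff ℝ (⊤ : ℕ∞) f → DifferentiableAt ℝ f x :=
    fun hf => (hf.differentiable (by simp)).differentiableAt
  have h1 : ∀ l (I : Fin (m + 1) → Fin n), pd l (fun y => exactTest K η y I) x =
      ∑ k, pd l (pd k η) x * gdelta I (Fin.cons k K) := by
    intro l I
    simp only [exactTest]
    rw [pd_sum _ _ fun k _ => hd ((contDiff_pd hη k).mul contDiff_const)]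
    refine Finset.sum_congr rfl fun k _ => ?_
    rw [pd_mul _ (hd (contDiff_pd hη k)) (hd contDiff_const)]
    simp [pd]
  -- by Laplace expansion the sum contracts the Hessian of `η` with an alternating tensor
  have h2 : ∑ b : Fin (m + 2), (-1 : ℝ) ^ (b : ℕ) *
      pd (J b) (fun y => exactTest K η y (J ∘ b.succAbove)) x =
      ∑ k, ∑ l, pd l (pd k η) x * gdelta J (Fin.cons l (Fin.cons k K : Fin (m + 1) → Fin n)) := by
    simp only [h1, gdelta_cons_right J, Finset.mul_sum]
    rw [Finset.sum_comm]
    refine Finset.sum_congr rfl fun k _ => ?_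
    rw [Finset.sum_comm]
    refine Finset.sum_congr rfl fun b _ => ?_
    simp only [mul_ite, ite_mul, mul_one, mul_zero, zero_mul, Finset.sum_ite_eq', Finset.mem_univ,
      if_true]
    ring
  rw [h2]
  have h3 : ∑ k, ∑ l, pd l (pd k η) x * gdelta J (Fin.cons l (Fin.cons k K : Fin (m + 1) → Fin n))
      = - ∑ k, ∑ l, pd l (pd k η) x *
        gdelta J (Fin.cons l (Fin.cons k K : Fin (m + 1) → Fin n)) := by
    conv_lhs => rw [Finset.sum_comm]
    rw [← Finset.sum_neg_distrib]
    refine Finset.sum_congr rfl fun k _ => ?_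
    rw [← Finset.sum_neg_distrib]
    refine Finset.sum_congr rfl fun l _ => ?_
    rw [pd_comm hη, gdelta_cons_cons_swap]
    ring
  linarith

lemma dotProduct_exactTest (K : Fin m → Fin n) (η : Base n → ℝ) (x : Base n)
    {u : (Fin (m + 1) → Fin n) → ℝ} (hu : IsAlt u) :
    exactTest K η x ⬝ᵥ u = (m + 1).factorial * ∑ k, u (Fin.cons k K) * pd k η x := by
  simp only [dotProduct, exactTest, Finset.sum_mul, Finset.mul_sum]
  rw [Finset.sum_comm]
  refine Finset.sum_congr rfl fun k _ => ?_
  rw [← mul_assoc, ← sum_mul_gdelta hu, Finset.sum_mul]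
  exact Finset.sum_congr rfl fun I _ => by ring

end Constraints

section Duality
variable {g : Base n → Matrix (Fin n) (Fin n) ℝ} {φ : Base n → ℝ} {ε : ℝ}

/-- The divergence of a multivector field. -/
noncomputable def divT (W : Base n → (Fin (m + 1) → Fin n) → ℝ) (x : Base n)
    (K : Fin m → Fin n) : ℝ := ∑ k, pd k (fun y => W y (Fin.cons k K)) x

/-- The basic a priori inequality, for a metric bounded below by a constant one: the projection `u`
of `P⁻¹ W` to the closed forms satisfies `ε ‖u‖² ≤ ‖div W‖²`, and `β` only sees `u`. -/
theorem sq_integral_le_of_bounded_below (h : WeightedHessianMetric g φ ε) (hε : 0 < ε) {δ : ℝ}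
    (hδ : 0 < δ) (hgδ : ∀ x, (g x - δ • (1 : Matrix (Fin n) (Fin n) ℝ)).PosSemidef)
    {β : Base n → (Fin (m + 1) → Fin n) → ℝ} (hβ : WMem (weight g φ (m + 1)) β)
    (hcl : WeaklyClosed β) (ha : ∀ x, IsAlt (β x))
    {W : Base n → (Fin (m + 1) → Fin n) → ℝ} (hW : ∀ I, ContDiff ℝ (⊤ : ℕ∞) fun x => W x I)
    (hWa : ∀ x, IsAlt (W x)) {C : Set (Base n)} (hC : IsCompact C) (hW0 : ∀ x ∉ C, W x = 0) :
    (∫ x, β x ⬝ᵥ W x) ^ 2 ≤ ε⁻¹ * (∫ x, β x ⬝ᵥ weight g φ (m + 1) x *ᵥ β x) *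
      ∫ x, Real.exp (φ x) * (divT W x ⬝ᵥ tpow (g x) m *ᵥ divT W x) := by
  set P := weight g φ (m + 1) with hP
  have hPd : ∀ x, (P x).PosDef := weight_posDef h.posDef (m + 1)
  have hPc : ∀ I J, Continuous fun x => P x I J := fun I J => (h.contDiff_weight I J).continuous
  have hPa : ∀ {v : (Fin (m + 1) → Fin n) → ℝ} x, IsAlt v → IsAlt (P x *ᵥ v) := fun x hv => by
    rw [hP, weight_mulVec]
    exact (hv.mulVec_tpow _).smul _
  set w : Base n → (Fin (m + 1) → Fin n) → ℝ := fun x =>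
    Real.exp (φ x) • (tpow (g x) (m + 1) *ᵥ W x) with hw
  have hPw : ∀ x, P x *ᵥ w x = W x := fun x => by
    rw [hP, weight_mulVec, hw]
    simp only [mulVec_smul, mulVec_mulVec, tpow_inv_mul (h.posDef x), one_mulVec, smul_smul,
      ← Real.exp_add]
    simp
  have hwc : ∀ I, Continuous fun x => w x I := fun I =>
    h.smooth_weight.continuous.rexp.mul (continuous_finsetSum _ fun J _ =>
      (contDiff_tpow h.smooth I J).continuous.mul (hW J).continuous)
  have hwm : WMem P w := wMem_of_continuous hPc hwc hC fun x hx => by simp [hw, hW0 x hx]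
  obtain ⟨u₀, hu₀m, hu₀c, hu₀⟩ := weighted_projection hPd hPc _ constraints_regular hwm
  obtain ⟨u, huae, hum, hua, hucl⟩ := exists_alternating_representative hu₀m.aesm
    (fun I C hC => hu₀m.memLp_restrict hPd hPc hC I) hu₀c
  have hu := hu₀m.congr huae
  have hproj : ∀ v, WMem P v → WeaklyClosed v → (∀ x, IsAlt (v x)) →
      ∫ x, v x ⬝ᵥ P x *ᵥ u x = ∫ x, v x ⬝ᵥ W x := fun v h1 h2 h3 => by
    have := hu₀ v h1 (integral_constraints_eq_zero h2 h3)
    simp only [hPw] at this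
    rw [← this]
    exact integral_congr_ae (huae.mono fun x hx => by simp only [hx])
  have hdW : ∀ K, Continuous fun x => divT W x K := fun K =>
    continuous_finsetSum _ fun k _ => continuous_pd (hW _) k
  have hdW0 : ∀ x ∉ C, divT W x = 0 := fun x hx => by
    ext K
    exact Finset.sum_eq_zero fun k _ => pd_eq_zero_of_eventually hC.isClosed
      (fun y hy => by simp [hW0 y hy]) hx
  -- `u` differs from `w` by a field orthogonal to the closed forms, in particular to the exact forms
  -- `d (η dx_K)`, so `P u` has the same weak divergence as `P w = W`
  have hweak : ∀ K (η : Base n → ℝ), ContDiff ℝ (⊤ : ℕ∞) η → HasCompactSupport η →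
      ∫ x, ∑ k, (P x *ᵥ u x) (Fin.cons k K) * pd k η x = ∫ x, -divT W x K * η x := by
    intro K η h1 h2
    have h0 : ∀ x ∉ tsupport η, η x = 0 := fun x hx => image_eq_zero_of_notMem_tsupport hx
    have h3 := hproj (exactTest K η) (wMem_of_continuous hPc
      (fun I => (contDiff_exactTest K h1 I).continuous) h2 fun x hx => by
        ext I
        simp [exactTest, pd_eq_zero_of_eventually (isClosed_tsupport η) h0 hx])
      (weaklyClosed_exactTest K h1) (exactTest_isAlt K η)
    simp only [dotProduct_exactTest K η _ (hPa _ (hua _)), dotProduct_exactTest K η _ (hWa _)] at h3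
    rw [integral_const_mul, integral_const_mul] at h3
    have i1 : ∀ k, Integrable fun x => W x (Fin.cons k K) * pd k η x := fun k =>
      integrable_of_continuous_of_compact ((hW _).continuous.mul (continuous_pd h1 k)) hC
        fun x hx => by simp [hW0 x hx]
    have i2 : ∀ k, Integrable fun x => pd k (fun y => W y (Fin.cons k K)) x * η x := fun k =>
      integrable_of_continuous_of_compact ((continuous_pd (hW _) k).mul h1.continuous) h2
        fun x hx => by simp [h0 x hx]
    rw [mul_left_cancel₀ (Nat.cast_ne_zero.mpr (Nat.factorial_ne_zero _)) h3,
      integral_finsetSum _ fun k _ => i1 k]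
    simp only [fun k => integral_mul_pd (hW (Fin.cons k K)) h1 hC (fun x hx => by simp [hW0 x hx]) k]
    rw [Finset.sum_neg_distrib, ← integral_finsetSum _ fun k _ => i2 k, ← integral_neg]
    congr 1
    ext x
    rw [divT, neg_mul, Finset.sum_mul]
  have hkey := apriori_of_bounded_below h hδ hgδ hum hu hua hucl (G := fun x => -divT W x)
    (fun K => (hdW K).neg) hC (fun x hx => by simp [hdW0 x hx]) hweak
  simp only [mulVec_neg, neg_dotProduct, dotProduct_neg, neg_neg] at hkey
  have hcs := hβ.cauchy_schwarz hPd hPc hu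
  rw [hproj β hβ hcl ha] at hcs
  refine hcs.trans ?_
  have h0 : 0 ≤ ∫ x, β x ⬝ᵥ P x *ᵥ β x :=
    integral_nonneg fun x => quad_nonneg (hPd x).posSemidef _
  have h1 : ∫ x, u x ⬝ᵥ P x *ᵥ u x ≤
      ε⁻¹ * ∫ x, Real.exp (φ x) * (divT W x ⬝ᵥ tpow (g x) m *ᵥ divT W x) := by
    rw [inv_mul_eq_div, le_div_iff₀ hε, mul_comm]
    exact hkey
  calc _ ≤ (∫ x, β x ⬝ᵥ P x *ᵥ β x) * _ := mul_le_mul_of_nonneg_left h1 h0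
    _ = _ := by ring

/-- Adding `δ` times the flat metric, and `ε δ |x|² / 2` to the weight: the Hessian of the weight
still dominates `ε` times the metric. -/
lemma WeightedHessianMetric.add_flat (h : WeightedHessianMetric g φ ε) {δ : ℝ} (hδ : 0 ≤ δ) :
    WeightedHessianMetric (fun x => g x + δ • (1 : Matrix (Fin n) (Fin n) ℝ))
      (fun x => φ x + ε * δ / 2 * ∑ i, x i ^ 2) ε := by
  have hd : ∀ {f : Base n → ℝ} {x : Base n}, ContDiff ℝ (⊤ : ℕ∞) f → DifferentiableAt ℝ f x :=
    fun hf => (hf.differentiable (by simp)).differentiableAt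
  have hco : ∀ i, ContDiff ℝ (⊤ : ℕ∞) fun x : Base n => x i := fun i =>
    (EuclideanSpace.proj i : Base n →L[ℝ] ℝ).contDiff
  have hpc : ∀ k i (x : Base n), pd k (fun x : Base n => x i) x = if i = k then 1 else 0 := by
    intro k i x
    have : fderiv ℝ (fun x : Base n => x i) x = (EuclideanSpace.proj i : Base n →L[ℝ] ℝ) :=
      (EuclideanSpace.proj i : Base n →L[ℝ] ℝ).fderiv
    rw [pd, this]
    simp [stdVec]
  have hsq : ContDiff ℝ (⊤ : ℕ∞) fun x : Base n => ε * δ / 2 * ∑ i, x i ^ 2 :=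
    contDiff_const.mul (ContDiff.sum fun i _ => (hco i).pow 2)
  have hp1 : ∀ j, pd j (fun x : Base n => φ x + ε * δ / 2 * ∑ i, x i ^ 2) =
      fun x => pd j φ x + ε * δ * x j := by
    intro j
    ext x
    rw [pd_add j (hd h.smooth_weight) (hd hsq),
      pd_const_mul j (hd (ContDiff.sum fun i _ => (hco i).pow 2)),
      pd_sum _ _ fun i _ => hd ((hco i).pow 2)]
    have : ∀ i, pd j (fun x : Base n => x i ^ 2) x = if i = j then 2 * x i else 0 := fun i => by
      simp only [sq]
      rw [pd_mul j (hd (hco i)) (hd (hco i)), hpc]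
      split_ifs <;> ring
    simp only [this, Finset.sum_ite_eq', Finset.mem_univ, if_true]
    ring
  have hone : ∀ i j, ContDiff ℝ (⊤ : ℕ∞) fun _ : Base n => (δ • (1 : Matrix (Fin n) (Fin n) ℝ)) i j :=
    fun i j => contDiff_const
  refine ⟨fun i j => (h.smooth i j).add contDiff_const, fun x => ?_, fun x k i j => ?_,
    h.smooth_weight.add hsq, fun x => ?_⟩
  · exact (h.posDef x).add_posSemidef (PosSemidef.one.smul hδ)
  · simp only [Matrix.add_apply]
    rw [pd_add _ (hd (h.smooth i j)) (hd (hone i j)), pd_add _ (hd (h.smooth k j)) (hd (hone k j)),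
      h.symm]
    simp [pd]
  · have : (Matrix.of (fun i j => pd i (pd j fun x => φ x + ε * δ / 2 * ∑ i, x i ^ 2) x) -
        ε • (g x + δ • (1 : Matrix (Fin n) (Fin n) ℝ))) =
        Matrix.of (fun i j => pd i (pd j φ) x) - ε • g x := by
      ext i j
      simp only [Matrix.sub_apply, Matrix.smul_apply, Matrix.add_apply, of_apply, smul_eq_mul, hp1,
        one_apply]
      rw [pd_add _ (hd (contDiff_pd h.smooth_weight j)) (hd (contDiff_const.mul (hco j))),
        pd_const_mul _ (hd (hco j)), hpc]
      by_cases hij : i = j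
      · simp [hij]; ring
      · simp [hij, Ne.symm hij]
    rw [this]
    exact h.hess_ge x

/-- The basic a priori inequality, without completeness of the metric. In passing to the metric and
weight of `WeightedHessianMetric.add_flat` the norm of `β` decreases, while the integral over `W`,
which has compact support, is continuous in `δ`. -/
theorem sq_integral_le (h : WeightedHessianMetric g φ ε) (hε : 0 < ε)
    {β : Base n → (Fin (m + 1) → Fin n) → ℝ} (hβ : WMem (weight g φ (m + 1)) β)
    (hcl : WeaklyClosed β) (ha : ∀ x, IsAlt (β x))
    {W : Base n → (Fin (m + 1) → Fin n) → ℝ} (hW : ∀ I, ContDiff ℝ (⊤ : ℕ∞) fun x => W x I)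
    (hWa : ∀ x, IsAlt (W x)) {C : Set (Base n)} (hC : IsCompact C) (hW0 : ∀ x ∉ C, W x = 0) :
    (∫ x, β x ⬝ᵥ W x) ^ 2 ≤ ε⁻¹ * (∫ x, β x ⬝ᵥ weight g φ (m + 1) x *ᵥ β x) *
      ∫ x, Real.exp (φ x) * (divT W x ⬝ᵥ tpow (g x) m *ᵥ divT W x) := by
  set gδ : ℝ → Base n → Matrix (Fin n) (Fin n) ℝ := fun δ x => g x + δ • 1 with hgδ
  set φδ : ℝ → Base n → ℝ := fun δ x => φ x + ε * δ / 2 * ∑ i, x i ^ 2 with hφδ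
  set Φ : ℝ → Base n → ℝ := fun δ x =>
    Real.exp (φδ δ x) * (divT W x ⬝ᵥ tpow (gδ δ x) m *ᵥ divT W x) with hΦ
  set E := ∫ x, β x ⬝ᵥ weight g φ (m + 1) x *ᵥ β x with hE
  have hdW : ∀ K, Continuous fun x => divT W x K := fun K =>
    continuous_finsetSum _ fun k _ => continuous_pd (hW _) k
  have hdW0 : ∀ x ∉ C, divT W x = 0 := fun x hx => by
    ext K
    exact Finset.sum_eq_zero fun k _ => pd_eq_zero_of_eventually hC.isClosed
      (fun y hy => by simp [hW0 y hy]) hx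
  have hE0 : 0 ≤ E := integral_nonneg fun x =>
    quad_nonneg (weight_posDef h.posDef (m + 1) x).posSemidef _
  have hcont : Continuous fun δ => ∫ x in C, Φ δ x := by
    refine continuous_parametric_integral_of_continuous ?_ hC
    simp only [Function.uncurry_def, hΦ, hφδ, hgδ, quad_eq_sum, tpow_apply]
    have c1 : Continuous φ := h.smooth_weight.continuous
    have c2 : ∀ i j, Continuous fun x => g x i j := fun i j => (h.smooth i j).continuous
    refine Continuous.mul ?_ (continuous_finsetSum _ fun I _ => continuous_finsetSum _ fun K _ =>
      (((continuous_finsetProd _ fun a _ => ?_).mul ((hdW I).comp continuous_snd)).mul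
        ((hdW K).comp continuous_snd)))
    · refine Continuous.rexp ?_
      refine (c1.comp continuous_snd).add (Continuous.mul (by fun_prop)
        (continuous_finsetSum _ fun i _ => ?_))
      exact (((EuclideanSpace.proj i : Base n →L[ℝ] ℝ).continuous).comp continuous_snd).pow 2
    · simp only [Matrix.add_apply, Matrix.smul_apply, smul_eq_mul]
      exact ((c2 _ _).comp continuous_snd).add (continuous_fst.mul continuous_const)
  have hle : ∀ δ, 0 < δ → (∫ x, β x ⬝ᵥ W x) ^ 2 ≤ ε⁻¹ * E * ∫ x in C, Φ δ x := by
    intro δ hδ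
    have hδm := h.add_flat hδ.le
    have hmono : ∀ x, β x ⬝ᵥ weight (gδ δ) (φδ δ) (m + 1) x *ᵥ β x ≤
        β x ⬝ᵥ weight g φ (m + 1) x *ᵥ β x := by
      intro x
      simp only [weight_mulVec, dotProduct_smul, smul_eq_mul]
      have h1 : (g x)⁻¹ - (gδ δ x)⁻¹ |>.PosSemidef := by
        refine inv_sub_inv_posSemidef (h.posDef x) (hδm.posDef x) ?_
        simp only [hgδ, add_sub_cancel_left]
        exact PosSemidef.one.smul hδ.le
      refine mul_le_mul (Real.exp_le_exp.mpr ?_)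
        (quad_tpow_mono (hδm.posDef x).inv.posSemidef h1 _)
        (quad_nonneg (tpow_posSemidef (hδm.posDef x).inv.posSemidef _) _) (Real.exp_pos _).le
      have : 0 ≤ ε * δ / 2 * ∑ i, x i ^ 2 :=
        mul_nonneg (by positivity) (Finset.sum_nonneg fun i _ => sq_nonneg _)
      simp only [hφδ]
      linarith
    have hnn : ∀ x, 0 ≤ β x ⬝ᵥ weight (gδ δ) (φδ δ) (m + 1) x *ᵥ β x := fun x =>
      quad_nonneg (weight_posDef hδm.posDef (m + 1) x).posSemidef _
    have hβδ : WMem (weight (gδ δ) (φδ δ) (m + 1)) β := by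
      refine ⟨hβ.aesm, hβ.integrable.mono' ?_ (Eventually.of_forall fun x => ?_)⟩
      · simp only [quad_eq_sum]
        exact Finset.aestronglyMeasurable_fun_sum _ fun I _ =>
          Finset.aestronglyMeasurable_fun_sum _ fun K _ =>
            ((hδm.contDiff_weight I K).continuous.aestronglyMeasurable.mul (hβ.aesm I)).mul
              (hβ.aesm K)
      · rw [Real.norm_of_nonneg (hnn x)]
        exact hmono x
    have h1 := sq_integral_le_of_bounded_below hδm hε hδ (fun x => by
      simpa using (h.posDef x).posSemidef) hβδ hcl ha hW hWa hC hW0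
    have h2 : ∫ x in C, Φ δ x = ∫ x, Φ δ x :=
      setIntegral_eq_integral_of_forall_compl_eq_zero fun x hx => by simp [hΦ, hdW0 x hx]
    rw [h2]
    refine h1.trans (mul_le_mul_of_nonneg_right (mul_le_mul_of_nonneg_left ?_ (by positivity)) ?_)
    · exact integral_mono hβδ.integrable hβ.integrable hmono
    · exact integral_nonneg fun x => mul_nonneg (Real.exp_pos _).le
        (quad_nonneg (tpow_posSemidef (hδm.posDef x).posSemidef m) _)
  have hlim : Tendsto (fun δ => ε⁻¹ * E * ∫ x in C, Φ δ x) (𝓝[>] 0)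
      (𝓝 (ε⁻¹ * E * ∫ x in C, Φ 0 x)) :=
    ((hcont.tendsto 0).mono_left nhdsWithin_le_nhds).const_mul _
  have hfin := ge_of_tendsto hlim (eventually_mem_nhdsWithin.mono fun δ hδ => hle δ hδ)
  have h2 : ∫ x in C, Φ 0 x = ∫ x, Φ 0 x :=
    setIntegral_eq_integral_of_forall_compl_eq_zero fun x hx => by simp [hΦ, hdW0 x hx]
  rw [h2] at hfin
  simpa [hΦ, hφδ, hgδ] using hfin

end Duality

/-! ### Components of superforms of bidegree (p,n) -/

section Tuples

lemma orderEmbedding_comp_perm_injective (p n : ℕ) :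
    Function.Injective fun x : (Fin p ↪o Fin n) × Equiv.Perm (Fin p) => (x.1 : Fin p → Fin n) ∘ x.2 := by
  rintro ⟨K, σ⟩ ⟨K', σ'⟩ h
  simp only at h
  have h1 : Set.range K = Set.range K' := by
    rw [← σ.surjective.range_comp K, ← σ'.surjective.range_comp K', h]
  obtain rfl := OrderEmbedding.range_inj.mp h1
  refine Prod.ext rfl (Equiv.ext fun a => K.injective (congrFun h a))

/-- A sum over all tuples, of a function which vanishes on tuples with repetitions. -/
lemma sum_tuples_eq {M : Type*} [AddCommMonoid M] {F : (Fin p → Fin n) → M}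
    (hF : ∀ I, ¬ Function.Injective I → F I = 0) :
    ∑ I, F I = ∑ K : Fin p ↪o Fin n, ∑ σ : Equiv.Perm (Fin p), F (K ∘ σ) := by
  rw [← Fintype.sum_prod_type' (f := fun (K : Fin p ↪o Fin n) (σ : Equiv.Perm (Fin p)) => F (K ∘ σ))]
  symm
  refine Finset.sum_of_injOn (fun x => (x.1 : Fin p → Fin n) ∘ x.2)
    (orderEmbedding_comp_perm_injective p n).injOn (fun _ _ => Finset.mem_coe.mpr (Finset.mem_univ _))
    (fun I _ hI => hF I fun hinj => hI ?_) fun _ _ => rfl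
  have hm : StrictMono (I ∘ Tuple.sort I) :=
    (Tuple.monotone_sort I).strictMono_of_injective (hinj.comp (Tuple.sort I).injective)
  refine ⟨(OrderEmbedding.ofStrictMono _ hm, (Tuple.sort I)⁻¹), Finset.mem_coe.mpr (Finset.mem_univ _), ?_⟩
  ext a
  simp

lemma IsAlt.eq_zero_of_not_injective {u : (Fin p → Fin n) → ℝ} (hu : IsAlt u) {I : Fin p → Fin n}
    (hI : ¬ Function.Injective I) : u I = 0 := by
  simp only [Function.Injective, not_forall] at hI
  obtain ⟨a, b, h1, h2⟩ := hI
  have h3 := hu.swap h2 I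
  have h4 : I ∘ Equiv.swap a b = I := by
    ext c
    simp only [Function.comp_apply, Equiv.swap_apply_def]
    split_ifs with h5 h6 <;> simp [*]
  rw [h4] at h3
  linarith

lemma sign_sq (σ : Equiv.Perm (Fin p)) :
    ((Equiv.Perm.sign σ : ℤ) : ℝ) * ((Equiv.Perm.sign σ : ℤ) : ℝ) = 1 := by
  rcases Int.units_eq_one_or (Equiv.Perm.sign σ) with h | h <;> simp [h]

/-- The inner product of alternating tensors by means of increasing multi-indices. -/
lemma quad_tpow_eq_sum_orderEmbedding (H : Matrix (Fin n) (Fin n) ℝ) {u v : (Fin p → Fin n) → ℝ}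
    (hu : IsAlt u) (hv : IsAlt v) : u ⬝ᵥ tpow H p *ᵥ v =
      p.factorial * ∑ I : Fin p ↪o Fin n, ∑ K : Fin p ↪o Fin n,
        u I * v K * (H.submatrix I K).det := by
  have h1 : ∀ I : Fin p → Fin n, (tpow H p *ᵥ v) I =
      ∑ K : Fin p ↪o Fin n, v K * (H.submatrix I K).det := by
    intro I
    simp only [mulVec, dotProduct]
    rw [sum_tuples_eq fun K hK => by rw [hv.eq_zero_of_not_injective hK, mul_zero]]
    refine Finset.sum_congr rfl fun K _ => ?_
    rw [← det_transpose, det_apply', Finset.mul_sum]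
    refine Finset.sum_congr rfl fun σ _ => ?_
    rw [hv σ K, tpow_apply]
    simp only [transpose_apply, submatrix_apply, Function.comp_apply]
    ring
  have h2 : IsAlt (tpow H p *ᵥ v) := hv.mulVec_tpow H
  rw [dotProduct, sum_tuples_eq fun K hK => by rw [hu.eq_zero_of_not_injective hK, zero_mul],
    Finset.mul_sum]
  refine Finset.sum_congr rfl fun I _ => ?_
  have h3 : ∀ σ : Equiv.Perm (Fin p), u (I ∘ σ) * (tpow H p *ᵥ v) (I ∘ σ) =
      u I * (tpow H p *ᵥ v) I := fun σ => by
    rw [hu σ I, h2 σ I]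
    linear_combination (u I * (tpow H p *ᵥ v) I) * sign_sq σ
  rw [Finset.sum_congr rfl fun σ _ => h3 σ, Finset.sum_const, Finset.card_univ, Fintype.card_perm,
    Fintype.card_fin, nsmul_eq_mul, h1, Finset.mul_sum, Finset.mul_sum]
  rw [Finset.mul_sum]
  exact Finset.sum_congr rfl fun K _ => by ring

/-- The only strictly increasing multi-index of length `n` is `(1, …, n)`. -/
instance : Unique (Fin n ↪o Fin n) where
  default := RelEmbedding.refl _
  uniq f := by
    refine OrderEmbedding.range_inj.mp ?_
    rw [(Finite.surjective_of_injective f.injective).range_eq]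
    exact (Set.range_eq_univ.mpr Function.surjective_id).symm

end Tuples

section Components

/-- The components of a `(p,n)`-form, as an alternating tensor. -/
noncomputable def comp (α : SForm n p n) (I : Fin p → Fin n) : ℝ :=
  α (fun a => stdVec (I a)) stdVec

lemma comp_isAlt (α : SForm n p n) : IsAlt (comp α) := by
  intro σ I
  have h := α.toAlternatingMap.map_perm (fun a => stdVec (I a)) σ
  have h2 := congrArg (fun f : (Base n) [⋀^Fin n]→L[ℝ] ℝ => f stdVec) h
  simp only [comp]
  refine h2.trans ?_
  rcases Int.units_eq_one_or (Equiv.Perm.sign σ) with h | h <;> simp [h]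

lemma coeff_eq_comp (α : SForm n p n) (I : Fin p ↪o Fin n) (J : Fin n ↪o Fin n) :
    coeff α I J = comp α I := by
  rw [Unique.eq_default J]
  rfl

/-- The length of a `(p,n)`-form: the single `dξ`-component contributes the determinant of the inverse
metric, and summation over all tuples instead of the increasing ones counts everything `p!` times. -/
lemma pInner_eq (ω : SForm n 1 1) (α : SForm n p n) : pInner ω α α =
    (p.factorial : ℝ)⁻¹ * (comp α ⬝ᵥ tpow (coeffMatrix ω)⁻¹ p *ᵥ comp α) *
      ((coeffMatrix ω)⁻¹).det := by
  rw [quad_tpow_eq_sum_orderEmbedding _ (comp_isAlt α) (comp_isAlt α), ← mul_assoc,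
    inv_mul_cancel₀ (Nat.cast_ne_zero.mpr (Nat.factorial_ne_zero _)), one_mul]
  simp only [pInner, Fintype.sum_unique, coeff_eq_comp, Finset.sum_mul]
  refine Finset.sum_congr rfl fun I _ => Finset.sum_congr rfl fun K _ => ?_
  have : gram ω (default : Fin n ↪o Fin n) default = ((coeffMatrix ω)⁻¹).det := rfl
  rw [this, gram]
  ring

lemma wedgeDx_apply (a : Base n →L[ℝ] ℝ) (α : SForm n p q) (v : Fin (p + 1) → Base n)
    (w : Fin q → Base n) : wedgeDx a α v w =
      ∑ c : Fin (p + 1), (-1) ^ (c : ℕ) * (a (v c) * α (v ∘ c.succAbove) w) := by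
  rw [wedgeDx, ContinuousAlternatingMap.alternatizeUncurryFin_apply,
    ContinuousAlternatingMap.sum_apply]
  refine Finset.sum_congr rfl fun c _ => ?_
  rw [ContinuousAlternatingMap.smul_apply, zsmul_eq_mul]
  push_cast
  rfl

lemma altXi_apply (f : Base n →L[ℝ] SForm n p q) (v : Fin p → Base n) (w : Fin (q + 1) → Base n) :
    altXi f v w = (-1) ^ p * ∑ c : Fin (q + 1), (-1) ^ (c : ℕ) * f (w c) v (w ∘ c.succAbove) := by
  have : altXi f v w = (-1 : ℝ) ^ p *
      ContinuousAlternatingMap.alternatizeUncurryFin (f.flipAlternating v) w := rfl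
  rw [this, ContinuousAlternatingMap.alternatizeUncurryFin_apply]
  congr 1
  refine Finset.sum_congr rfl fun c _ => ?_
  rw [zsmul_eq_mul]
  push_cast
  rfl

lemma wedgeDxi_apply (b : Base n →L[ℝ] ℝ) (α : SForm n p q) (v : Fin p → Base n)
    (w : Fin (q + 1) → Base n) : wedgeDxi b α v w =
      (-1) ^ p * ∑ c : Fin (q + 1), (-1) ^ (c : ℕ) * (b (w c) * α v (w ∘ c.succAbove)) := by
  rw [wedgeDxi, altXi_apply]
  rfl

lemma comp_wedgeDx (a : Base n →L[ℝ] ℝ) (α : SForm n p n) (J : Fin (p + 1) → Fin n) :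
    comp (wedgeDx a α) J =
      ∑ b : Fin (p + 1), (-1) ^ (b : ℕ) * (a (stdVec (J b)) * comp α (J ∘ b.succAbove)) := by
  rw [comp, wedgeDx_apply]
  rfl

lemma neg_one_pow_triangle (k : ℕ) :
    (-1 : ℝ) ^ ((k + 1) * k / 2) = (-1) ^ k * (-1) ^ (k * (k - 1) / 2) := by
  rw [← pow_add]
  congr 1
  have h1 := Finset.sum_range_id_mul_two (k + 1)
  have h2 := Finset.sum_range_id_mul_two k
  rw [Finset.sum_range_succ] at h1
  simp only [Nat.add_sub_cancel] at h1
  omega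

/-- The powers of a `(1,1)`-form are given by determinants. -/
lemma omegaPow_apply (ω : SForm n 1 1) (k : ℕ) (v w : Fin k → Base n) :
    omegaPow ω k v w = (-1) ^ (k * (k - 1) / 2) * (k.factorial *
      (Matrix.of fun a b => ∑ i, ∑ j, coeffMatrix ω i j * (v a i * w b j)).det) := by
  induction k with
  | zero => simp [omegaPow]
  | succ k ih =>
    set M : Matrix (Fin (k + 1)) (Fin (k + 1)) ℝ :=
      Matrix.of fun a b => ∑ i, ∑ j, coeffMatrix ω i j * (v a i * w b j) with hM
    have h1 : omegaPow ω (k + 1) v w = ∑ i, ∑ j, coeffMatrix ω i j *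
        ∑ c : Fin (k + 1), (-1) ^ (c : ℕ) * (v c i * ((-1) ^ k * ∑ d : Fin (k + 1),
          (-1) ^ (d : ℕ) * (w d j * omegaPow ω k (v ∘ c.succAbove) (w ∘ d.succAbove)))) := by
      simp only [omegaPow, wedgeOmega, ContinuousAlternatingMap.sum_apply,
        ContinuousAlternatingMap.smul_apply, wedgeDx_apply, wedgeDxi_apply]
      rfl
    have h2 : ∀ c d : Fin (k + 1), omegaPow ω k (v ∘ c.succAbove) (w ∘ d.succAbove) =
        (-1) ^ (k * (k - 1) / 2) * (k.factorial * (M.submatrix c.succAbove d.succAbove).det) :=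
      fun c d => ih _ _
    have h3 : omegaPow ω (k + 1) v w = (-1) ^ k * (-1) ^ (k * (k - 1) / 2) * (k.factorial *
        ∑ c : Fin (k + 1), ∑ d : Fin (k + 1), (-1) ^ ((c : ℕ) + d) * M c d *
          (M.submatrix c.succAbove d.succAbove).det) := by
      rw [h1]
      simp only [h2, Finset.mul_sum]
      have e1 : ∀ i, ∑ j, ∑ c : Fin (k + 1), ∑ d : Fin (k + 1), coeffMatrix ω i j *
          ((-1) ^ (c : ℕ) * (v c i * ((-1) ^ k * ((-1) ^ (d : ℕ) * (w d j *
            ((-1) ^ (k * (k - 1) / 2) * (k.factorial *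
              (M.submatrix c.succAbove d.succAbove).det))))))) =
          ∑ c : Fin (k + 1), ∑ d : Fin (k + 1), ∑ j, coeffMatrix ω i j *
          ((-1) ^ (c : ℕ) * (v c i * ((-1) ^ k * ((-1) ^ (d : ℕ) * (w d j *
            ((-1) ^ (k * (k - 1) / 2) * (k.factorial *
              (M.submatrix c.succAbove d.succAbove).det))))))) := fun i => by
        rw [Finset.sum_comm]
        exact Finset.sum_congr rfl fun c _ => Finset.sum_comm
      simp only [e1]
      rw [Finset.sum_comm]
      refine Finset.sum_congr rfl fun c _ => ?_
      rw [Finset.sum_comm]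
      refine Finset.sum_congr rfl fun d _ => ?_
      simp only [hM, of_apply, Finset.sum_mul, Finset.mul_sum]
      refine Finset.sum_congr rfl fun i _ => Finset.sum_congr rfl fun j _ => ?_
      rw [pow_add]
      ring
    rw [h3]
    simp only [← det_succ_row M, Finset.sum_const, Finset.card_univ, Fintype.card_fin, nsmul_eq_mul]
    rw [Nat.add_sub_cancel, neg_one_pow_triangle, Nat.factorial_succ]
    push_cast
    ring

lemma topCoeff_omegaVol (ω : SForm n 1 1) : topCoeff (omegaVol ω) = (coeffMatrix ω).det := by
  have h1 : omegaVol ω stdVec stdVec = (n.factorial : ℝ)⁻¹ * omegaPow ω n stdVec stdVec := rfl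
  have h2 : (Matrix.of fun a b : Fin n => ∑ i, ∑ j, coeffMatrix ω i j *
      ((stdVec a : Base n) i * (stdVec b : Base n) j)) = coeffMatrix ω := by
    ext a b
    simp [stdVec]
  rw [topCoeff, h1, omegaPow_apply, h2]
  have h3 : ((-1 : ℝ) ^ (n * (n - 1) / 2)) * (-1) ^ (n * (n - 1) / 2) = 1 := by
    rw [← mul_pow]; simp
  have h4 : (n.factorial : ℝ)⁻¹ * n.factorial = 1 :=
    inv_mul_cancel₀ (Nat.cast_ne_zero.mpr (Nat.factorial_ne_zero _))
  linear_combination ((n.factorial : ℝ)⁻¹ * n.factorial * (coeffMatrix ω).det) * h3 +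
    (coeffMatrix ω).det * h4

/-- The integrand of the weighted norm of a `(p,n)`-form; the volume factor cancels. -/
lemma topCoeff_normDensity {ω : Base n → SForm n 1 1} (hω : ∀ x, (coeffMatrix (ω x)).PosDef)
    (φ : Base n → ℝ) (α : Base n → SForm n p n) (x : Base n) : topCoeff (normDensity ω φ α x) =
      (p.factorial : ℝ)⁻¹ *
        (comp (α x) ⬝ᵥ weight (fun y => coeffMatrix (ω y)) φ p x *ᵥ comp (α x)) := by
  have h1 : topCoeff (normDensity ω φ α x) =
      (pInner (ω x) (α x) (α x) * Real.exp (-φ x)) * topCoeff (omegaVol (ω x)) := by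
    simp only [topCoeff, normDensity, ContinuousAlternatingMap.smul_apply, smul_eq_mul]
    ring
  have h2 : ((coeffMatrix (ω x))⁻¹).det * (coeffMatrix (ω x)).det = 1 := by
    rw [← det_mul, nonsing_inv_mul _ ((isUnit_iff_isUnit_det _).mp (hω x).isUnit), det_one]
  rw [h1, pInner_eq, topCoeff_omegaVol, weight_mulVec, dotProduct_smul, smul_eq_mul]
  linear_combination ((p.factorial : ℝ)⁻¹ * (comp (α x) ⬝ᵥ tpow (coeffMatrix (ω x))⁻¹ p *ᵥ comp (α x))
    * Real.exp (-φ x)) * h2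

/-- The norm of a `(p,n)`-form does not involve the volume density of the metric, only the weight `φ`. -/
lemma normSq_eq {ω : Base n → SForm n 1 1} (hω : ∀ x, (coeffMatrix (ω x)).PosDef)
    (φ : Base n → ℝ) (α : Base n → SForm n p n) : normSq ω φ α = (p.factorial : ℝ)⁻¹ *
      ∫ x, comp (α x) ⬝ᵥ weight (fun y => coeffMatrix (ω y)) φ p x *ᵥ comp (α x) := by
  simp only [normSq, superIntegral, topCoeff_normDensity hω, integral_const_mul]

/-- Up to sign, every component is a coefficient. -/
lemma comp_eq_zero_or (I : Fin p → Fin n) : (∀ α : SForm n p n, comp α I = 0) ∨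
    ∃ (c : ℝ) (K : Fin p ↪o Fin n), ∀ α : SForm n p n, comp α I = c * coeff α K default := by
  by_cases hI : Function.Injective I
  · right
    have hm : StrictMono (I ∘ Tuple.sort I) :=
      (Tuple.monotone_sort I).strictMono_of_injective (hI.comp (Tuple.sort I).injective)
    refine ⟨((Equiv.Perm.sign (Tuple.sort I)⁻¹ : ℤ) : ℝ), OrderEmbedding.ofStrictMono _ hm, fun α => ?_⟩
    rw [coeff_eq_comp, OrderEmbedding.coe_ofStrictMono, ← comp_isAlt α (Tuple.sort I)⁻¹]
    congr 1
    ext a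
    simp
  · exact Or.inl fun α => (comp_isAlt α).eq_zero_of_not_injective hI

/-- A `(p,n)`-form is determined by its components. -/
lemma apply_eq_sum_comp (α : SForm n p n) (v : Fin p → Base n) (w : Fin n → Base n) :
    α v w = ∑ J : Fin p → Fin n, (∏ a, v a (J a)) *
      (EuclideanSpace.basisFun (Fin n) ℝ).toBasis.det w * comp α J := by
  have h1 : ∀ u : Base n, u = ∑ j, u j • stdVec j := fun u => by
    have := (EuclideanSpace.basisFun (Fin n) ℝ).sum_repr u
    simpa [stdVec] using this.symm
  have h2 : ∀ f : (Base n) [⋀^Fin n]→L[ℝ] ℝ,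
      f w = (EuclideanSpace.basisFun (Fin n) ℝ).toBasis.det w * f stdVec := fun f => by
    have h3 := f.toAlternatingMap.eq_smul_basis_det (EuclideanSpace.basisFun (Fin n) ℝ).toBasis
    have h4 := congrArg (fun F => F w) h3
    simp only [AlternatingMap.smul_apply, smul_eq_mul] at h4
    have h5 : ((EuclideanSpace.basisFun (Fin n) ℝ).toBasis : Fin n → Base n) = stdVec := by
      ext1 i
      simp [stdVec]
    rw [h5, mul_comm] at h4
    exact h4
  have h6 : α v = ∑ J : Fin p → Fin n, (∏ a, v a (J a)) • α fun a => stdVec (J a) := by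
    have h7 : v = fun a => ∑ j, v a j • stdVec j := funext fun a => h1 (v a)
    have h8 := α.toMultilinearMap.map_sum fun a j => v a j • (stdVec j : Base n)
    have h9 : ∀ J : Fin p → Fin n, α.toMultilinearMap (fun a => v a (J a) • (stdVec (J a) : Base n))
        = (∏ a, v a (J a)) • α fun a => stdVec (J a) := fun J =>
      α.toMultilinearMap.map_smul_univ _ _
    simp only [h9] at h8
    conv_lhs => rw [h7]
    exact h8
  rw [h6, ContinuousAlternatingMap.sum_apply]
  refine Finset.sum_congr rfl fun J _ => ?_
  rw [ContinuousAlternatingMap.smul_apply, h2, smul_eq_mul, comp]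
  ring

end Components

section Monomials
variable {F : Type*} [NormedAddCommGroup F] [NormedSpace ℝ F]

/-- The alternating form `f dx_{I₀} ∧ ⋯ ∧ dx_{I_{p-1}}`, for a vector `f` and a tuple `I`. -/
noncomputable def monomial (f : F) : (p : ℕ) → (Fin p → Fin n) → (Base n) [⋀^Fin p]→L[ℝ] F
  | 0, _ => ContinuousAlternatingMap.constOfIsEmpty ℝ (Base n) (Fin 0) f
  | p + 1, I => ContinuousAlternatingMap.alternatizeUncurryFin
      ((EuclideanSpace.proj (I 0) : Base n →L[ℝ] ℝ).smulRight (monomial f p (Fin.tail I)))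

/-- The components of a monomial form, by Laplace expansion of the generalized delta. -/
lemma monomial_apply (f : F) (I J : Fin p → Fin n) :
    monomial f p I (fun a => stdVec (J a)) = gdelta I J • f := by
  induction p with
  | zero => simp [monomial, gdelta]
  | succ p ih =>
    rw [monomial, ContinuousAlternatingMap.alternatizeUncurryFin_apply, ← Fin.cons_self_tail I,
      gdelta_cons_left, Finset.sum_smul]
    refine Finset.sum_congr rfl fun b _ => ?_
    have h1 : (((EuclideanSpace.proj ((Fin.cons (I 0) (Fin.tail I) : Fin (p + 1) → Fin n) 0) :
        Base n →L[ℝ] ℝ).smulRight (monomial f p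
          (Fin.tail (Fin.cons (I 0) (Fin.tail I) : Fin (p + 1) → Fin n)))) (stdVec (J b)))
        (b.removeNth fun a => stdVec (J a)) =
        (stdVec (J b) : Base n) (I 0) • monomial f p (Fin.tail I)
          (fun a => stdVec ((J ∘ b.succAbove) a)) := rfl
    rw [h1, ih, ← Int.cast_smul_eq_zsmul ℝ, smul_smul, smul_smul]
    congr 1
    simp [stdVec]

/-- The `(p,n)`-form with components the antisymmetrization of `p! c`. -/
noncomputable def ofTuples (c : (Fin p → Fin n) → ℝ) : SForm n p n :=
  ∑ I, c I • monomial (monomial (1 : ℝ) n id) p I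

lemma comp_ofTuples (c : (Fin p → Fin n) → ℝ) (J : Fin p → Fin n) :
    comp (ofTuples c) J = ∑ I, c I * gdelta I J := by
  have h1 : (monomial (1 : ℝ) n id : (Base n) [⋀^Fin n]→L[ℝ] ℝ) stdVec = 1 := by
    have h2 := monomial_apply (1 : ℝ) (id : Fin n → Fin n) id
    have h3 : gdelta (id : Fin n → Fin n) id = 1 := by
      have : (Matrix.of fun a b : Fin n => if id a = id b then (1 : ℝ) else 0) = 1 := by
        ext a b
        simp [one_apply]
      rw [gdelta, this, det_one]
    rw [h3] at h2
    simpa using h2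
  rw [comp, ofTuples, ContinuousAlternatingMap.sum_apply, ContinuousAlternatingMap.sum_apply]
  refine Finset.sum_congr rfl fun I _ => ?_
  rw [ContinuousAlternatingMap.smul_apply, monomial_apply, ContinuousAlternatingMap.smul_apply,
    ContinuousAlternatingMap.smul_apply, h1]
  simp

end Monomials

/-! ### Solution of the equation -/

section Kahler

section Evaluation
variable {F : Type*} [NormedAddCommGroup F] [NormedSpace ℝ F]

lemma hasFDerivAt_alternating_apply {α : Base n → (Base n) [⋀^Fin p]→L[ℝ] F} {x : Base n}
    (h : DifferentiableAt ℝ α x) (v : Fin p → Base n) :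
    HasFDerivAt (fun y => α y v)
      ((ContinuousAlternatingMap.apply ℝ (Base n) F v).comp (fderiv ℝ α x)) x :=
  HasFDerivAt.comp (g := ContinuousAlternatingMap.apply ℝ (Base n) F v) x
    (ContinuousAlternatingMap.apply ℝ (Base n) F v).hasFDerivAt h.hasFDerivAt

lemma contDiff_alternating_apply {α : Base n → (Base n) [⋀^Fin p]→L[ℝ] F}
    (h : ContDiff ℝ (⊤ : ℕ∞) α) (v : Fin p → Base n) : ContDiff ℝ (⊤ : ℕ∞) fun y => α y v :=
  (ContinuousAlternatingMap.apply ℝ (Base n) F v).contDiff.comp h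

lemma contDiff_sum_smul {ι : Type*} [Fintype ι] {f : ι → Base n → ℝ}
    (hf : ∀ i, ContDiff ℝ (⊤ : ℕ∞) (f i)) (c : ι → F) :
    ContDiff ℝ (⊤ : ℕ∞) fun x => ∑ i, f i x • c i :=
  ContDiff.sum fun i _ => (hf i).smul contDiff_const

lemma fderiv_smul_vector {f : Base n → ℝ} {x : Base n} (hf : DifferentiableAt ℝ f x) (c : F) :
    fderiv ℝ (fun y => f y • c) x = (fderiv ℝ f x).smulRight c :=
  (hf.hasFDerivAt.smul_const c).fderiv

end Evaluation

lemma fderiv_apply_apply {α : Base n → SForm n p q} {x : Base n} (h : DifferentiableAt ℝ α x)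
    (v : Fin p → Base n) (w : Fin q → Base n) (u : Base n) :
    fderiv ℝ (fun y => α y v w) x u = fderiv ℝ α x u v w := by
  have h1 := hasFDerivAt_alternating_apply h v
  rw [(hasFDerivAt_alternating_apply h1.differentiableAt w).fderiv, h1.fderiv]
  rfl

lemma contDiff_coeffMatrix {ω : Base n → SForm n 1 1} (h : ContDiff ℝ (⊤ : ℕ∞) ω) (i j : Fin n) :
    ContDiff ℝ (⊤ : ℕ∞) fun x => coeffMatrix (ω x) i j :=
  contDiff_alternating_apply (contDiff_alternating_apply h _) _

lemma d_apply (α : Base n → SForm n p q) (x : Base n) (v : Fin (p + 1) → Base n)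
    (w : Fin q → Base n) : d α x v w =
      ∑ c : Fin (p + 1), (-1) ^ (c : ℕ) * fderiv ℝ α x (v c) (v ∘ c.succAbove) w := by
  rw [d, extDeriv, ContinuousAlternatingMap.alternatizeUncurryFin_apply,
    ContinuousAlternatingMap.sum_apply]
  refine Finset.sum_congr rfl fun c _ => ?_
  rw [ContinuousAlternatingMap.smul_apply, zsmul_eq_mul]
  push_cast
  rfl

/-- Here `omegaPow 0 0` is the constant `1`, as a `(0,0)`-form. -/
lemma dSharp_ofFun {φ : Base n → ℝ} (hφ : ContDiff ℝ (⊤ : ℕ∞) φ) :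
    dSharp (ofFun φ) = fun x => ∑ i, pd i φ x •
      wedgeDxi (EuclideanSpace.proj i : Base n →L[ℝ] ℝ) (omegaPow (0 : SForm n 1 1) 0) := by
  ext1 x
  have h1 : ofFun φ = fun x => φ x • omegaPow (0 : SForm n 1 1) 0 := by
    ext x v w
    simp [ofFun, omegaPow]
  have h2 : fderiv ℝ (ofFun φ) x = (fderiv ℝ φ x).smulRight (omegaPow (0 : SForm n 1 1) 0) := by
    rw [h1]
    exact fderiv_smul_vector (F := SForm n 0 0) (hφ.differentiable (by simp)).differentiableAt _
  have h3 : ∀ u : Base n, fderiv ℝ φ x u = ∑ i, pd i φ x * u i := fun u => by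
    have h4 : u = ∑ j, u j • stdVec j := by
      simpa [stdVec] using ((EuclideanSpace.basisFun (Fin n) ℝ).sum_repr u).symm
    conv_lhs => rw [h4]
    simp only [map_sum, map_smul, smul_eq_mul, pd]
    exact Finset.sum_congr rfl fun i _ => mul_comm _ _
  ext v w
  rw [dSharp, h2]
  refine (wedgeDxi_apply (fderiv ℝ φ x) _ v w).trans ?_
  simp only [ContinuousAlternatingMap.sum_apply, ContinuousAlternatingMap.smul_apply,
    wedgeDxi_apply, h3, smul_eq_mul]
  simp [Finset.sum_mul, mul_assoc]

lemma dSharp_ofFun_apply {φ : Base n → ℝ} (hφ : ContDiff ℝ (⊤ : ℕ∞) φ) (x : Base n)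
    (v : Fin 0 → Base n) (j : Fin n) :
    dSharp (ofFun φ) x v (fun _ => stdVec j) = pd j φ x := by
  rw [dSharp_ofFun hφ]
  simp only [ContinuousAlternatingMap.sum_apply, ContinuousAlternatingMap.smul_apply,
    wedgeDxi_apply, smul_eq_mul]
  simp [omegaPow, stdVec]

lemma contDiff_dSharp_ofFun {φ : Base n → ℝ} (hφ : ContDiff ℝ (⊤ : ℕ∞) φ) :
    ContDiff ℝ (⊤ : ℕ∞) (dSharp (ofFun φ)) := by
  rw [dSharp_ofFun hφ]
  exact contDiff_sum_smul (contDiff_pd hφ) _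

lemma coeffMatrix_ddSharp {φ : Base n → ℝ} (hφ : ContDiff ℝ (⊤ : ℕ∞) φ) (x : Base n) :
    coeffMatrix (ddSharp φ x) = Matrix.of fun i j => pd i (pd j φ) x := by
  ext i j
  have hd : DifferentiableAt ℝ (dSharp (ofFun φ)) x :=
    ((contDiff_dSharp_ofFun hφ).differentiable (by simp)).differentiableAt
  rw [coeffMatrix, of_apply, ddSharp, d_apply, Fin.sum_univ_one]
  simp only [← fderiv_apply_apply hd, dSharp_ofFun_apply hφ]
  simp [pd]
  rfl

/-- The coefficient matrix of an `ℝ`-Kähler form is a Hessian metric: `dω = 0` says that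
`∂ₖ ω_{ij} = ∂ᵢ ω_{kj}`. -/
lemma weightedHessianMetric_of_isRKahler {ω : Base n → SForm n 1 1} (hω : IsRKahler ω)
    {φ : Base n → ℝ} (hφ : ContDiff ℝ (⊤ : ℕ∞) φ) {ε : ℝ} (hεω : FormGE (ddSharp φ) (ε • ω)) :
    WeightedHessianMetric (fun x => coeffMatrix (ω x)) φ ε := by
  refine ⟨contDiff_coeffMatrix hω.smooth, hω.pos, fun x k i j => ?_, hφ, fun x => ?_⟩
  · have hd : DifferentiableAt ℝ ω x := (hω.smooth.differentiable (by simp)).differentiableAt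
    have h1 := d_apply ω x (fun a : Fin 2 => stdVec (![k, i] a)) fun _ => stdVec j
    rw [hω.closed, Fin.sum_univ_two] at h1
    have h2 : ∀ k i, pd k (fun y => coeffMatrix (ω y) i j) x =
        fderiv ℝ ω x (stdVec k) (fun _ => stdVec i) fun _ => stdVec j := fun k i =>
      fderiv_apply_apply hd (fun _ => stdVec i) (fun _ => stdVec j) (stdVec k)
    have h3 : (fun a : Fin 2 => (stdVec (![k, i] a) : Base n)) ∘ Fin.succAbove 0 =
        fun _ => stdVec i := by
      ext1 a
      fin_cases a
      rfl
    have h4 : (fun a : Fin 2 => (stdVec (![k, i] a) : Base n)) ∘ Fin.succAbove 1 =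
        fun _ => stdVec k := by
      ext1 a
      fin_cases a
      rfl
    rw [h3, h4] at h1
    simp only [Pi.zero_apply, Fin.val_zero, Fin.val_one,
      pow_zero, pow_one, cons_val_zero, cons_val_one, one_mul] at h1
    rw [h2, h2]
    have h5 : (0 : SForm n 2 1) (fun a : Fin 2 => stdVec (![k, i] a)) (fun _ => stdVec j) = 0 := rfl
    linarith [h1.symm.trans h5]
  · have h1 := hεω x
    have h2 : coeffMatrix (ddSharp φ x - (ε • ω) x) =
        coeffMatrix (ddSharp φ x) - ε • coeffMatrix (ω x) := rfl
    rwa [h2, coeffMatrix_ddSharp hφ] at h1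

lemma weaklyClosed_comp {β : Base n → SForm n (m + 1) n} (h : IsWeakD β 0) :
    WeaklyClosed fun x => comp (β x) := by
  intro J η h1 h2
  have h3 := h.integral_eq η h1 h2 (fun a => stdVec (J a)) stdVec
  have h4 : ∀ x, wedgeDx (fderiv ℝ η x) (β x) (fun a => stdVec (J a)) stdVec =
      ∑ b : Fin (m + 2), (-1) ^ (b : ℕ) * (pd (J b) η x * comp (β x) (J ∘ b.succAbove)) := fun x =>
    comp_wedgeDx _ _ _
  simp only [h4] at h3
  rw [h3]
  simp

end Kahler

section Solve

lemma wMem_comp {ω : Base n → SForm n 1 1} (hω : ∀ x, (coeffMatrix (ω x)).PosDef)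
    {φ : Base n → ℝ} {β : Base n → SForm n p n} (hβ : MemL2 ω φ β) :
    WMem (weight (fun x => coeffMatrix (ω x)) φ p) fun x => comp (β x) := by
  refine ⟨fun I => ?_, ?_⟩
  · rcases comp_eq_zero_or (n := n) I with h | ⟨c, K, h⟩
    · simp only [h]
      exact aestronglyMeasurable_const
    · simp only [h]
      exact (hβ.aestronglyMeasurable K default).const_mul c
  · have h1 := hβ.integrable
    unfold SuperIntegrable at h1
    simp only [topCoeff_normDensity hω] at h1
    have h2 := h1.const_mul (p.factorial : ℝ)
    refine h2.congr (Eventually.of_forall fun x => ?_)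
    simp only
    rw [← mul_assoc, mul_inv_cancel₀ (Nat.cast_ne_zero.mpr (Nat.factorial_ne_zero _)), one_mul]

lemma memL2_of_wMem {ω : Base n → SForm n 1 1} (hω : ∀ x, (coeffMatrix (ω x)).PosDef)
    {φ : Base n → ℝ} {α : Base n → SForm n p n}
    (hα : WMem (weight (fun x => coeffMatrix (ω x)) φ p) fun x => comp (α x)) : MemL2 ω φ α := by
  refine ⟨fun I J => ?_, ?_⟩
  · simp only [coeff_eq_comp]
    exact hα.aesm I
  · unfold SuperIntegrable
    simp only [topCoeff_normDensity hω]
    exact hα.integrable.const_mul _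

/-- The smooth compactly supported alternating tensor fields. -/
def testForms (n m : ℕ) : Submodule ℝ (Base n → (Fin m → Fin n) → ℝ) where
  carrier := {W | (∀ I, ContDiff ℝ (⊤ : ℕ∞) fun x => W x I) ∧ (∀ x, IsAlt (W x)) ∧
    ∃ C, IsCompact C ∧ ∀ x ∉ C, W x = 0}
  add_mem' := by
    rintro W V ⟨h1, h2, C, hC, h3⟩ ⟨k1, k2, D, hD, k3⟩
    refine ⟨fun I => (h1 I).add (k1 I), fun x => (h2 x).add (k2 x), C ∪ D, hC.union hD,
      fun x hx => ?_⟩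
    rw [Set.mem_union, not_or] at hx
    rw [Pi.add_apply, h3 x hx.1, k3 x hx.2, add_zero]
  zero_mem' := ⟨fun _ => contDiff_const, fun _ σ I => by simp, ∅, isCompact_empty, fun _ _ => rfl⟩
  smul_mem' := by
    rintro c W ⟨h1, h2, C, hC, h3⟩
    refine ⟨fun I => contDiff_const.mul (h1 I), fun x => (h2 x).smul c, C, hC, fun x hx => ?_⟩
    rw [Pi.smul_apply, h3 x hx, smul_zero]

/-- The divergence as a linear map on test forms. -/
noncomputable def divLinear (n m : ℕ) :
    testForms n (m + 1) →ₗ[ℝ] (Base n → (Fin m → Fin n) → ℝ) where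
  toFun W := divT W.1
  map_add' W V := by
    ext x K
    simp only [divT, Pi.add_apply, ← Finset.sum_add_distrib]
    refine Finset.sum_congr rfl fun k _ => ?_
    exact pd_add k ((W.2.1 _).differentiable (by simp)).differentiableAt
      ((V.2.1 _).differentiable (by simp)).differentiableAt
  map_smul' c W := by
    ext x K
    simp only [divT, Pi.smul_apply, RingHom.id_apply, smul_eq_mul, Finset.mul_sum]
    refine Finset.sum_congr rfl fun k _ => ?_
    exact pd_const_mul k ((W.2.1 _).differentiable (by simp)).differentiableAt c

lemma divT_eq_zero {W : Base n → (Fin (m + 1) → Fin n) → ℝ} {C : Set (Base n)} (hC : IsCompact C)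
    (hW0 : ∀ x ∉ C, W x = 0) {x : Base n} (hx : x ∉ C) : divT W x = 0 := by
  ext K
  exact Finset.sum_eq_zero fun k _ => pd_eq_zero_of_eventually hC.isClosed
    (fun y hy => by simp [hW0 y hy]) hx

lemma integrable_dotProduct_test {u : Base n → (Fin m → Fin n) → ℝ}
    (hu : ∀ I, LocL2 fun x => u x I) {W : Base n → (Fin m → Fin n) → ℝ}
    (hW : ∀ I, Continuous fun x => W x I) {C : Set (Base n)} (hC : IsCompact C)
    (hW0 : ∀ x ∉ C, W x = 0) : Integrable fun x => u x ⬝ᵥ W x := by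
  simp only [dotProduct]
  refine integrable_finsetSum _ fun I _ => ?_
  exact (hu I).locallyIntegrable.integrable_smul_right_of_hasCompactSupport (hW I)
    (HasCompactSupport.intro hC fun x hx => by rw [hW0 x hx]; rfl)

variable {g : Base n → Matrix (Fin n) (Fin n) ℝ} {φ : Base n → ℝ} {ε : ℝ}

/-- Solution of the equation `du = β` in its dual form, tested by divergences of smooth compactly
supported multivector fields, with the bound provided by `sq_integral_le`. -/
lemma exists_dual_solution (h : WeightedHessianMetric g φ ε) (hε : 0 < ε)
    {β : Base n → (Fin (m + 1) → Fin n) → ℝ} (hβ : WMem (weight g φ (m + 1)) β)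
    (hcl : WeaklyClosed β) (ha : ∀ x, IsAlt (β x)) :
    ∃ u, WMem (weight g φ m) u ∧ (∫ x, u x ⬝ᵥ weight g φ m x *ᵥ u x) ≤
        ε⁻¹ * ∫ x, β x ⬝ᵥ weight g φ (m + 1) x *ᵥ β x ∧
      ∀ W ∈ testForms n (m + 1), ∫ x, u x ⬝ᵥ divT W x = - ∫ x, β x ⬝ᵥ W x := by
  have hPd := weight_posDef (φ := φ) h.posDef
  have hPc : ∀ m (I J : Fin m → Fin n), Continuous fun x => weight g φ m x I J := fun m I J =>
    (h.contDiff_weight I J).continuous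
  have hL : ∀ I, LocL2 fun x => β x I := fun I C hC =>
    hβ.memLp_restrict (hPd (m + 1)) (hPc _) hC I
  have hint : ∀ W ∈ testForms n (m + 1), Integrable fun x => β x ⬝ᵥ W x := by
    rintro W ⟨h1, h2, C, hC, h3⟩
    exact integrable_dotProduct_test hL (fun I => (h1 I).continuous) hC h3
  let ℓ : testForms n (m + 1) →ₗ[ℝ] ℝ :=
    { toFun := fun W => - ∫ x, β x ⬝ᵥ W.1 x
      map_add' := fun W V => by
        rw [← neg_add, ← integral_add (hint _ W.2) (hint _ V.2)]
        simp only [Submodule.coe_add, Pi.add_apply, dotProduct_add]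
      map_smul' := fun c W => by
        simp only [Submodule.coe_smul, Pi.smul_apply, dotProduct_smul, RingHom.id_apply,
          smul_eq_mul, integral_const_mul, mul_neg] }
  have hE0 : 0 ≤ ∫ x, β x ⬝ᵥ weight g φ (m + 1) x *ᵥ β x := integral_nonneg fun x =>
    quad_nonneg (hPd (m + 1) x).posSemidef _
  obtain ⟨u, hu, hn, hs⟩ := weighted_riesz (hPd m) (hPc m) (divLinear n m)
    (fun W I => continuous_finsetSum Finset.univ fun k _ => continuous_pd (W.2.1 (Fin.cons k I)) k)
    (fun W => by
      obtain ⟨C, hC, h3⟩ := W.2.2.2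
      exact ⟨C, hC, fun x hx => divT_eq_zero hC h3 hx⟩) ℓ
    (c := ε⁻¹ * ∫ x, β x ⬝ᵥ weight g φ (m + 1) x *ᵥ β x)
    (mul_nonneg (inv_pos.mpr hε).le hE0) fun W => by
      obtain ⟨C, hC, h3⟩ := W.2.2.2
      have := sq_integral_le h hε hβ hcl ha W.2.1 W.2.2.1 hC h3
      simp only [weight_inv h.posDef, smul_mulVec, dotProduct_smul, smul_eq_mul]
      simp only [ℓ, LinearMap.coe_mk, AddHom.coe_mk, neg_sq]
      exact this
  exact ⟨u, hu, hn, fun W hW => hs ⟨W, hW⟩⟩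

/-- The alternating part of a tensor. -/
noncomputable def altPart (u : (Fin m → Fin n) → ℝ) (J : Fin m → Fin n) : ℝ :=
  (m.factorial : ℝ)⁻¹ * ∑ I, u I * gdelta I J

lemma altPart_isAlt (u : (Fin m → Fin n) → ℝ) : IsAlt (altPart u) := by
  intro σ J
  simp only [altPart, gdelta_isAlt_right _ σ J, Finset.mul_sum]
  exact Finset.sum_congr rfl fun I _ => by ring

lemma dotProduct_altPart {v : (Fin m → Fin n) → ℝ} (hv : IsAlt v) (u : (Fin m → Fin n) → ℝ) :
    altPart u ⬝ᵥ v = u ⬝ᵥ v := by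
  simp only [dotProduct, altPart, Finset.mul_sum, Finset.sum_mul]
  rw [Finset.sum_comm]
  refine Finset.sum_congr rfl fun I _ => ?_
  have h1 := sum_mul_gdelta hv I
  have h2 : ∀ J, (m.factorial : ℝ)⁻¹ * (u I * gdelta I J) * v J =
      (m.factorial : ℝ)⁻¹ * u I * (v J * gdelta J I) := fun J => by
    rw [gdelta_comm I J]; ring
  simp only [h2]
  rw [← Finset.mul_sum, h1]
  have : (m.factorial : ℝ) ≠ 0 := Nat.cast_ne_zero.mpr (Nat.factorial_ne_zero _)
  field_simp

/-- Taking the alternating part is an orthogonal projection. -/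
lemma quad_altPart_le {H : Matrix (Fin n) (Fin n) ℝ} (hH : H.PosSemidef)
    (u : (Fin m → Fin n) → ℝ) :
    altPart u ⬝ᵥ tpow H m *ᵥ altPart u ≤ u ⬝ᵥ tpow H m *ᵥ u := by
  have hp := tpow_posSemidef hH m
  have hs : (tpow H m).IsSymm := posSemidef_isSymm hp
  have h1 := dotProduct_altPart ((altPart_isAlt u).mulVec_tpow H) u
  have h2 := quad_nonneg hp (u - altPart u)
  rw [mulVec_sub, sub_dotProduct, dotProduct_sub, dotProduct_sub, quad_comm hs (altPart u) u] at h2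
  linarith

/-- The alternating part of a solution of the dual equation, divided by `m + 1`, is a distributional
primitive: this follows by testing with the fields `η dx_J`. -/
lemma integral_dual_solution {β : Base n → (Fin (m + 1) → Fin n) → ℝ}
    (ha : ∀ x, IsAlt (β x)) {u : Base n → (Fin m → Fin n) → ℝ}
    (hu : ∀ W ∈ testForms n (m + 1), ∫ x, u x ⬝ᵥ divT W x = - ∫ x, β x ⬝ᵥ W x)
    (J : Fin (m + 1) → Fin n) {η : Base n → ℝ} (h1 : ContDiff ℝ (⊤ : ℕ∞) η)
    (h2 : HasCompactSupport η) :
    ∫ x, ∑ b : Fin (m + 1), (-1) ^ (b : ℕ) *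
      (pd (J b) η x * (((m : ℝ) + 1)⁻¹ * altPart (u x) (J ∘ b.succAbove))) =
      - ∫ x, η x * β x J := by
  set W : Base n → (Fin (m + 1) → Fin n) → ℝ := fun x I => η x * gdelta I J with hW
  have hWm : W ∈ testForms n (m + 1) := by
    refine ⟨fun I => h1.mul contDiff_const, fun x σ I => ?_, tsupport η, h2, fun x hx => ?_⟩
    · have := gdelta_isAlt J σ I
      simp only at this
      simp only [hW, this]
      ring
    · ext I
      simp [hW, image_eq_zero_of_notMem_tsupport hx]
  have h3 := hu W hWm
  have h4 : ∀ x, β x ⬝ᵥ W x = (m + 1).factorial * (η x * β x J) := fun x => by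
    have := sum_mul_gdelta (ha x) J
    simp only [dotProduct, hW]
    rw [mul_left_comm, ← this, Finset.mul_sum]
    exact Finset.sum_congr rfl fun I _ => by ring
  have h5 : ∀ x, u x ⬝ᵥ divT W x = (m + 1).factorial * ∑ b : Fin (m + 1), (-1) ^ (b : ℕ) *
      (pd (J b) η x * (((m : ℝ) + 1)⁻¹ * altPart (u x) (J ∘ b.succAbove))) := fun x => by
    have e1 : ∀ K, divT W x K = ∑ b : Fin (m + 1), (-1) ^ (b : ℕ) *
        (pd (J b) η x * gdelta K (J ∘ b.succAbove)) := fun K => by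
      have e2 : ∀ k, pd k (fun y => W y (Fin.cons k K)) x = pd k η x * gdelta (Fin.cons k K) J :=
        fun k => by
          simp only [hW]
          rw [pd_mul k (h1.differentiable (by simp)).differentiableAt (differentiableAt_const _)]
          simp [pd]
      simp only [divT, e2, gdelta_cons_left, Finset.mul_sum]
      rw [Finset.sum_comm]
      refine Finset.sum_congr rfl fun b _ => ?_
      simp only [mul_ite, ite_mul, mul_one, mul_zero, zero_mul, Finset.sum_ite_eq',
        Finset.mem_univ, if_true]
      ring
    simp only [dotProduct, e1, altPart, Finset.mul_sum]
    rw [Finset.sum_comm]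
    refine Finset.sum_congr rfl fun b _ => Finset.sum_congr rfl fun K _ => ?_
    rw [Nat.factorial_succ]
    have f1 : (m.factorial : ℝ) ≠ 0 := Nat.cast_ne_zero.mpr (Nat.factorial_ne_zero _)
    have f2 : (m : ℝ) + 1 ≠ 0 := by positivity
    push_cast
    field_simp
  simp only [h4, h5, integral_const_mul] at h3
  rw [← mul_neg] at h3
  exact mul_left_cancel₀ (Nat.cast_ne_zero.mpr (Nat.factorial_ne_zero _)) h3

/-- The weak equation `dα = β` may be tested on coordinate vectors. -/
lemma isWeakD_of_comp {α : Base n → SForm n p n} {β : Base n → SForm n (p + 1) n}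
    (hα : ∀ I, LocallyIntegrable (fun x => comp (α x) I) volume)
    (hβ : ∀ I, LocallyIntegrable (fun x => comp (β x) I) volume)
    (h : ∀ (J : Fin (p + 1) → Fin n) (η : Base n → ℝ), ContDiff ℝ (⊤ : ℕ∞) η → HasCompactSupport η →
      ∫ x, comp (wedgeDx (fderiv ℝ η x) (α x)) J = - ∫ x, η x * comp (β x) J) : IsWeakD α β := by
  refine ⟨fun I J => ?_, fun I J => ?_, fun η h1 h2 v w => ?_⟩
  · simp only [coeff_eq_comp]
    exact hα I
  · simp only [coeff_eq_comp]
    exact hβ I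
  · have i1 : ∀ J : Fin (p + 1) → Fin n,
        Integrable fun x => comp (wedgeDx (fderiv ℝ η x) (α x)) J := fun J => by
      simp only [comp_wedgeDx]
      refine integrable_finsetSum _ fun b _ => Integrable.const_mul ?_ _
      exact (hα _).integrable_smul_left_of_hasCompactSupport (continuous_pd h1 (J b))
        (HasCompactSupport.intro h2 fun x hx => pd_eq_zero_of_eventually (isClosed_tsupport η)
          (fun y hy => image_eq_zero_of_notMem_tsupport hy) hx)
    have i2 : ∀ J : Fin (p + 1) → Fin n, Integrable fun x => η x * comp (β x) J := fun J =>
      (hβ J).integrable_smul_left_of_hasCompactSupport h1.continuous h2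
    simp only [apply_eq_sum_comp _ v w]
    rw [integral_finsetSum _ fun J _ => (i1 J).const_mul _]
    simp only [integral_const_mul, h _ η h1 h2, Finset.mul_sum, mul_left_comm (η _)]
    rw [integral_finsetSum _ fun J _ => (i2 J).const_mul _, ← Finset.sum_neg_distrib]
    simp only [integral_const_mul, mul_neg]

end Solve

end SuperForms

theorem mainTheorem3 (n p : ℕ) (ω : Base n → SForm n 1 1) (hω : IsRKahler ω)
    (φ : Base n → ℝ) (hφ : ContDiff ℝ (⊤ : ℕ∞) φ) (ε : ℝ) (hε : 0 < ε)
    (hεω : FormGE (ddSharp φ) (ε • ω))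
    (β : Base n → SForm n (p + 1) n) (hβ : MemL2 ω φ β) (hdβ : IsWeakD β 0) :
    ∃ α : Base n → SForm n p n, MemL2 ω φ α ∧ IsWeakD α β ∧
      normSq ω φ α ≤ 1 / (((p + 1 : ℕ) : ℝ) * ε) * normSq ω φ β := by
  have h := weightedHessianMetric_of_isRKahler hω hφ hεω
  have hPd := weight_posDef (φ := φ) h.posDef
  have hPc : ∀ m (I J : Fin m → Fin n),
      Continuous fun x => weight (fun y => coeffMatrix (ω y)) φ m x I J := fun m I J =>
    (h.contDiff_weight I J).continuous
  have hβm := wMem_comp hω.pos hβ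
  obtain ⟨u, hu, hun, hus⟩ := exists_dual_solution h hε hβm (weaklyClosed_comp hdβ)
    fun x => comp_isAlt (β x)
  -- the factor `p!` built into `ofTuples` is divided out; the factor `1 / (p + 1)` is the
  -- one of `integral_dual_solution`
  set α : Base n → SForm n p n := fun x =>
    ofTuples (((p : ℝ) + 1)⁻¹ • (p.factorial : ℝ)⁻¹ • u x) with hα
  have hcomp : ∀ x, comp (α x) = ((p : ℝ) + 1)⁻¹ • altPart (u x) := fun x => by
    ext J
    rw [hα, comp_ofTuples]
    simp only [Pi.smul_apply, smul_eq_mul, altPart, Finset.mul_sum]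
    exact Finset.sum_congr rfl fun I _ => by ring
  have hquad : ∀ x, comp (α x) ⬝ᵥ weight (fun y => coeffMatrix (ω y)) φ p x *ᵥ comp (α x) ≤
      (((p : ℝ) + 1)⁻¹) ^ 2 * (u x ⬝ᵥ weight (fun y => coeffMatrix (ω y)) φ p x *ᵥ u x) := fun x => by
    rw [hcomp]
    simp only [weight_mulVec, mulVec_smul, smul_dotProduct, dotProduct_smul, smul_eq_mul]
    have h1 := mul_le_mul_of_nonneg_left (quad_altPart_le (h.posDef x).inv.posSemidef (u x))
      (mul_nonneg (sq_nonneg ((p : ℝ) + 1)⁻¹) (Real.exp_pos (-φ x)).le)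
    calc _ = _ := by ring
      _ ≤ _ := h1
      _ = _ := by ring
  have hnn : ∀ x, 0 ≤ comp (α x) ⬝ᵥ weight (fun y => coeffMatrix (ω y)) φ p x *ᵥ comp (α x) :=
    fun x => quad_nonneg (hPd p x).posSemidef _
  have hαm : WMem (weight (fun y => coeffMatrix (ω y)) φ p) fun x => comp (α x) := by
    have ha : ∀ I, AEStronglyMeasurable (fun x => comp (α x) I) volume := fun I => by
      simp only [hcomp, Pi.smul_apply, smul_eq_mul, altPart]
      exact ((Finset.aestronglyMeasurable_fun_sum _ fun J _ =>
        (hu.aesm J).mul_const _).const_mul _).const_mul _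
    refine ⟨ha, (hu.integrable.const_mul ((((p : ℝ) + 1)⁻¹) ^ 2)).mono' ?_
      (Filter.Eventually.of_forall fun x => ?_)⟩
    · simp only [quad_eq_sum]
      exact Finset.aestronglyMeasurable_fun_sum _ fun I _ =>
        Finset.aestronglyMeasurable_fun_sum _ fun K _ =>
          (((hPc p I K).aestronglyMeasurable.mul (ha I)).mul (ha K))
    · rw [Real.norm_of_nonneg (hnn x)]
      exact hquad x
  refine ⟨α, memL2_of_wMem hω.pos hαm, isWeakD_of_comp (fun I => LocL2.locallyIntegrable
    fun C hC => hαm.memLp_restrict (hPd p) (hPc p) hC I) (fun I => LocL2.locallyIntegrable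
    fun C hC => hβm.memLp_restrict (hPd _) (hPc _) hC I) fun J η h1 h2 => ?_, ?_⟩
  · rw [← integral_dual_solution (fun x => comp_isAlt (β x)) hus J h1 h2]
    simp only [comp_wedgeDx, hcomp]
    rfl
  · rw [normSq_eq hω.pos, normSq_eq hω.pos]
    -- the norms of `α` and `β` carry `1 / p!` and `1 / (p + 1)!`: with the square of the factor
    -- `1 / (p + 1)` in `α` this leaves `1 / (p + 1)`
    have h1 := integral_mono hαm.integrable (hu.integrable.const_mul _) hquad
    rw [integral_const_mul] at h1
    have h2 := h1.trans (mul_le_mul_of_nonneg_left hun (sq_nonneg ((p : ℝ) + 1)⁻¹))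
    have h3 := mul_le_mul_of_nonneg_left h2 (inv_nonneg.mpr (Nat.cast_nonneg p.factorial))
    refine h3.trans (le_of_eq ?_)
    rw [Nat.factorial_succ]
    push_cast
    field_simp
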